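/- Let $\mathcal L(g_{\mu\nu},R_{\mu\nu\rho\sigma},F_{\alpha\beta})$ be a smooth scalar function of a Lorentzian metric, a Riemann tensor and a field strength at a point of a four-dimensional spacetime, invariant under all changes of basis of the tangent space (it may be defined only on a relatively open invariant set of values, in which case all configurations below are assumed to take values there). Put $P^{\mu\nu\rho\sigma}=\partial\mathcal L/\partial R_{\mu\nu\rho\sigma}$ (with the symmetries of a Riemann tensor), $\mathcal M^{\mu\nu}=-\tfrac12\,\partial\mathcal L/\partial F_{\mu\nu}$, $F_{\mu\nu}=\partial_\mu A_\nu-\partial_\nu A_\mu$, and $$\mathcal E_{\mu\nu}=P_{(\mu}{}^{\rho\sigma\gamma}R_{\nu)\rho\sigma\gamma}-\tfrac12 g_{\mu\nu}\mathcal L+2\nabla^\sigma\nabla^\rho P_{(\mu|\sigma|\nu)\rho}-2\mathcal M_{(\mu}{}^{\alpha}F_{\nu)\alpha},\qquad \mathcal E^\nu=\nabla_\mu\mathcal M^{\mu\nu},$$ so that the full field equations are $\mathcal E_{\mu\nu}=0$, $\mathcal E^\nu=0$. Let $I\subset(0,\infty)$ be open, let $N,f$ be smooth and nowhere zero on $I$,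 and consider on $t\in\mathbb R$, $r\in I$, $\theta\in(0,\pi)$, $\phi\in\mathbb R$ the metric $$ds^2=-N(r)^2f(r)\,dt^2+\frac{dr^2}{f(r)}+r^2(d\theta^2+\sin^2\theta\,d\phi^2)$$ together with either an electric potential $A=\Phi(r)\,dt$ with $\Phi$ smooth on $I$, or a magnetic potential $A=\chi(\theta)\,d\phi$ with $\chi$ smooth on $(0,\pi)$ and $\chi'(\theta)=P\sin\theta$ for a constant $P$. Let $L=\sqrt{|g|}\,\mathcal L$ be the reduced Lagrangian evaluated on this ansatz, as a functional of $N$, $f$ and $\Phi$ (or $\chi$), and let $\mathcal E_N=\delta L/\delta N$, $\mathcal E_f=\delta L/\delta f$, $\mathcal E_\Phi=\delta L/\delta\Phi$, $\mathcal E_\chi=\delta L/\delta\chi$ be its Euler–Lagrange expressions (in $r$ for $N,f,\Phi$; in $\theta$ for $\chi$). Then, at all points: 1. $\mathcal E_N=\sqrt{|g|}\,\dfrac{2}{N^3f}\,\mathcal E_{tt}$ and $\mathcal E_f=\sqrt{|g|}\left[\dfrac{1}{N^2f^2}\,\mathcal E_{tt}+\mathcal E_{rr}\right]$; hence $\mathcal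 E_N=\mathcal E_f=0$ if and only if $\mathcal E_{tt}=\mathcal E_{rr}=0$. 2. The Lie derivatives of $\mathcal E_{\mu\nu}$ along the four Killing vectors $\partial_t$, $\partial_\phi$, $-\sin\phi\,\partial_\theta-\cos\phi\cot\theta\,\partial_\phi$, $\cos\phi\,\partial_\theta-\sin\phi\cot\theta\,\partial_\phi$ vanish; all off-diagonal components of $\mathcal E_{\mu\nu}$ vanish; and $\mathcal E_{\phi\phi}=\sin^2\theta\,\mathcal E_{\theta\theta}$. 3. The identity $\nabla^\mu\mathcal E_{\mu\nu}=-2F_{\nu\lambda}\mathcal E^\lambda$ holds. If $\mathcal E^\nu=0$ everywhere, then $\mathcal E_N=\mathcal E_f=0$ everywhere if and only if $\mathcal E_{\mu\nu}=0$ everywhere for all $\mu,\nu$ (including the angular components). 4. In the electric case, $\mathcal E_\Phi=0$ everywhere if and only if $\mathcal E^\nu=0$ everywhere for all $\nu$; consequently the reduced equations $\mathcal E_N=\mathcal E_f=\mathcal E_\Phi=0$ are equivalent to the full field equations $\mathcal E_{\mu\nu}=0$, $\mathcal E^\nu=0$. In the magnetic case, $\mathcal E_\chi=0$ and $\mathcal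 E^\nu=0$ hold identically, and the reduced equations $\mathcal E_N=\mathcal E_f=0$ are equivalent to the full field equations. -/

import Mathlib

open scoped ContDiff

noncomputable section

namespace ReducedAction

/-- Points of a four-dimensional coordinate domain. For the static and spherically symmetric ansatz
the coordinates are `x 0 = t`, `x 1 = r`, `x 2 = θ`, `x 3 = φ`. -/
abbrev Pt := Fin 4 → ℝ

abbrev Mat := Matrix (Fin 4) (Fin 4) ℝ

/-- Arrays with `k` space-time indices; the component `T_{abcd}` of `T : Tensor 4` is
`T ![a, b, c, d]`. -/
abbrev Tensor (k : ℕ) := (Fin k → Fin 4) → ℝ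

/-! ### Tensor calculus in coordinates -/

/-- The partial derivative `∂_μ h` at `x`. -/
def pd (μ : Fin 4) (h : Pt → ℝ) (x : Pt) : ℝ :=
  deriv (fun s => h (Function.update x μ s)) (x μ)

/-- The Christoffel symbols `Γ^a_{bc}` of the Levi-Civita connection. -/
def christoffel (g : Pt → Mat) (x : Pt) (a b c : Fin 4) : ℝ :=
  (1 / 2) * ∑ d, (g x)⁻¹ a d *
    (pd b (fun y => g y d c) x + pd c (fun y => g y d b) x - pd d (fun y => g y b c) x)

/-- `R^a_{bcd} = ∂_c Γ^a_{db} - ∂_d Γ^a_{cb} + Γ^a_{ce} Γ^e_{db} - Γ^a_{de} Γ^e_{cb}`. -/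
def riemannUp (g : Pt → Mat) (x : Pt) (a b c d : Fin 4) : ℝ :=
  pd c (fun y => christoffel g y a d b) x - pd d (fun y => christoffel g y a c b) x
    + ∑ e, (christoffel g x a c e * christoffel g x e d b
        - christoffel g x a d e * christoffel g x e c b)

/-- The Riemann tensor `R_{abcd} = g_{ae} R^e_{bcd}`. -/
def riemann (g : Pt → Mat) (x : Pt) : Tensor 4 :=
  fun i => ∑ e, g x (i 0) e * riemannUp g x e (i 1) (i 2) (i 3)

/-- The field strength `F_{ab} = ∂_a A_b - ∂_b A_a`. -/
def fieldStrength (A : Pt → Fin 4 → ℝ) (x : Pt) : Mat :=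
  Matrix.of fun a b => pd a (fun y => A y b) x - pd b (fun y => A y a) x

/-- The covariant derivative `∇_e T_{a₁…a_k}` of a tensor field with lower indices. The derivative
index is the first index of the result. -/
def covD {k : ℕ} (g : Pt → Mat) (T : Pt → Tensor k) (x : Pt) : Tensor (k + 1) :=
  fun i => pd (i 0) (fun y => T y (Fin.tail i)) x
    - ∑ j : Fin k, ∑ a, christoffel g x a (i 0) (i j.succ)
        * T x (Function.update (Fin.tail i) j a)

/-- The Lie derivative `(L_k T)_{μν}` of a tensor field with two lower indices. -/
def lieD (k : Pt → Fin 4 → ℝ) (T : Pt → Mat) (x : Pt) (μ ν : Fin 4) : ℝ :=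
  ∑ l, (k x l * pd l (fun y => T y μ ν) x
    + T x l ν * pd μ (fun y => k y l) x + T x μ l * pd ν (fun y => k y l) x)

/-! ### Lagrangians `ℒ(R_{μνρσ}, F_{αβ})` -/

/-- Symmetric matrices of signature `(-,+,+,+)`. -/
def IsLorentzian (g : Mat) : Prop :=
  ∃ A : Mat, IsUnit A.det ∧ g = A.transpose * Matrix.diagonal ![-1, 1, 1, 1] * A

/-- The algebraic symmetries of a Riemann tensor. -/
def IsCurvatureTensor (R : Tensor 4) : Prop :=
  ∀ a b c d, R ![a, b, c, d] = - R ![b, a, c, d] ∧ R ![a, b, c, d] = - R ![a, b, d, c] ∧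
    R ![a, b, c, d] = R ![c, d, a, b] ∧
    R ![a, b, c, d] + R ![a, c, d, b] + R ![a, d, b, c] = 0

/- The norm only serves to speak of smooth functions of matrices. -/
section LagrangianDef

attribute [local instance] Matrix.normedAddCommGroup Matrix.normedSpace

/-- The possible values `(g, R, F)` at a point of metric, curvature and field strength. -/
def pointValues : Set (Mat × Tensor 4 × Mat) :=
  {p | IsLorentzian p.1 ∧ IsCurvatureTensor p.2.1 ∧ p.2.2.transpose = - p.2.2}

/-- Change of basis on arrays with lower indices:
`(A • T)_{a₁…a_k} = A^{b₁}_{a₁} ⋯ A^{b_k}_{a_k} T_{b₁…b_k}`. -/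
def pullback {k : ℕ} (A : Mat) (T : Tensor k) : Tensor k :=
  fun i => ∑ j : Fin k → Fin 4, (∏ l, A (j l) (i l)) * T j

/-- A Lagrangian `ℒ(R_{μνρσ}, F_{αβ})`: a smooth scalar function of the metric, the Riemann tensor
and the field strength at a point, invariant under all changes of basis of the tangent space. It may
be defined on a part `dom` only, which is (relatively) open and invariant. -/
structure Lagrangian where
  toFun : Mat → Tensor 4 → Mat → ℝ
  dom : Set (Mat × Tensor 4 × Mat)
  dom_open : ∃ U : Set (Mat × Tensor 4 × Mat), IsOpen U ∧ dom = U ∩ pointValues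
  smooth : ContDiffOn ℝ ∞ (fun p : Mat × Tensor 4 × Mat => toFun p.1 p.2.1 p.2.2) dom
  dom_invariant : ∀ A : Mat, IsUnit A.det → ∀ g R F, (g, R, F) ∈ dom →
    (A.transpose * g * A, pullback A R, A.transpose * F * A) ∈ dom
  invariant : ∀ A : Mat, IsUnit A.det → ∀ g R F, (g, R, F) ∈ dom →
    toFun (A.transpose * g * A) (pullback A R) (A.transpose * F * A) = toFun g R F

end LagrangianDef

/-- The projection of four-index arrays onto the arrays with the symmetries of a Riemann tensor:
impose the pair symmetries, then remove the totally antisymmetric part. -/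
def curvProj (T : Tensor 4) : Tensor 4 :=
  let S : Fin 4 → Fin 4 → Fin 4 → Fin 4 → ℝ := fun a b c d =>
    (1 / 8) * (T ![a, b, c, d] - T ![b, a, c, d] - T ![a, b, d, c] + T ![b, a, d, c]
      + T ![c, d, a, b] - T ![d, c, a, b] - T ![c, d, b, a] + T ![d, c, b, a])
  fun i => S (i 0) (i 1) (i 2) (i 3)
    - (1 / 3) * (S (i 0) (i 1) (i 2) (i 3) + S (i 0) (i 2) (i 3) (i 1) + S (i 0) (i 3) (i 1) (i 2))

/-- `P^{abcd} = ∂ℒ/∂R_{abcd}`: the array with the symmetries of a Riemann tensor for which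
`P^{abcd} δR_{abcd}` is the derivative of `ℒ` in every direction `δR` with these symmetries. -/
def dRiem (L : Lagrangian) (g : Mat) (R : Tensor 4) (F : Mat) : Tensor 4 :=
  fun i => deriv (fun s : ℝ => L.toFun g (R + s • curvProj (Pi.single i 1)) F) 0

/-- `∂ℒ/∂F_{ab}`: the antisymmetric array for which `(∂ℒ/∂F_{ab}) δF_{ab}` (sum over all `a, b`) is
the derivative of `ℒ` in every antisymmetric direction `δF`. -/
def dField (L : Lagrangian) (g : Mat) (R : Tensor 4) (F : Mat) : Mat :=
  Matrix.of fun a b => deriv (fun s : ℝ =>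
    L.toFun g R (F + s • ((1 / 2 : ℝ) • (Matrix.single a b 1 - Matrix.single b a 1)))) 0

/-! ### Field equations of a metric `g` and a vector potential `A` -/

section FieldEquations

variable (L : Lagrangian) (g : Pt → Mat) (A : Pt → Fin 4 → ℝ)

/-- The value `(g, R, F)` of metric, curvature and field strength at `x`. -/
def config (x : Pt) : Mat × Tensor 4 × Mat := (g x, riemann g x, fieldStrength A x)

/-- `ℒ` evaluated on the configuration. -/
def lag (x : Pt) : ℝ := L.toFun (g x) (riemann g x) (fieldStrength A x)

/-- `√|g|`. -/
def sqrtDet (x : Pt) : ℝ := Real.sqrt |(g x).det|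

/-- `P^{abcd}`. -/
def Pup (x : Pt) : Tensor 4 := dRiem L (g x) (riemann g x) (fieldStrength A x)

/-- `P_{abcd}`. -/
def Plow (x : Pt) : Tensor 4 := fun i => ∑ j : Fin 4 → Fin 4, (∏ l, g x (i l) (j l)) * Pup L g A x j

/-- `M^{ab} = -(1/2) ∂ℒ/∂F_{ab}`. -/
def Mup (x : Pt) : Mat := -(1 / 2 : ℝ) • dField L (g x) (riemann g x) (fieldStrength A x)

/-- `M_{ab}`. -/
def Mlow (x : Pt) : Tensor 2 := fun i => ∑ a, ∑ b, g x (i 0) a * g x (i 1) b * Mup L g A x a b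

/-- `P_μ^{ρσγ} R_{νρσγ} + 2 ∇^σ ∇^ρ P_{μσνρ} - 2 M_μ^α F_{να}`. -/
def gravAux (x : Pt) (μ ν : Fin 4) : ℝ :=
  (∑ a, ∑ ρ, ∑ σ, ∑ γ, g x μ a * Pup L g A x ![a, ρ, σ, γ] * riemann g x ![ν, ρ, σ, γ])
  + 2 * (∑ σ, ∑ ρ, ∑ σ', ∑ ρ', (g x)⁻¹ σ σ' * (g x)⁻¹ ρ ρ'
      * covD g (covD g (Plow L g A)) x ![σ', ρ', μ, σ, ν, ρ])
  - 2 * (∑ a, ∑ b, g x μ b * Mup L g A x b a * fieldStrength A x ν a)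

/-- The gravitational field equations
`ℰ_{μν} = P_{(μ}^{ρσγ} R_{ν)ρσγ} - (1/2) g_{μν} ℒ + 2 ∇^σ ∇^ρ P_{(μ|σ|ν)ρ} - 2 M_{(μ}^α F_{ν)α}`. -/
def gravEq (x : Pt) : Mat :=
  Matrix.of fun μ ν =>
    (1 / 2) * (gravAux L g A x μ ν + gravAux L g A x ν μ) - (1 / 2) * g x μ ν * lag L g A x

/-- The generalized Maxwell equations `ℰ^ν = ∇_μ M^{μν}`. -/
def maxwellEq (x : Pt) (ν : Fin 4) : ℝ :=
  ∑ μ, ∑ a, ∑ b, (g x)⁻¹ μ a * (g x)⁻¹ ν b * covD g (Mlow L g A) x ![a, μ, b]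

/-- The divergence `∇^μ ℰ_{μν}`. -/
def divGravEq (x : Pt) (ν : Fin 4) : ℝ :=
  ∑ μ, ∑ a, (g x)⁻¹ μ a * covD g (fun y (i : Fin 2 → Fin 4) => gravEq L g A y (i 0) (i 1)) x ![a, μ, ν]

end FieldEquations

/-! ### The static and spherically symmetric ansatz -/

/-- `ds² = -N(r)² f(r) dt² + dr² / f(r) + r² (dθ² + sin² θ dφ²)`. -/
def sssMetric (N f : ℝ → ℝ) (x : Pt) : Mat :=
  Matrix.diagonal ![-(N (x 1) ^ 2 * f (x 1)), 1 / f (x 1), x 1 ^ 2, x 1 ^ 2 * Real.sin (x 2) ^ 2]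

/-- `A = Φ(r) dt`. -/
def electricPotential (Φ : ℝ → ℝ) (x : Pt) : Fin 4 → ℝ := ![Φ (x 1), 0, 0, 0]

/-- `A = χ(θ) dφ`. -/
def magneticPotential (χ : ℝ → ℝ) (x : Pt) : Fin 4 → ℝ := ![0, 0, 0, χ (x 2)]

/-- The coordinate domain `t ∈ ℝ`, `r ∈ I`, `θ ∈ (0, π)`, `φ ∈ ℝ`. -/
def region (I : Set ℝ) : Set Pt := {x | x 1 ∈ I ∧ x 2 ∈ Set.Ioo 0 Real.pi}

/-- The Killing vectors of the ansatz: `∂_t`, `∂_φ`, `-sin φ ∂_θ - cos φ cot θ ∂_φ`,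
`cos φ ∂_θ - sin φ cot θ ∂_φ`. -/
def killing (i : Fin 4) (x : Pt) : Fin 4 → ℝ :=
  ![![1, 0, 0, 0],
    ![0, 0, 0, 1],
    ![0, 0, -Real.sin (x 3), -(Real.cos (x 3) * Real.cot (x 2))],
    ![0, 0, Real.cos (x 3), -(Real.sin (x 3) * Real.cot (x 2))]] i

/-! ### The reduced Lagrangian and its Euler-Lagrange equations -/

/-- The Euler-Lagrange expression `∂ℓ/∂u - (∂ℓ/∂u')' + (∂ℓ/∂u'')''` at `s` of a Lagrangian density
`𝓁 u s` that depends on the function `u` through `u(s), u'(s), u''(s)`. As a function of these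
numbers the density is the value `ℓ s a b c` on the quadratic polynomial with value `a`, first
derivative `b` and second derivative `c` at `s`. -/
def eulerLagrange (𝓁 : (ℝ → ℝ) → ℝ → ℝ) (u : ℝ → ℝ) (s : ℝ) : ℝ :=
  let ℓ : ℝ → ℝ → ℝ → ℝ → ℝ := fun s a b c => 𝓁 (fun y => a + b * (y - s) + c / 2 * (y - s) ^ 2) s
  let u₁ : ℝ → ℝ := deriv u
  let u₂ : ℝ → ℝ := deriv u₁
  deriv (fun a => ℓ s a (u₁ s) (u₂ s)) (u s)
    - deriv (fun y => deriv (fun b => ℓ y (u y) b (u₂ y)) (u₁ y)) s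
    + deriv (deriv (fun y => deriv (fun c => ℓ y (u y) (u₁ y) c) (u₂ y))) s

/-- The reduced Lagrangian `√|g| ℒ` on the ansatz. -/
def reducedLag (L : Lagrangian) (N f : ℝ → ℝ) (A : Pt → Fin 4 → ℝ) (x : Pt) : ℝ :=
  sqrtDet (sssMetric N f) x * lag L (sssMetric N f) A x

/-- `ℰ_N = δL/δN`. -/
def eqN (L : Lagrangian) (N f : ℝ → ℝ) (A : Pt → Fin 4 → ℝ) (x : Pt) : ℝ :=
  eulerLagrange (fun u s => reducedLag L u f A (Function.update x 1 s)) N (x 1)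

/-- `ℰ_f = δL/δf`. -/
def eqf (L : Lagrangian) (N f : ℝ → ℝ) (A : Pt → Fin 4 → ℝ) (x : Pt) : ℝ :=
  eulerLagrange (fun u s => reducedLag L N u A (Function.update x 1 s)) f (x 1)

/-- `ℰ_Φ = δL/δΦ` (electric ansatz). -/
def eqPhi (L : Lagrangian) (N f Φ : ℝ → ℝ) (x : Pt) : ℝ :=
  eulerLagrange (fun u s => reducedLag L N f (electricPotential u) (Function.update x 1 s)) Φ (x 1)

/-- `ℰ_χ = δL/δχ` (magnetic ansatz). -/
def eqChi (L : Lagrangian) (N f χ : ℝ → ℝ) (x : Pt) : ℝ :=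
  eulerLagrange (fun u s => reducedLag L N f (magneticPotential u) (Function.update x 2 s)) χ (x 2)

end ReducedAction

end

open ReducedAction
open scoped ContDiff

noncomputable section

namespace ReducedAction

/-! ### Partial derivatives on the coordinate domain -/

/-! The metric is diagonal and every component is a function of r times a function of θ. Its
curvature is therefore diagonal on the coordinate planes, with four sectional curvatures `curv`
depending on r alone (`Background.riemannUp_eq`). In an orthonormal frame a configuration consists
of these four numbers and one field strength, Φ'/N or P/r², so that invariance turns ℒ into a
function `frameLag` of five real variables.

The derivatives of ℒ are equivariant, hence fixed by every change of frame that fixes the frame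
data. Reflections and a quarter turn of the sphere leave only the diagonal components of ∂ℒ/∂R,
apart from P^{tθrθ} and P^{tφrφ} in the electric case; these are excluded by boost invariance of ℒ
(`frameRiem_boost`), although the curvature itself need not be boost invariant. The surviving
coefficients are partial derivatives of `frameLag`, which makes them smooth in r. `Resolved`
collects this information in a form common to both ansätze.

For a diagonal P the double divergence can be computed explicitly. The result is that ℰ_{μν} is
diagonal, that its mixed components `gravR` depend on r only, and that the two angular ones agree
(`Resolved.gravEq_eq`); this contains the symmetry statements. The only component of ℰ^ν is ℰ^t,
proportional to pe' + 2 pe / r. The Noether identity has one nontrivial component, the radial one,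
and it follows from the chain rule for the r-derivative of ℒ (`Resolved.hasDerivAt_gravR_one`). The
angular component of ℰ enters it undifferentiated with coefficient 2/r, so it vanishes as soon as
the tt, rr and Maxwell equations hold on an interval (`Resolved.gravR_two_eq_zero`).

On the reduced side the density is |N| r² sin θ times `frameLag`, evaluated on curvatures that are
explicit functions of the 2-jets of N and f. Differentiating these functions gives the
Euler–Lagrange expressions: δN produces ℰ^t_t, δf produces ℰ^r_r - ℰ^t_t, and δΦ produces the
Maxwell equation (`Framed.eqN_eq`, `Framed.eqf_eq`, `Framed.eqPhi_eq`). In the magnetic case ∂L/∂χ'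
does not depend on θ on the ansatz, so its derivative vanishes.

All claims are local in r. Hence f and N may be assumed to have constant signs σ and ν
(`Background.exists_sign`); for σ = -1 the timelike direction is r. -/

theorem isOpen_region {I : Set ℝ} (hI : IsOpen I) : IsOpen (region I) :=
  (hI.preimage (continuous_apply 1)).inter (isOpen_Ioo.preimage (continuous_apply 2))

theorem pd_congr {U : Set Pt} (hU : IsOpen U) {h k : Pt → ℝ} (hk : ∀ y ∈ U, h y = k y)
    {x : Pt} (hx : x ∈ U) (μ : Fin 4) : pd μ h x = pd μ k x := by
  have hc : Filter.Tendsto (fun s => Function.update x μ s) (nhds (x μ)) (nhds x) := by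
    have : Continuous fun s => Function.update x μ s := by fun_prop
    simpa using this.tendsto (x μ)
  refine Filter.EventuallyEq.deriv_eq ?_
  filter_upwards [hc (hU.mem_nhds hx)] with s hs using hk _ hs

theorem pd_eq_fderiv {h : Pt → ℝ} {x : Pt} (hd : DifferentiableAt ℝ h x) (μ : Fin 4) :
    pd μ h x = fderiv ℝ h x (Pi.single μ 1) := by
  have h1 := hasDerivAt_update x μ (x μ)
  have h2 : HasFDerivAt h (fderiv ℝ h x) (Function.update x μ (x μ)) := by
    simpa using hd.hasFDerivAt
  exact (h2.comp_hasDerivAt (x μ) h1).deriv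

theorem contDiffOn_pd {U : Set Pt} (hU : IsOpen U) {h : Pt → ℝ} (hh : ContDiffOn ℝ ∞ h U)
    (μ : Fin 4) : ContDiffOn ℝ ∞ (pd μ h) U := by
  have h1 : ContDiffOn ℝ ∞ (fun x => fderiv ℝ h x (Pi.single μ 1)) U :=
    (hh.fderiv_of_isOpen hU (by simp)).clm_apply contDiffOn_const
  refine h1.congr fun x hx => pd_eq_fderiv ?_ μ
  exact (hh.contDiffAt (hU.mem_nhds hx)).differentiableAt (by simp)

theorem pd_mul {h k : Pt → ℝ} {x : Pt} (hh : DifferentiableAt ℝ h x)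
    (hk : DifferentiableAt ℝ k x) (μ : Fin 4) :
    pd μ (fun y => h y * k y) x = pd μ h x * k x + h x * pd μ k x := by
  rw [pd_eq_fderiv (hh.fun_mul hk), pd_eq_fderiv hh, pd_eq_fderiv hk, fderiv_fun_mul hh hk]
  simp; ring

theorem pd_sum {ι : Type*} (s : Finset ι) {h : ι → Pt → ℝ} {x : Pt}
    (hh : ∀ i ∈ s, DifferentiableAt ℝ (h i) x) (μ : Fin 4) :
    pd μ (fun y => ∑ i ∈ s, h i y) x = ∑ i ∈ s, pd μ (h i) x := by
  rw [pd_eq_fderiv (DifferentiableAt.fun_sum hh), fderiv_fun_sum hh]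
  simp only [sum_apply]
  exact Finset.sum_congr rfl fun i hi => (pd_eq_fderiv (hh i hi) μ).symm

/-- Partial derivatives of a function that is a product of a function of `r` and one of `θ`. -/
theorem pd_separated {I : Set ℝ} (hI : IsOpen I) {h : Pt → ℝ} {φ ψ : ℝ → ℝ}
    (heq : ∀ y ∈ region I, h y = φ (y 1) * ψ (y 2)) {x : Pt} (hx : x ∈ region I) {φ' ψ' : ℝ}
    (hφ : HasDerivAt φ φ' (x 1)) (hψ : HasDerivAt ψ ψ' (x 2)) (μ : Fin 4) :
    pd μ h x = ![0, φ' * ψ (x 2), φ (x 1) * ψ', 0] μ := by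
  rw [pd_congr (isOpen_region hI) heq hx]
  unfold pd
  fin_cases μ
  · simp [Function.update]
  · simpa [Function.update] using (hφ.mul_const (ψ (x 2))).deriv
  · simpa [Function.update] using (hψ.const_mul (φ (x 1))).deriv
  · simp [Function.update]

theorem hasDerivAt_of_smooth {I : Set ℝ} (hI : IsOpen I) {u : ℝ → ℝ} (hu : ContDiffOn ℝ ∞ u I)
    {r : ℝ} (hr : r ∈ I) : HasDerivAt u (deriv u r) r :=
  ((hu.contDiffAt (hI.mem_nhds hr)).differentiableAt (by simp)).hasDerivAt

theorem contDiffOn_deriv {I : Set ℝ} (hI : IsOpen I) {u : ℝ → ℝ} (hu : ContDiffOn ℝ ∞ u I) :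
    ContDiffOn ℝ ∞ (deriv u) I :=
  hu.deriv_of_isOpen hI (by simp)

/-! ### Metric, connection and curvature of the ansatz -/

/-- The lapse `N` and the function `f` of the ansatz on an open set of positive radii. -/
structure Background (N f : ℝ → ℝ) (I : Set ℝ) : Prop where
  isOpen : IsOpen I
  radius_ne : ∀ r ∈ I, r ≠ 0
  smooth_N : ContDiffOn ℝ ∞ N I
  smooth_f : ContDiffOn ℝ ∞ f I
  N_ne : ∀ r ∈ I, N r ≠ 0
  f_ne : ∀ r ∈ I, f r ≠ 0

/-- The diagonal components of the metric, as products of functions of `r` and of `θ`. -/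
def metricR (N f : ℝ → ℝ) (r : ℝ) : Fin 4 → ℝ := ![-(N r ^ 2 * f r), 1 / f r, r ^ 2, r ^ 2]

/-- The factors of the metric components that depend on `θ`. -/
def metricT (θ : ℝ) : Fin 4 → ℝ := ![1, 1, 1, Real.sin θ ^ 2]

/-- The diagonal components of the metric. -/
def metricD (N f : ℝ → ℝ) (x : Pt) (a : Fin 4) : ℝ := metricR N f (x 1) a * metricT (x 2) a

/-- The `r`-derivatives of `metricR`. -/
def metricR' (N f : ℝ → ℝ) (r : ℝ) : Fin 4 → ℝ :=
  ![-(2 * N r * deriv N r * f r + N r ^ 2 * deriv f r), -(deriv f r) / f r ^ 2, 2 * r, 2 * r]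

/-- The `θ`-derivatives of `metricT`. -/
def metricT' (θ : ℝ) : Fin 4 → ℝ := ![0, 0, 0, 2 * Real.sin θ * Real.cos θ]

theorem sssMetric_eq (N f : ℝ → ℝ) (x : Pt) :
    sssMetric N f x = Matrix.diagonal (metricD N f x) := by
  unfold sssMetric
  congr 1
  funext a
  fin_cases a <;> simp [metricD, metricR, metricT]

theorem sssMetric_apply (N f : ℝ → ℝ) (x : Pt) (a b : Fin 4) :
    sssMetric N f x a b = if a = b then metricD N f x a else 0 := by
  rw [sssMetric_eq, Matrix.diagonal_apply]

section
variable {N f : ℝ → ℝ} {I : Set ℝ}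

theorem sin_ne_of_mem_region {x : Pt} (hx : x ∈ region I) : Real.sin (x 2) ≠ 0 :=
  (Real.sin_pos_of_mem_Ioo hx.2).ne'

theorem Background.metricD_ne (H : Background N f I) {x : Pt} (hx : x ∈ region I) (a : Fin 4) : metricD N f x a ≠ 0 := by
  have h1 := H.radius_ne _ hx.1
  have h2 := H.N_ne _ hx.1
  have h3 := H.f_ne _ hx.1
  have h4 := sin_ne_of_mem_region hx
  fin_cases a <;> simp [metricD, metricR, metricT, h1, h2, h3, h4]

theorem Background.inv_sssMetric (H : Background N f I) {x : Pt} (hx : x ∈ region I) :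
    (sssMetric N f x)⁻¹ = Matrix.diagonal fun a => (metricD N f x a)⁻¹ := by
  refine Matrix.inv_eq_right_inv ?_
  rw [sssMetric_eq, Matrix.diagonal_mul_diagonal, ← Matrix.diagonal_one]
  congr 1
  funext a
  exact mul_inv_cancel₀ (H.metricD_ne hx a)

theorem Background.inv_sssMetric_apply (H : Background N f I) {x : Pt} (hx : x ∈ region I) (a b : Fin 4) :
    (sssMetric N f x)⁻¹ a b = if a = b then (metricD N f x a)⁻¹ else 0 := by
  rw [H.inv_sssMetric hx, Matrix.diagonal_apply]

theorem Background.hasDerivAt_metricR (H : Background N f I) {r : ℝ} (hr : r ∈ I) (a : Fin 4) :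
    HasDerivAt (fun r => metricR N f r a) (metricR' N f r a) r := by
  have hN := hasDerivAt_of_smooth H.isOpen H.smooth_N hr
  have hf := hasDerivAt_of_smooth H.isOpen H.smooth_f hr
  have h3 := H.f_ne _ hr
  fin_cases a
  · exact ((hN.pow 2).mul hf).neg.congr_deriv (by simp [metricR'])
  · exact ((hasDerivAt_const r (1 : ℝ)).div hf h3).congr_deriv (by simp [metricR'])
  · exact (hasDerivAt_pow 2 r).congr_deriv (by simp [metricR'])
  · exact (hasDerivAt_pow 2 r).congr_deriv (by simp [metricR'])

theorem hasDerivAt_metricT (θ : ℝ) (a : Fin 4) :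
    HasDerivAt (fun θ => metricT θ a) (metricT' θ a) θ := by
  fin_cases a
  · exact hasDerivAt_const θ (1 : ℝ)
  · exact hasDerivAt_const θ (1 : ℝ)
  · exact hasDerivAt_const θ (1 : ℝ)
  · exact ((Real.hasDerivAt_sin θ).pow 2).congr_deriv (by simp [metricT'])

theorem Background.pd_sssMetric (H : Background N f I) {x : Pt} (hx : x ∈ region I) (μ a b : Fin 4) :
    pd μ (fun y => sssMetric N f y a b) x
      = if a = b then ![0, metricR' N f (x 1) a * metricT (x 2) a,
          metricR N f (x 1) a * metricT' (x 2) a, 0] μ else 0 := by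
  split_ifs with h
  · exact pd_separated H.isOpen (φ := fun r => metricR N f r a) (ψ := fun θ => metricT θ a)
      (fun y _ => by rw [sssMetric_apply, if_pos h, metricD]) hx
      (H.hasDerivAt_metricR hx.1 a) (hasDerivAt_metricT _ a) μ
  · simp [pd, sssMetric_apply, h]

/-- The Christoffel symbols, as products of functions of `r` and of `θ`. -/
def chrR (N f : ℝ → ℝ) (r : ℝ) : Fin 4 → Fin 4 → Fin 4 → ℝ :=
  ![![![0, deriv N r / N r + deriv f r / (2 * f r), 0, 0],
      ![deriv N r / N r + deriv f r / (2 * f r), 0, 0, 0], 0, 0],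
    ![![N r * f r * (deriv N r * f r + N r * deriv f r / 2), 0, 0, 0],
      ![0, -(deriv f r / (2 * f r)), 0, 0], ![0, 0, -(r * f r), 0], ![0, 0, 0, -(r * f r)]],
    ![0, ![0, 0, 1 / r, 0], ![0, 1 / r, 0, 0], ![0, 0, 0, 1]],
    ![0, ![0, 0, 0, 1 / r], ![0, 0, 0, 1], ![0, 1 / r, 1, 0]]]

/-- The factors of the Christoffel symbols that depend on `θ`. -/
def chrT (θ : ℝ) : Fin 4 → Fin 4 → Fin 4 → ℝ :=
  ![1, ![1, 1, 1, ![1, 1, 1, Real.sin θ ^ 2]], ![1, 1, 1, ![1, 1, 1, -(Real.sin θ * Real.cos θ)]],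
    ![1, 1, ![1, 1, 1, Real.cos θ / Real.sin θ], ![1, 1, Real.cos θ / Real.sin θ, 1]]]

/-- The `r`-derivatives of `chrR`. -/
def chrR' (N f : ℝ → ℝ) (r : ℝ) : Fin 4 → Fin 4 → Fin 4 → ℝ :=
  ![![![0, (deriv (deriv N) r * N r - deriv N r * deriv N r) / N r ^ 2
        + (deriv (deriv f) r * f r - deriv f r * deriv f r) / (2 * f r ^ 2), 0, 0],
      ![(deriv (deriv N) r * N r - deriv N r * deriv N r) / N r ^ 2
        + (deriv (deriv f) r * f r - deriv f r * deriv f r) / (2 * f r ^ 2), 0, 0, 0], 0, 0],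
    ![![(deriv N r * f r + N r * deriv f r) * (deriv N r * f r + N r * deriv f r / 2)
        + N r * f r * (deriv (deriv N) r * f r + deriv N r * deriv f r
          + (deriv N r * deriv f r + N r * deriv (deriv f) r) / 2), 0, 0, 0],
      ![0, -((deriv (deriv f) r * f r - deriv f r * deriv f r) / (2 * f r ^ 2)), 0, 0],
      ![0, 0, -(f r + r * deriv f r), 0], ![0, 0, 0, -(f r + r * deriv f r)]],
    ![0, ![0, 0, -1 / r ^ 2, 0], ![0, -1 / r ^ 2, 0, 0], 0],
    ![0, ![0, 0, 0, -1 / r ^ 2], 0, ![0, -1 / r ^ 2, 0, 0]]]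

/-- The `θ`-derivatives of `chrT`. -/
def chrT' (θ : ℝ) : Fin 4 → Fin 4 → Fin 4 → ℝ :=
  ![0, ![0, 0, 0, ![0, 0, 0, 2 * Real.sin θ * Real.cos θ]],
    ![0, 0, 0, ![0, 0, 0, Real.sin θ ^ 2 - Real.cos θ ^ 2]],
    ![0, 0, ![0, 0, 0, -1 / Real.sin θ ^ 2], ![0, 0, -1 / Real.sin θ ^ 2, 0]]]

def chr (N f : ℝ → ℝ) (x : Pt) (a b c : Fin 4) : ℝ := chrR N f (x 1) a b c * chrT (x 2) a b c

theorem Background.christoffel_eq (H : Background N f I) {x : Pt} (hx : x ∈ region I) (a b c : Fin 4) :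
    christoffel (sssMetric N f) x a b c = chr N f x a b c := by
  have h1 := H.radius_ne _ hx.1
  have h2 := H.N_ne _ hx.1
  have h3 := H.f_ne _ hx.1
  have h4 := sin_ne_of_mem_region hx
  simp only [christoffel, H.inv_sssMetric_apply hx, H.pd_sssMetric hx, ite_mul, zero_mul,
    Finset.sum_ite_eq, Finset.mem_univ, if_true]
  fin_cases a <;> fin_cases b <;> fin_cases c <;>
    simp [metricD, metricR, metricR', metricT, metricT', chr, chrR, chrT] <;> field_simp <;> ring

end

section
variable {N f : ℝ → ℝ} {I : Set ℝ}

theorem Background.hasDerivAt_chrR (H : Background N f I) {r : ℝ} (hr : r ∈ I) (a b c : Fin 4) :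
    HasDerivAt (fun r => chrR N f r a b c) (chrR' N f r a b c) r := by
  have hN := hasDerivAt_of_smooth H.isOpen H.smooth_N hr
  have hf := hasDerivAt_of_smooth H.isOpen H.smooth_f hr
  have hN1 := hasDerivAt_of_smooth H.isOpen (contDiffOn_deriv H.isOpen H.smooth_N) hr
  have hf1 := hasDerivAt_of_smooth H.isOpen (contDiffOn_deriv H.isOpen H.smooth_f) hr
  have h1 := H.radius_ne _ hr
  have h2 := H.N_ne _ hr
  have h3 := H.f_ne _ hr
  have e1 : HasDerivAt (fun r => deriv f r / (2 * f r))
      ((deriv (deriv f) r * f r - deriv f r * deriv f r) / (2 * f r ^ 2)) r := by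
    refine (hf1.fun_div (hf.const_mul 2) (by simpa using h3)).congr_deriv ?_
    field_simp
  have e2 : HasDerivAt (fun r => deriv N r / N r + deriv f r / (2 * f r))
      ((deriv (deriv N) r * N r - deriv N r * deriv N r) / N r ^ 2
        + (deriv (deriv f) r * f r - deriv f r * deriv f r) / (2 * f r ^ 2)) r :=
    (hN1.fun_div hN h2).fun_add e1
  have e3 : HasDerivAt (fun r => N r * f r * (deriv N r * f r + N r * deriv f r / 2))
      ((deriv N r * f r + N r * deriv f r) * (deriv N r * f r + N r * deriv f r / 2)
        + N r * f r * (deriv (deriv N) r * f r + deriv N r * deriv f r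
          + (deriv N r * deriv f r + N r * deriv (deriv f) r) / 2)) r :=
    (hN.fun_mul hf).fun_mul ((hN1.fun_mul hf).fun_add ((hN.fun_mul hf1).div_const 2))
  have e4 : HasDerivAt (fun r => -(r * f r)) (-(f r + r * deriv f r)) r :=
    ((hasDerivAt_id' r).fun_mul hf).fun_neg.congr_deriv (by ring)
  have e5 : HasDerivAt (fun r : ℝ => 1 / r) (-1 / r ^ 2) r :=
    ((hasDerivAt_const r (1 : ℝ)).fun_div (hasDerivAt_id' r) h1).congr_deriv (by simp)
  have e6 := hasDerivAt_const r (0 : ℝ)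
  have e7 := hasDerivAt_const r (1 : ℝ)
  fin_cases a <;> fin_cases b <;> fin_cases c <;>
    first | exact e6 | exact e7 | exact e5 | exact e4 | exact e2 | exact e3 | exact e1.fun_neg

theorem hasDerivAt_chrT {θ : ℝ} (hθ : Real.sin θ ≠ 0) (a b c : Fin 4) :
    HasDerivAt (fun θ => chrT θ a b c) (chrT' θ a b c) θ := by
  have e1 : HasDerivAt (fun θ => Real.sin θ ^ 2) (2 * Real.sin θ * Real.cos θ) θ :=
    ((Real.hasDerivAt_sin θ).pow 2).congr_deriv (by simp)
  have e2 : HasDerivAt (fun θ => -(Real.sin θ * Real.cos θ))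
      (Real.sin θ ^ 2 - Real.cos θ ^ 2) θ :=
    ((Real.hasDerivAt_sin θ).fun_mul (Real.hasDerivAt_cos θ)).fun_neg.congr_deriv (by ring)
  have e3 : HasDerivAt (fun θ => Real.cos θ / Real.sin θ) (-1 / Real.sin θ ^ 2) θ := by
    refine ((Real.hasDerivAt_cos θ).fun_div (Real.hasDerivAt_sin θ) hθ).congr_deriv ?_
    congr 1
    linarith [Real.sin_sq_add_cos_sq θ]
  have e7 := hasDerivAt_const θ (1 : ℝ)
  fin_cases a <;> fin_cases b <;> fin_cases c <;>
    first | exact e7 | exact e1 | exact e2 | exact e3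

theorem Background.pd_christoffel (H : Background N f I) {x : Pt} (hx : x ∈ region I)
    (μ a b c : Fin 4) :
    pd μ (fun y => christoffel (sssMetric N f) y a b c) x
      = ![0, chrR' N f (x 1) a b c * chrT (x 2) a b c,
          chrR N f (x 1) a b c * chrT' (x 2) a b c, 0] μ :=
  pd_separated H.isOpen (φ := fun r => chrR N f r a b c) (ψ := fun θ => chrT θ a b c)
    (fun _ hy => H.christoffel_eq hy a b c) hx (H.hasDerivAt_chrR hx.1 a b c)
    (hasDerivAt_chrT (sin_ne_of_mem_region hx) a b c) μ

/-- A symmetric array of four numbers attached to the planes `tr`, `tθ`/`tφ`, `rθ`/`rφ`, `θφ`. -/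
def planes (v : Fin 4 → ℝ) : Fin 4 → Fin 4 → ℝ :=
  ![![0, v 0, v 1, v 1], ![v 0, 0, v 2, v 2], ![v 1, v 2, 0, v 3], ![v 1, v 2, v 3, 0]]

theorem planes_symm (v : Fin 4 → ℝ) (a b : Fin 4) : planes v a b = planes v b a := by
  fin_cases a <;> fin_cases b <;> rfl

/-- The Kronecker symbol. -/
def kr (a b : Fin 4) : ℝ := if a = b then 1 else 0

/-- The array `δ_{ac} δ_{bd} - δ_{ad} δ_{bc}`. -/
def kr₂ (a b c d : Fin 4) : ℝ := kr a c * kr b d - kr a d * kr b c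

/-- The sectional curvatures of the ansatz. -/
def curv (N f : ℝ → ℝ) (r : ℝ) : Fin 4 → ℝ :=
  ![-(f r * deriv (deriv N) r / N r + 3 * deriv f r * deriv N r / (2 * N r)
      + deriv (deriv f) r / 2),
    -(f r * deriv N r / N r + deriv f r / 2) / r, -(deriv f r / (2 * r)), (1 - f r) / r ^ 2]

theorem riemannUp_antisymm (g : Pt → Mat) (x : Pt) (a b c d : Fin 4) :
    riemannUp g x a b c d = -riemannUp g x a b d c := by
  simp only [riemannUp, neg_add_rev, neg_sub, ← Finset.sum_neg_distrib]
  ring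

/-- Antisymmetry leaves six independent components out of sixteen; this keeps the case analyses
below small. -/
theorem eq_of_antisymm {u v : Fin 4 → Fin 4 → ℝ} (hu : ∀ c d, u c d = -u d c)
    (hv : ∀ c d, v c d = -v d c) (h01 : u 0 1 = v 0 1) (h02 : u 0 2 = v 0 2)
    (h03 : u 0 3 = v 0 3) (h12 : u 1 2 = v 1 2) (h13 : u 1 3 = v 1 3) (h23 : u 2 3 = v 2 3)
    (c d : Fin 4) : u c d = v c d := by
  have hd : ∀ c, u c c = v c c := fun c => by linarith [hu c c, hv c c]
  have hn : ∀ c d, u c d = v c d → u d c = v d c := fun c d h => by rw [hu, hv, h]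
  fin_cases c <;> fin_cases d <;> first | assumption | exact hd _ | (apply hn; assumption)

-- Everything later rests on this form: the curvature is diagonal on coordinate planes, and
-- staticity and spherical symmetry identify the planes tθ with tφ and rθ with rφ. The proof is a
-- component computation from the separated Christoffel symbols.
set_option maxHeartbeats 4000000 in
theorem Background.riemannUp_eq (H : Background N f I) {x : Pt} (hx : x ∈ region I)
    (a b c d : Fin 4) :
    riemannUp (sssMetric N f) x a b c d
      = planes (curv N f (x 1)) a b * metricD N f x b * kr₂ a b c d := by
  have h1 := H.radius_ne _ hx.1
  have h2 := H.N_ne _ hx.1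
  have h3 := H.f_ne _ hx.1
  have h4 := sin_ne_of_mem_region hx
  -- The only relation between the θ-functions; once cos² is eliminated, the identities are rational
  -- and `ring` decides them.
  have h5 : Real.cos (x 2) ^ 2 = 1 - Real.sin (x 2) ^ 2 := Real.cos_sq' (x 2)
  refine eq_of_antisymm (v := fun c d => planes (curv N f (x 1)) a b * metricD N f x b * kr₂ a b c d)
    (riemannUp_antisymm _ x a b) (fun c d => by simp only [kr₂]; ring) ?_ ?_ ?_ ?_ ?_ ?_ c d <;>
  · simp only [riemannUp, H.pd_christoffel hx, H.christoffel_eq hx, Fin.sum_univ_four, chr]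
    fin_cases a <;> fin_cases b <;>
      simp [chrR, chrT, chrR', chrT', planes, curv, metricD, metricR, metricT, kr₂, kr] <;>
      field_simp <;> (try simp only [h5]) <;> (try field_simp) <;> ring

end

/-! ### Covariant derivatives in components -/

/-- The expansions for two to five indices replace `Function.update` on index tuples by explicit
tuples, on which the component formulas can be rewritten. -/
theorem covD_two (g : Pt → Mat) (T : Pt → Tensor 2) (x : Pt) (e a b : Fin 4) :
    covD g T x ![e, a, b] = pd e (fun y => T y ![a, b]) x
      - (∑ m, christoffel g x m e a * T x ![m, b] + ∑ m, christoffel g x m e b * T x ![a, m]) := by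
  have h0 : Fin.tail ![e, a, b] = ![a, b] := rfl
  have h1 : ∀ m, Function.update ![a, b] 0 m = ![m, b] := fun m => by
    ext i; fin_cases i <;> rfl
  have h2 : ∀ m, Function.update ![a, b] 1 m = ![a, m] := fun m => by
    ext i; fin_cases i <;> rfl
  simp only [covD, h0, Fin.sum_univ_two, h1, h2]
  rfl

theorem covD_three (g : Pt → Mat) (T : Pt → Tensor 3) (x : Pt) (e a b c : Fin 4) :
    covD g T x ![e, a, b, c] = pd e (fun y => T y ![a, b, c]) x
      - (∑ m, christoffel g x m e a * T x ![m, b, c] + ∑ m, christoffel g x m e b * T x ![a, m, c]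
        + ∑ m, christoffel g x m e c * T x ![a, b, m]) := by
  have h0 : Fin.tail ![e, a, b, c] = ![a, b, c] := rfl
  have h1 : ∀ m, Function.update ![a, b, c] 0 m = ![m, b, c] := fun m => by
    ext i; fin_cases i <;> rfl
  have h2 : ∀ m, Function.update ![a, b, c] 1 m = ![a, m, c] := fun m => by
    ext i; fin_cases i <;> rfl
  have h3 : ∀ m, Function.update ![a, b, c] 2 m = ![a, b, m] := fun m => by
    ext i; fin_cases i <;> rfl
  simp only [covD, h0, Fin.sum_univ_three, h1, h2, h3]
  rfl

theorem covD_four (g : Pt → Mat) (T : Pt → Tensor 4) (x : Pt) (e a b c d : Fin 4) :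
    covD g T x ![e, a, b, c, d] = pd e (fun y => T y ![a, b, c, d]) x
      - (∑ m, christoffel g x m e a * T x ![m, b, c, d]
        + ∑ m, christoffel g x m e b * T x ![a, m, c, d]
        + ∑ m, christoffel g x m e c * T x ![a, b, m, d]
        + ∑ m, christoffel g x m e d * T x ![a, b, c, m]) := by
  have h0 : Fin.tail ![e, a, b, c, d] = ![a, b, c, d] := rfl
  have h1 : ∀ m, Function.update ![a, b, c, d] 0 m = ![m, b, c, d] := fun m => by
    ext i; fin_cases i <;> rfl
  have h2 : ∀ m, Function.update ![a, b, c, d] 1 m = ![a, m, c, d] := fun m => by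
    ext i; fin_cases i <;> rfl
  have h3 : ∀ m, Function.update ![a, b, c, d] 2 m = ![a, b, m, d] := fun m => by
    ext i; fin_cases i <;> rfl
  have h4 : ∀ m, Function.update ![a, b, c, d] 3 m = ![a, b, c, m] := fun m => by
    ext i; fin_cases i <;> rfl
  simp only [covD, h0, Fin.sum_univ_four, h1, h2, h3, h4]
  rfl

theorem covD_five (g : Pt → Mat) (T : Pt → Tensor 5) (x : Pt) (e a b c d k : Fin 4) :
    covD g T x ![e, a, b, c, d, k] = pd e (fun y => T y ![a, b, c, d, k]) x
      - (∑ m, christoffel g x m e a * T x ![m, b, c, d, k]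
        + ∑ m, christoffel g x m e b * T x ![a, m, c, d, k]
        + ∑ m, christoffel g x m e c * T x ![a, b, m, d, k]
        + ∑ m, christoffel g x m e d * T x ![a, b, c, m, k]
        + ∑ m, christoffel g x m e k * T x ![a, b, c, d, m]) := by
  have h0 : Fin.tail ![e, a, b, c, d, k] = ![a, b, c, d, k] := rfl
  have h1 : ∀ m, Function.update ![a, b, c, d, k] 0 m = ![m, b, c, d, k] := fun m => by
    ext i; fin_cases i <;> rfl
  have h2 : ∀ m, Function.update ![a, b, c, d, k] 1 m = ![a, m, c, d, k] := fun m => by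
    ext i; fin_cases i <;> rfl
  have h3 : ∀ m, Function.update ![a, b, c, d, k] 2 m = ![a, b, m, d, k] := fun m => by
    ext i; fin_cases i <;> rfl
  have h4 : ∀ m, Function.update ![a, b, c, d, k] 3 m = ![a, b, c, m, k] := fun m => by
    ext i; fin_cases i <;> rfl
  have h5 : ∀ m, Function.update ![a, b, c, d, k] 4 m = ![a, b, c, d, m] := fun m => by
    ext i; fin_cases i <;> rfl
  simp only [covD, h0, Fin.sum_univ_five, h1, h2, h3, h4, h5]
  rfl

theorem contDiffOn_covD {U : Set Pt} (hU : IsOpen U) {g : Pt → Mat}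
    (hg : ∀ a b c, ContDiffOn ℝ ∞ (fun x => christoffel g x a b c) U) {k : ℕ} {T : Pt → Tensor k}
    (hT : ∀ i, ContDiffOn ℝ ∞ (fun x => T x i) U) (i : Fin (k + 1) → Fin 4) :
    ContDiffOn ℝ ∞ (fun x => covD g T x i) U :=
  (contDiffOn_pd hU (hT _) _).sub
    (ContDiffOn.sum fun _ _ => ContDiffOn.sum fun _ _ => (hg _ _ _).mul (hT _))

theorem contDiffOn_separated {I : Set ℝ} {h : Pt → ℝ} {φ ψ : ℝ → ℝ}
    (heq : ∀ y ∈ region I, h y = φ (y 1) * ψ (y 2)) (hφ : ContDiffOn ℝ ∞ φ I)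
    (hψ : ContDiffOn ℝ ∞ ψ (Set.Ioo 0 Real.pi)) : ContDiffOn ℝ ∞ h (region I) :=
  ((hφ.comp (contDiff_apply ℝ ℝ 1).contDiffOn fun _ hy => hy.1).mul
    (hψ.comp (contDiff_apply ℝ ℝ 2).contDiffOn fun _ hy => hy.2)).congr heq

section
variable {N f : ℝ → ℝ} {I : Set ℝ}

theorem Background.contDiffOn_metricR (H : Background N f I) (a : Fin 4) :
    ContDiffOn ℝ ∞ (fun r => metricR N f r a) I := by
  have h1 : ContDiffOn ℝ ∞ (fun r => -(N r ^ 2 * f r)) I :=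
    ((H.smooth_N.pow 2).mul H.smooth_f).neg
  have h2 : ContDiffOn ℝ ∞ (fun r => 1 / f r) I := contDiffOn_const.div H.smooth_f H.f_ne
  have h3 : ContDiffOn ℝ ∞ (fun r : ℝ => r ^ 2) I := contDiffOn_id.pow 2
  fin_cases a <;> assumption

theorem contDiffOn_metricT (U : Set ℝ) (a : Fin 4) :
    ContDiffOn ℝ ∞ (fun θ => metricT θ a) U := by
  have h1 : ContDiffOn ℝ ∞ (fun _ : ℝ => (1 : ℝ)) U := contDiffOn_const
  have h2 : ContDiffOn ℝ ∞ (fun θ => Real.sin θ ^ 2) U := Real.contDiff_sin.contDiffOn.pow 2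
  fin_cases a <;> assumption

theorem Background.contDiffOn_metricD (H : Background N f I) (a : Fin 4) :
    ContDiffOn ℝ ∞ (fun x => metricD N f x a) (region I) :=
  contDiffOn_separated (φ := fun r => metricR N f r a) (ψ := fun θ => metricT θ a)
    (fun _ _ => rfl) (H.contDiffOn_metricR a) (contDiffOn_metricT _ a)

theorem Background.contDiffOn_inv_metricD (H : Background N f I) (a : Fin 4) :
    ContDiffOn ℝ ∞ (fun x => (metricD N f x a)⁻¹) (region I) :=
  (H.contDiffOn_metricD a).inv fun _ hx => H.metricD_ne hx a

/-- The diagonal part of ∇g⁻¹ = 0 for a diagonal metric; `Background.chr_compat` supplies the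
off-diagonal part. -/
theorem Background.pd_inv_metricD (H : Background N f I) {x : Pt} (hx : x ∈ region I)
    (μ a : Fin 4) : pd μ (fun y => (metricD N f y a)⁻¹) x
      = -2 * chr N f x a μ a * (metricD N f x a)⁻¹ := by
  have hR := H.hasDerivAt_metricR hx.1 a
  have hT := hasDerivAt_metricT (x 2) a
  have h0 := H.metricD_ne hx a
  have hR0 : metricR N f (x 1) a ≠ 0 := left_ne_zero_of_mul h0
  have hT0 : metricT (x 2) a ≠ 0 := right_ne_zero_of_mul h0
  rw [pd_separated H.isOpen (φ := fun r => (metricR N f r a)⁻¹) (ψ := fun θ => (metricT θ a)⁻¹)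
    (fun y _ => by rw [metricD, mul_inv]) hx (hR.fun_inv hR0) (hT.fun_inv hT0) μ]
  have h1 := H.radius_ne _ hx.1
  have h2 := H.N_ne _ hx.1
  have h3 := H.f_ne _ hx.1
  have h4 := sin_ne_of_mem_region hx
  fin_cases a <;> fin_cases μ <;>
    simp [metricD, metricR, metricR', metricT, metricT', chr, chrR, chrT] <;> field_simp

/-- The connection is compatible with the (diagonal, inverse) metric. -/
theorem Background.chr_compat (H : Background N f I) {x : Pt} (hx : x ∈ region I) {μ a b : Fin 4}
    (hab : a ≠ b) :
    chr N f x a μ b * (metricD N f x b)⁻¹ + chr N f x b μ a * (metricD N f x a)⁻¹ = 0 := by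
  have h1 := H.radius_ne _ hx.1
  have h2 := H.N_ne _ hx.1
  have h3 := H.f_ne _ hx.1
  have h4 := sin_ne_of_mem_region hx
  fin_cases a <;> fin_cases b <;> first | exact absurd rfl hab | skip
  all_goals
    fin_cases μ <;>
      simp [metricD, metricR, metricT, chr, chrR, chrT] <;> field_simp <;> ring

/-- Contraction with the inverse metric commutes with covariant differentiation. -/
theorem Background.contract_covD (H : Background N f I) {x : Pt} (hx : x ∈ region I) (μ : Fin 4)
    (Q : Fin 4 → Fin 4 → Pt → ℝ) (hQ : ∀ a, DifferentiableAt ℝ (Q a a) x) :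
    ∑ a, (metricD N f x a)⁻¹ * (pd μ (Q a a) x
        - (∑ m, chr N f x m μ a * Q m a x + ∑ m, chr N f x m μ a * Q a m x))
      = pd μ (fun y => ∑ a, (metricD N f y a)⁻¹ * Q a a y) x := by
  have hg : ∀ a, DifferentiableAt ℝ (fun y => (metricD N f y a)⁻¹) x := fun a =>
    ((H.contDiffOn_inv_metricD a).contDiffAt
      ((isOpen_region H.isOpen).mem_nhds hx)).differentiableAt (by simp)
  rw [pd_sum _ (fun a _ => (hg a).fun_mul (hQ a))]
  simp only [pd_mul (hg _) (hQ _), H.pd_inv_metricD hx, Fin.sum_univ_four]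
  have c01 := H.chr_compat hx (μ := μ) (a := 0) (b := 1) (by decide)
  have c02 := H.chr_compat hx (μ := μ) (a := 0) (b := 2) (by decide)
  have c03 := H.chr_compat hx (μ := μ) (a := 0) (b := 3) (by decide)
  have c12 := H.chr_compat hx (μ := μ) (a := 1) (b := 2) (by decide)
  have c13 := H.chr_compat hx (μ := μ) (a := 1) (b := 3) (by decide)
  have c23 := H.chr_compat hx (μ := μ) (a := 2) (b := 3) (by decide)
  -- The terms in Q a a have cancelled against the derivative of the inverse metric. For a ≠ b, both
  -- Q a b and Q b a multiply the same off-diagonal compatibility expression.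
  linear_combination -(Q 0 1 x + Q 1 0 x) * c01 - (Q 0 2 x + Q 2 0 x) * c02
    - (Q 0 3 x + Q 3 0 x) * c03 - (Q 1 2 x + Q 2 1 x) * c12 - (Q 1 3 x + Q 3 1 x) * c13
    - (Q 2 3 x + Q 3 2 x) * c23

theorem Background.contDiffOn_christoffel (H : Background N f I) (a b c : Fin 4) :
    ContDiffOn ℝ ∞ (fun x => christoffel (sssMetric N f) x a b c) (region I) := by
  have hU := isOpen_region H.isOpen
  have hg : ∀ a b, ContDiffOn ℝ ∞ (fun x => sssMetric N f x a b) (region I) := fun a b => by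
    simp only [sssMetric_apply]
    split_ifs
    · exact H.contDiffOn_metricD a
    · exact contDiffOn_const
  have hi : ∀ a b, ContDiffOn ℝ ∞ (fun x => (sssMetric N f x)⁻¹ a b) (region I) := fun a b => by
    refine ContDiffOn.congr (f := fun x => if a = b then (metricD N f x a)⁻¹ else 0) ?_
      fun x hx => H.inv_sssMetric_apply hx a b
    split_ifs
    · exact H.contDiffOn_inv_metricD a
    · exact contDiffOn_const
  unfold christoffel
  exact contDiffOn_const.mul (ContDiffOn.sum fun d _ => (hi a d).mul
    (((contDiffOn_pd hU (hg d c) b).add (contDiffOn_pd hU (hg d b) c)).sub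
      (contDiffOn_pd hU (hg b c) d)))

/-- The divergence `∇^ρ T_{μσνρ}`. -/
def divLast (N f : ℝ → ℝ) (T : Pt → Tensor 4) (x : Pt) : Tensor 3 :=
  fun j => ∑ ρ, (metricD N f x ρ)⁻¹ * covD (sssMetric N f) T x ![ρ, j 0, j 1, j 2, ρ]

/-- Metric compatibility moves the inner trace through the outer derivative. The second covariant
derivative, an array with six indices, thus never has to be computed: two successive divergences
suffice. -/
theorem Background.sum_covD_covD (H : Background N f I) {T : Pt → Tensor 4}
    (hT : ∀ i, ContDiffOn ℝ ∞ (fun x => T x i) (region I)) {x : Pt} (hx : x ∈ region I)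
    (μ ν : Fin 4) :
    ∑ σ, ∑ ρ, ∑ σ', ∑ ρ', (sssMetric N f x)⁻¹ σ σ' * (sssMetric N f x)⁻¹ ρ ρ'
      * covD (sssMetric N f) (covD (sssMetric N f) T) x ![σ', ρ', μ, σ, ν, ρ]
      = ∑ σ, (metricD N f x σ)⁻¹
        * covD (sssMetric N f) (divLast N f T) x ![σ, μ, σ, ν] := by
  have hU := isOpen_region H.isOpen
  simp only [H.inv_sssMetric_apply hx, ite_mul, mul_ite, zero_mul, mul_zero, Finset.sum_ite_eq,
    Finset.mem_univ, if_true]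
  refine Finset.sum_congr rfl fun σ _ => ?_
  simp only [mul_assoc, ← Finset.mul_sum]
  congr 1
  have hd : ∀ i, DifferentiableAt ℝ (fun y => covD (sssMetric N f) T y i) x := fun i =>
    ((contDiffOn_covD hU H.contDiffOn_christoffel hT i).contDiffAt
      (hU.mem_nhds hx)).differentiableAt (by simp)
  have key := H.contract_covD hx σ
    (fun a b y => covD (sssMetric N f) T y ![a, μ, σ, ν, b]) fun a => hd _
  rw [covD_three]
  have e1 : pd σ (fun y => divLast N f T y ![μ, σ, ν]) x
      = pd σ (fun y => ∑ a, (metricD N f y a)⁻¹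
          * covD (sssMetric N f) T y ![a, μ, σ, ν, a]) x := rfl
  have e2 : ∀ a b c, divLast N f T x ![a, b, c]
      = ∑ ρ, (metricD N f x ρ)⁻¹ * covD (sssMetric N f) T x ![ρ, a, b, c, ρ] :=
    fun a b c => rfl
  rw [e1, ← key]
  simp only [e2, covD_five, H.christoffel_eq hx, Fin.sum_univ_four]
  ring

end

/-! ### Divergences of diagonal curvature-like tensors. -/

section
variable {N f : ℝ → ℝ} {I : Set ℝ}

/-- `Γ^t_{tr}`. -/
def accel (N f : ℝ → ℝ) (r : ℝ) : ℝ := deriv N r / N r + deriv f r / (2 * f r)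

/-- The functions of `r` in the divergence of a curvature-like tensor with planes `q`. -/
def divR (N f : ℝ → ℝ) (q : Fin 4 → ℝ → ℝ) (r : ℝ) : Fin 4 → ℝ :=
  let w := deriv (q 2) r + accel N f r * (q 2 r - q 1 r) + (q 2 r - q 3 r) / r
  ![deriv (q 0) r + 2 * (q 0 r - q 1 r) / r, 0, w, w]

/-- The diagonal curvature-like tensor with planes `q` (lower indices). -/
def diagCurv (N f : ℝ → ℝ) (q : Fin 4 → ℝ → ℝ) (x : Pt) (a b c d : Fin 4) : ℝ :=
  planes (fun i => q i (x 1)) a b * metricD N f x a * metricD N f x b * kr₂ a b c d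

theorem Background.pd_diagCurv (H : Background N f I) {q : Fin 4 → ℝ → ℝ}
    (hq : ∀ i, ContDiffOn ℝ ∞ (q i) I) {T : Pt → Tensor 4}
    (hT : ∀ y ∈ region I, ∀ a b c d, T y ![a, b, c, d] = diagCurv N f q y a b c d) {x : Pt}
    (hx : x ∈ region I) (μ a b c d : Fin 4) :
    pd μ (fun y => T y ![a, b, c, d]) x
      = ![0, (planes (fun i => deriv (q i) (x 1)) a b * metricR N f (x 1) a * metricR N f (x 1) b
          + planes (fun i => q i (x 1)) a b * metricR' N f (x 1) a * metricR N f (x 1) b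
          + planes (fun i => q i (x 1)) a b * metricR N f (x 1) a * metricR' N f (x 1) b)
          * (metricT (x 2) a * metricT (x 2) b),
        planes (fun i => q i (x 1)) a b * metricR N f (x 1) a * metricR N f (x 1) b
          * (metricT' (x 2) a * metricT (x 2) b + metricT (x 2) a * metricT' (x 2) b), 0] μ
        * kr₂ a b c d := by
  have hpl : HasDerivAt (fun r => planes (fun i => q i r) a b)
      (planes (fun i => deriv (q i) (x 1)) a b) (x 1) := by
    have h := fun i => hasDerivAt_of_smooth H.isOpen (hq i) hx.1
    have h0 := hasDerivAt_const (x 1) (0 : ℝ)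
    fin_cases a <;> fin_cases b <;> first | exact h0 | exact h 0 | exact h 1 | exact h 2 | exact h 3
  have hR := (hpl.fun_mul (H.hasDerivAt_metricR hx.1 a)).fun_mul (H.hasDerivAt_metricR hx.1 b)
  have hT' := ((hasDerivAt_metricT (x 2) a).fun_mul (hasDerivAt_metricT (x 2) b)).mul_const
    (kr₂ a b c d)
  rw [pd_separated H.isOpen (fun y hy => ?_) hx hR hT' μ]
  · fin_cases μ <;> simp <;> ring
  · rw [hT y hy, diagCurv, metricD, metricD]; ring

theorem Background.contDiffOn_diagCurv (H : Background N f I) {q : Fin 4 → ℝ → ℝ}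
    (hq : ∀ i, ContDiffOn ℝ ∞ (q i) I) (a b c d : Fin 4) :
    ContDiffOn ℝ ∞ (fun y => diagCurv N f q y a b c d) (region I) := by
  have hpl : ContDiffOn ℝ ∞ (fun r => planes (fun i => q i r) a b) I := by
    have h0 : ContDiffOn ℝ ∞ (fun _ : ℝ => (0 : ℝ)) I := contDiffOn_const
    have h := hq
    fin_cases a <;> fin_cases b <;> first | exact h0 | exact h 0 | exact h 1 | exact h 2 | exact h 3
  refine ((ContDiffOn.mul ?_ (H.contDiffOn_metricD a)).mul (H.contDiffOn_metricD b)).mul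
    contDiffOn_const
  exact contDiffOn_separated (ψ := fun _ => 1) (fun y _ => (mul_one _).symm) hpl contDiffOn_const

-- The coefficients q depend on r only and the metric is diagonal, so one of the first two indices
-- of the divergence must be r and the remaining two must coincide. Antisymmetry in the first pair
-- is inherited by the divergence and reduces the computation to six pairs.
set_option maxHeartbeats 4000000 in
theorem Background.divLast_diagCurv (H : Background N f I) {q : Fin 4 → ℝ → ℝ}
    (hq : ∀ i, ContDiffOn ℝ ∞ (q i) I) {T : Pt → Tensor 4}
    (hT : ∀ y ∈ region I, ∀ a b c d, T y ![a, b, c, d] = diagCurv N f q y a b c d) {x : Pt}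
    (hx : x ∈ region I) (a b c : Fin 4) :
    divLast N f T x ![a, b, c]
      = metricD N f x a * divR N f q (x 1) a * kr a c * kr b 1
        - metricD N f x b * divR N f q (x 1) b * kr b c * kr a 1 := by
  have h1 := H.radius_ne _ hx.1
  have h2 := H.N_ne _ hx.1
  have h3 := H.f_ne _ hx.1
  have h4 := sin_ne_of_mem_region hx
  have e : ∀ a b c, divLast N f T x ![a, b, c]
      = ∑ ρ, (metricD N f x ρ)⁻¹ * covD (sssMetric N f) T x ![ρ, a, b, c, ρ] :=
    fun a b c => rfl
  have hanti : ∀ a b c, divLast N f T x ![a, b, c] = -divLast N f T x ![b, a, c] := by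
    intro a b c
    have : ∀ y ∈ region I, ∀ a b c d, T y ![a, b, c, d] = -T y ![b, a, c, d] := by
      intro y hy a b c d
      rw [hT y hy, hT y hy, diagCurv, diagCurv, planes_symm, kr₂, kr₂]; ring
    simp only [e, covD_four, ← Finset.sum_neg_distrib]
    refine Finset.sum_congr rfl fun ρ _ => ?_
    simp only [H.pd_diagCurv hq hT hx]
    simp only [planes_symm _ a b, this x hx a, this x hx _ b]
    simp only [kr₂, Fin.sum_univ_four]
    fin_cases ρ <;> simp <;> ring
  refine eq_of_antisymm (u := fun a b => divLast N f T x ![a, b, c]) (v := fun a b =>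
    metricD N f x a * divR N f q (x 1) a * kr a c * kr b 1
        - metricD N f x b * divR N f q (x 1) b * kr b c * kr a 1) (fun a b => hanti a b c)
    (fun a b => by ring) ?_ ?_ ?_ ?_ ?_ ?_ a b <;>
  · simp only [e, covD_four, H.pd_diagCurv hq hT hx, H.christoffel_eq hx, hT x hx, diagCurv, chr]
    fin_cases c <;>
      simp [Fin.sum_univ_four, metricD, metricR, metricT, metricR', metricT', planes, kr₂, kr,
        chrR, chrT, divR, accel] <;>
      field_simp <;> first | ring1 | norm_num


/-- The functions of `r` in the second divergence of a curvature-like tensor with planes `q`. -/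
def div₂R (N f : ℝ → ℝ) (v v' : Fin 4 → ℝ) (r : ℝ) : Fin 4 → ℝ :=
  let w := f r * v' 2 + (deriv f r / 2 + accel N f r * f r) * v 2 + f r * v 2 / r
  ![f r * v' 0 + deriv f r / 2 * v 0 + 2 * f r * v 0 / r,
    f r * (accel N f r * v 0 + 2 * v 2 / r), w, w]

theorem Background.contDiffOn_divR (H : Background N f I) {q : Fin 4 → ℝ → ℝ}
    (hq : ∀ i, ContDiffOn ℝ ∞ (q i) I) (a : Fin 4) :
    ContDiffOn ℝ ∞ (fun r => divR N f q r a) I := by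
  have h' := fun i => contDiffOn_deriv H.isOpen (hq i)
  have hr : ContDiffOn ℝ ∞ (fun r : ℝ => r) I := contDiffOn_id
  have hα : ContDiffOn ℝ ∞ (accel N f) I :=
    ((contDiffOn_deriv H.isOpen H.smooth_N).div H.smooth_N H.N_ne).add
      ((contDiffOn_deriv H.isOpen H.smooth_f).div (contDiffOn_const.mul H.smooth_f)
        fun r hr => by simpa using H.f_ne r hr)
  have h0 : ContDiffOn ℝ ∞ (fun r => deriv (q 0) r + 2 * (q 0 r - q 1 r) / r) I :=
    (h' 0).add ((contDiffOn_const.mul ((hq 0).sub (hq 1))).div hr H.radius_ne)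
  have h1 : ContDiffOn ℝ ∞ (fun _ : ℝ => (0 : ℝ)) I := contDiffOn_const
  have h2 : ContDiffOn ℝ ∞ (fun r => deriv (q 2) r + accel N f r * (q 2 r - q 1 r)
      + (q 2 r - q 3 r) / r) I :=
    ((h' 2).add (hα.mul ((hq 2).sub (hq 1)))).add (((hq 2).sub (hq 3)).div hr H.radius_ne)
  fin_cases a <;> assumption

-- The entry `v 1` never contributes to V, since its two occurrences cancel for a = b = 1; `hv1`
-- merely normalises it. The equality of the two angular entries is what keeps the result diagonal
-- and free of θ apart from the metric factor.
set_option maxHeartbeats 4000000 in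
theorem Background.divLast_divLast (H : Background N f I) {v v' : Fin 4 → ℝ → ℝ}
    (hv : ∀ r ∈ I, ∀ i, HasDerivAt (v i) (v' i r) r) (hv1 : ∀ r, v 1 r = 0)
    (hv3 : ∀ r, v 3 r = v 2 r) {V : Pt → Tensor 3}
    (hV : ∀ y ∈ region I, ∀ a b c, V y ![a, b, c]
      = metricD N f y a * v a (y 1) * kr a c * kr b 1
        - metricD N f y b * v b (y 1) * kr b c * kr a 1) {x : Pt}
    (hx : x ∈ region I) (a c : Fin 4) :
    ∑ s, (metricD N f x s)⁻¹ * covD (sssMetric N f) V x ![s, a, s, c]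
      = metricD N f x a * div₂R N f (fun i => v i (x 1)) (fun i => v' i (x 1)) (x 1) a * kr a c := by
  have h1 := H.radius_ne _ hx.1
  have h2 := H.N_ne _ hx.1
  have h3 := H.f_ne _ hx.1
  have h4 := sin_ne_of_mem_region hx
  have h5 : Real.cos (x 2) ^ 2 = 1 - Real.sin (x 2) ^ 2 := Real.cos_sq' (x 2)
  have hv3' : v' 3 (x 1) = v' 2 (x 1) :=
    (hv _ hx.1 3).unique ((funext hv3 : v 3 = v 2) ▸ hv _ hx.1 2)
  have hp : ∀ μ a b c, pd μ (fun y => V y ![a, b, c]) x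
      = ![0, (metricR' N f (x 1) a * v a (x 1) + metricR N f (x 1) a * v' a (x 1)) * metricT (x 2) a,
          metricR N f (x 1) a * v a (x 1) * metricT' (x 2) a, 0] μ * kr a c * kr b 1
        - ![0, (metricR' N f (x 1) b * v b (x 1) + metricR N f (x 1) b * v' b (x 1)) * metricT (x 2) b,
          metricR N f (x 1) b * v b (x 1) * metricT' (x 2) b, 0] μ * kr b c * kr a 1 := by
    intro μ a b c
    have hd : ∀ a, HasDerivAt (fun r => metricR N f r a * v a r)
        (metricR' N f (x 1) a * v a (x 1) + metricR N f (x 1) a * v' a (x 1)) (x 1) :=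
      fun a => (H.hasDerivAt_metricR hx.1 a).fun_mul (hv _ hx.1 a)
    -- At most one of the two terms of V survives in each case, so V is again a product of a
    -- function of r and one of θ.
    by_cases ha : a = 1
    · by_cases hb : b = 1
      · rw [pd_separated H.isOpen (φ := fun _ => 0) (ψ := fun _ => 0) (fun y hy => ?_) hx
          (hasDerivAt_const _ _) (hasDerivAt_const _ _) μ]
        · subst ha hb; fin_cases μ <;> simp
        · rw [hV y hy]; subst ha hb; ring
      · rw [pd_separated H.isOpen (fun y hy => ?_) hx (hd b)
          ((hasDerivAt_metricT (x 2) b).const_mul (-(kr b c * kr a 1))) μ]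
        · fin_cases μ <;> simp [kr, hb]
        · rw [hV y hy]; simp only [kr, hb, if_false, metricD]; ring
    · rw [pd_separated H.isOpen (fun y hy => ?_) hx (hd a)
          ((hasDerivAt_metricT (x 2) a).const_mul (kr a c * kr b 1)) μ]
      · fin_cases μ <;> simp [kr, ha]
      · rw [hV y hy]; simp only [kr, ha, if_false, metricD]; ring
  simp only [covD_three, hp, H.christoffel_eq hx, hV x hx, chr]
  fin_cases a <;> fin_cases c <;>
    simp [Fin.sum_univ_four, metricD, metricR, metricT, metricR', metricT', kr,
      chrR, chrT, div₂R, accel, hv1, hv3, hv3'] <;>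
    field_simp <;> first | ring1 | norm_num

end

/-! ### The field equations on the ansatz. -/

/-- The antisymmetric matrix with components `u` in the `tr` plane and `w` in the `θφ` plane. -/
def plane₂ (u w : ℝ) : Mat :=
  Matrix.of ![![0, u, 0, 0], ![-u, 0, 0, 0], ![0, 0, 0, w], ![0, 0, -w, 0]]

def curv' (N f : ℝ → ℝ) (r : ℝ) : Fin 4 → ℝ :=
  ![-((deriv f r * deriv (deriv N) r + f r * deriv (deriv (deriv N)) r) / N r
      - f r * deriv (deriv N) r * deriv N r / N r ^ 2
      + 3 * (deriv (deriv f) r * deriv N r + deriv f r * deriv (deriv N) r) / (2 * N r)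
      - 3 * deriv f r * deriv N r ^ 2 / (2 * N r ^ 2) + deriv (deriv (deriv f)) r / 2),
    -((deriv f r * deriv N r + f r * deriv (deriv N) r) / N r - f r * deriv N r ^ 2 / N r ^ 2
      + deriv (deriv f) r / 2) / r + (f r * deriv N r / N r + deriv f r / 2) / r ^ 2,
    -(deriv (deriv f) r / (2 * r)) + deriv f r / (2 * r ^ 2),
    -deriv f r / r ^ 2 - 2 * (1 - f r) / r ^ 3]

theorem Background.hasDerivAt_curv {N f : ℝ → ℝ} {I : Set ℝ} (H : Background N f I) {r : ℝ}
    (hr : r ∈ I) (i : Fin 4) : HasDerivAt (fun r => curv N f r i) (curv' N f r i) r := by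
  have hN := hasDerivAt_of_smooth H.isOpen H.smooth_N hr
  have hf := hasDerivAt_of_smooth H.isOpen H.smooth_f hr
  have sN1 := contDiffOn_deriv H.isOpen H.smooth_N
  have sf1 := contDiffOn_deriv H.isOpen H.smooth_f
  have hN1 := hasDerivAt_of_smooth H.isOpen sN1 hr
  have hf1 := hasDerivAt_of_smooth H.isOpen sf1 hr
  have hN2 := hasDerivAt_of_smooth H.isOpen (contDiffOn_deriv H.isOpen sN1) hr
  have hf2 := hasDerivAt_of_smooth H.isOpen (contDiffOn_deriv H.isOpen sf1) hr
  have h1 := H.radius_ne _ hr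
  have h2 := H.N_ne _ hr
  have hi := hasDerivAt_id' r
  fin_cases i
  · refine ((((hf.fun_mul hN2).fun_div hN h2).fun_add (((hf1.const_mul 3).fun_mul hN1).fun_div
      (hN.const_mul 2) (by simpa using h2))).fun_add (hf2.div_const 2)).fun_neg.congr_deriv ?_
    simp [curv']
    field_simp
    ring
  · refine (((((hf.fun_mul hN1).fun_div hN h2).fun_add (hf1.div_const 2))).fun_neg.fun_div hi
      h1).congr_deriv ?_
    simp [curv']
    field_simp
    ring
  · refine (hf1.fun_div (hi.const_mul 2) (by simpa using h1)).fun_neg.congr_deriv ?_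
    simp [curv']
    field_simp
    ring
  · refine ((hf.const_sub 1).fun_div (hi.pow 2) (by simpa using h1)).congr_deriv ?_
    simp [curv']
    field_simp

/-- The values of `P`, `M`, `F` and `ℒ` on the ansatz in terms of functions of `r`: the components
`q` of `P` in the coordinate planes, the derivatives `pe`, `pm` of `ℒ` with respect to the electric
and magnetic field strengths `e`, `b` and the value `l` of `ℒ`. -/
structure Resolved (L : Lagrangian) (N f : ℝ → ℝ) (A : Pt → Fin 4 → ℝ) (I : Set ℝ)
    (q : Fin 4 → ℝ → ℝ) (pe pm e b l : ℝ → ℝ) : Prop where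
  smooth_q : ∀ i, ContDiffOn ℝ ∞ (q i) I
  smooth_pe : ContDiffOn ℝ ∞ pe I
  smooth_pm : ContDiffOn ℝ ∞ pm I
  smooth_e : ContDiffOn ℝ ∞ e I
  deriv_b : ∀ r ∈ I, HasDerivAt b (-2 * b r / r) r
  Pup_eq : ∀ x ∈ region I, ∀ α β γ δ, Pup L (sssMetric N f) A x ![α, β, γ, δ]
    = planes (fun i => q i (x 1)) α β * (metricD N f x α)⁻¹ * (metricD N f x β)⁻¹ * kr₂ α β γ δ
  Mup_eq : ∀ x ∈ region I, Mup L (sssMetric N f) A x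
    = plane₂ (pe (x 1) / (4 * N (x 1))) (-(pm (x 1) / (4 * x 1 ^ 2 * Real.sin (x 2))))
  field_eq : ∀ x ∈ region I, fieldStrength A x
    = plane₂ (-(N (x 1) * e (x 1))) (x 1 ^ 2 * Real.sin (x 2) * b (x 1))
  lag_eq : ∀ x ∈ region I, lag L (sssMetric N f) A x = l (x 1)
  deriv_lag : ∀ r ∈ I, HasDerivAt l (4 * q 0 r * curv' N f r 0 + 8 * q 1 r * curv' N f r 1
    + 8 * q 2 r * curv' N f r 2 + 4 * q 3 r * curv' N f r 3 + pe r * deriv e r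
    + pm r * (-2 * b r / r)) r

/-- The diagonal components of the mixed tensor `ℰ^μ_ν` on the ansatz. -/
def gravR (N f : ℝ → ℝ) (q : Fin 4 → ℝ → ℝ) (pe pm e b l : ℝ → ℝ) (r : ℝ) : Fin 4 → ℝ :=
  let w := 2 * (q 1 r * curv N f r 1 + q 2 r * curv N f r 2 + q 3 r * curv N f r 3) - l r / 2
      + 2 * div₂R N f (divR N f q r) (fun i => deriv (fun r => divR N f q r i) r) r 2
      + pm r * b r / 2
  ![2 * (q 0 r * curv N f r 0 + 2 * (q 1 r * curv N f r 1)) - l r / 2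
      + 2 * div₂R N f (divR N f q r) (fun i => deriv (fun r => divR N f q r i) r) r 0
      + pe r * e r / 2,
    2 * (q 0 r * curv N f r 0 + 2 * (q 2 r * curv N f r 2)) - l r / 2
      + 2 * div₂R N f (divR N f q r) (fun i => deriv (fun r => divR N f q r i) r) r 1
      + pe r * e r / 2, w, w]

section
variable {N f : ℝ → ℝ} {I : Set ℝ} {L : Lagrangian} {A : Pt → Fin 4 → ℝ} {q : Fin 4 → ℝ → ℝ}
  {pe pm e b l : ℝ → ℝ}

theorem Background.riemann_eq (H : Background N f I) {x : Pt} (hx : x ∈ region I)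
    (α β γ δ : Fin 4) : riemann (sssMetric N f) x ![α, β, γ, δ]
      = planes (curv N f (x 1)) α β * metricD N f x α * metricD N f x β * kr₂ α β γ δ := by
  have : riemann (sssMetric N f) x ![α, β, γ, δ]
      = ∑ e, sssMetric N f x α e * riemannUp (sssMetric N f) x e β γ δ := rfl
  simp only [this, sssMetric_apply, H.riemannUp_eq hx, ite_mul, zero_mul, Finset.sum_ite_eq,
    Finset.mem_univ, if_true]
  ring

theorem sum_pi_four (F : (Fin 4 → Fin 4) → ℝ) :
    ∑ j, F j = ∑ a, ∑ b, ∑ c, ∑ d, F ![a, b, c, d] := by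
  let e : Fin 4 × Fin 4 × Fin 4 × Fin 4 ≃ (Fin 4 → Fin 4) :=
    { toFun := fun p => ![p.1, p.2.1, p.2.2.1, p.2.2.2]
      invFun := fun j => (j 0, j 1, j 2, j 3)
      left_inv := fun p => rfl
      right_inv := fun j => by ext i; fin_cases i <;> rfl }
  rw [← e.sum_comp]
  simp only [Fintype.sum_prod_type]
  rfl

theorem Resolved.Plow_eq (R : Resolved L N f A I q pe pm e b l) (H : Background N f I) {x : Pt}
    (hx : x ∈ region I) (α β γ δ : Fin 4) :
    Plow L (sssMetric N f) A x ![α, β, γ, δ] = diagCurv N f q x α β γ δ := by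
  have h : Plow L (sssMetric N f) A x ![α, β, γ, δ]
      = ∑ a, ∑ b, ∑ c, ∑ d, sssMetric N f x α a * sssMetric N f x β b * sssMetric N f x γ c
        * sssMetric N f x δ d * Pup L (sssMetric N f) A x ![a, b, c, d] := by
    simp only [Plow, sum_pi_four, Fin.prod_univ_four]
    rfl
  simp only [h, sssMetric_apply, R.Pup_eq x hx]
  simp only [ite_mul, zero_mul, mul_ite, mul_zero, Finset.sum_ite_eq, Finset.mem_univ, if_true, diagCurv]
  have hg := H.metricD_ne hx
  by_cases hk : kr₂ α β γ δ = 0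
  · simp [hk]
  -- A nonzero `kr₂` forces γ, δ to be α, β in one of the two orders.
  · have : metricD N f x γ * metricD N f x δ = metricD N f x α * metricD N f x β := by
      simp only [kr₂, kr] at hk
      split_ifs at hk <;> simp_all [mul_comm]
    have h1 := hg α
    have h2 := hg β
    field_simp
    linear_combination planes (fun i => q i (x 1)) α β * this

/-- The contraction of P with R, the double divergence of P and the product of M with F are each
diagonal, and after one index is raised they depend on r only. The vanishing off-diagonal
components, the relation between the angular components and the invariance under the Killing vectors
are all read off from here. -/
theorem Resolved.gravEq_eq (R : Resolved L N f A I q pe pm e b l) (H : Background N f I) {x : Pt}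
    (hx : x ∈ region I) (μ ν : Fin 4) : gravEq L (sssMetric N f) A x μ ν
      = metricD N f x μ * gravR N f q pe pm e b l (x 1) μ * kr μ ν := by
  have h1 := H.radius_ne _ hx.1
  have h2 := H.N_ne _ hx.1
  have h4 := sin_ne_of_mem_region hx
  have hg := H.metricD_ne hx
  have hP := fun y (hy : y ∈ region I) => R.Plow_eq H hy
  have hPs : ∀ i, ContDiffOn ℝ ∞ (fun y => Plow L (sssMetric N f) A y i) (region I) := fun i => by
    have hi : i = ![i 0, i 1, i 2, i 3] := by ext j; fin_cases j <;> rfl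
    rw [hi]
    exact (H.contDiffOn_diagCurv R.smooth_q _ _ _ _).congr fun y hy => hP y hy _ _ _ _
  have hW : ∀ μ ν, _ := fun μ ν => (H.sum_covD_covD hPs hx μ ν).trans
    (H.divLast_divLast (v := fun i r => divR N f q r i)
      (v' := fun i => deriv (fun r => divR N f q r i))
      (fun r hr i => hasDerivAt_of_smooth H.isOpen (H.contDiffOn_divR R.smooth_q i) hr)
      (fun _ => rfl) (fun _ => rfl)
      (fun y hy => H.divLast_diagCurv R.smooth_q hP hy) hx μ ν)
  -- The term -l/2 in `gravR` comes from -(1/2) g ℒ, which is not part of `gravAux`; it is added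
  -- back here.
  have haux : ∀ μ ν, gravAux L (sssMetric N f) A x μ ν = metricD N f x μ
      * (gravR N f q pe pm e b l (x 1) μ + l (x 1) / 2) * kr μ ν := by
    intro μ ν
    simp only [gravAux, hW, R.Pup_eq x hx, H.riemann_eq hx, R.Mup_eq x hx, R.field_eq x hx,
      sssMetric_apply, ite_mul, zero_mul, Finset.sum_ite_eq, Finset.mem_univ, if_true,
      Finset.sum_const_zero, Finset.sum_ite_irrel]
    have g0 := hg 0
    have g1 := hg 1
    have g2 := hg 2
    have g3 := hg 3
    fin_cases μ <;> fin_cases ν <;>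
      simp [Fin.sum_univ_four, kr₂, kr, planes, plane₂, gravR, div₂R, divR] <;>
      field_simp <;> ring
  simp only [gravEq, Matrix.of_apply, haux, R.lag_eq x hx, sssMetric_apply]
  rcases eq_or_ne μ ν with rfl | h
  · simp [kr]; ring
  · simp [kr, h, h.symm]

/-- Up to sign, √|g| M^{rt} is r² pe sin θ / 4, which gives the t-component. The density √|g| M^{θφ}
depends on r only, and r is not one of its indices, so the magnetic part has no divergence. -/
theorem Resolved.maxwellEq_eq (R : Resolved L N f A I q pe pm e b l) (H : Background N f I)
    {x : Pt} (hx : x ∈ region I) (ν : Fin 4) : maxwellEq L (sssMetric N f) A x ν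
      = -((deriv pe (x 1) + 2 * pe (x 1) / x 1) / (4 * N (x 1))) * kr ν 0 := by
  have h1 := H.radius_ne _ hx.1
  have h2 := H.N_ne _ hx.1
  have h3 := H.f_ne _ hx.1
  have h4 := sin_ne_of_mem_region hx
  have hlow : ∀ y ∈ region I, ∀ α β, Mlow L (sssMetric N f) A y ![α, β]
      = plane₂ (-(N (y 1) * pe (y 1)) / 4) (-(y 1 ^ 2 * pm (y 1) / 4) * Real.sin (y 2)) α β := by
    intro y hy α β
    have h1 := H.radius_ne _ hy.1
    have h2 := H.N_ne _ hy.1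
    have h3 := H.f_ne _ hy.1
    have h4 := sin_ne_of_mem_region hy
    have : Mlow L (sssMetric N f) A y ![α, β] = ∑ a, ∑ b, sssMetric N f y α a
      * sssMetric N f y β b * Mup L (sssMetric N f) A y a b := rfl
    rw [this]
    simp only [sssMetric_apply, ite_mul, zero_mul, mul_ite, mul_zero, Finset.sum_ite_eq,
      Finset.mem_univ, if_true, R.Mup_eq y hy]
    fin_cases α <;> fin_cases β <;> simp [plane₂, metricD, metricR, metricT] <;> field_simp
  have hN := hasDerivAt_of_smooth H.isOpen H.smooth_N hx.1
  have hpe := hasDerivAt_of_smooth H.isOpen R.smooth_pe hx.1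
  have hpm := hasDerivAt_of_smooth H.isOpen R.smooth_pm hx.1
  have d1 := (hN.fun_mul hpe).fun_neg.div_const 4
  have d2 := (((hasDerivAt_pow 2 (x 1)).fun_mul hpm).div_const 4).fun_neg
  have c1 := hasDerivAt_const (x 2) (1 : ℝ)
  have c0 := hasDerivAt_const (x 1) (0 : ℝ)
  have s2 := Real.hasDerivAt_sin (x 2)
  have hpd : ∀ μ α β, pd μ (fun y => Mlow L (sssMetric N f) A y ![α, β]) x
      = ![0, plane₂ (-(deriv N (x 1) * pe (x 1) + N (x 1) * deriv pe (x 1)) / 4)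
          (-((2 * x 1 * pm (x 1) + x 1 ^ 2 * deriv pm (x 1)) / 4) * Real.sin (x 2)) α β,
        plane₂ 0 (-(x 1 ^ 2 * pm (x 1) / 4) * Real.cos (x 2)) α β, 0] μ := by
    intro μ α β
    have z : ∀ α β, (∀ u w, plane₂ u w α β = 0) →
        pd μ (fun y => Mlow L (sssMetric N f) A y ![α, β]) x = 0 := fun α β h => by
      rw [pd_separated H.isOpen (φ := fun _ => 0) (ψ := fun _ => 1)
        (fun y hy => by rw [hlow y hy, h, zero_mul]) hx c0 c1 μ]
      fin_cases μ <;> simp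
    fin_cases α <;> fin_cases β
    -- The picked goals are the components tr, rt, θφ, φθ, whose positions shift as goals are
    -- closed; the remaining twelve components vanish identically.
    pick_goal 2
    · rw [pd_separated H.isOpen (fun y hy => (hlow y hy _ _).trans (mul_one _).symm) hx d1 c1 μ]
      fin_cases μ <;> simp [plane₂]
    pick_goal 4
    · rw [pd_separated H.isOpen (fun y hy => (hlow y hy _ _).trans (mul_one _).symm) hx
        d1.fun_neg c1 μ]
      fin_cases μ <;> simp [plane₂]
    pick_goal 10
    · rw [pd_separated H.isOpen (fun y hy => hlow y hy _ _) hx d2 s2 μ]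
      fin_cases μ <;> simp [plane₂]
    pick_goal 12
    · rw [pd_separated H.isOpen (fun y hy => (hlow y hy _ _).trans (neg_mul _ _).symm) hx
        d2.fun_neg s2 μ]
      fin_cases μ <;> simp [plane₂]
    all_goals
      refine (z _ _ fun _ _ => rfl).trans ?_
      fin_cases μ <;> simp [plane₂]
  simp only [maxwellEq, H.inv_sssMetric_apply hx, ite_mul, zero_mul, mul_ite, mul_zero,
    Finset.sum_ite_eq, Finset.mem_univ, if_true, covD_two, H.christoffel_eq hx, hlow x hx, hpd, chr]
  fin_cases ν <;>
    simp [Fin.sum_univ_four, metricD, metricR, metricT, kr, chrR, chrT, plane₂] <;>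
    field_simp <;> first | ring1 | norm_num

/-- The covariant divergence of a diagonal spherically symmetric tensor. -/
theorem Background.divergence_diagonal (H : Background N f I) {G G' : Fin 4 → ℝ → ℝ}
    (hG : ∀ r ∈ I, ∀ i, HasDerivAt (G i) (G' i r) r) (hG3 : ∀ r, G 3 r = G 2 r)
    {T : Pt → Tensor 2}
    (hT : ∀ y ∈ region I, ∀ α β, T y ![α, β] = metricD N f y α * G α (y 1) * kr α β) {x : Pt}
    (hx : x ∈ region I) (ν : Fin 4) :
    ∑ μ, ∑ a, (sssMetric N f x)⁻¹ μ a * covD (sssMetric N f) T x ![a, μ, ν]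
      = (G' 1 (x 1) + accel N f (x 1) * (G 1 (x 1) - G 0 (x 1))
        + 2 * (G 1 (x 1) - G 2 (x 1)) / x 1) * kr ν 1 := by
  have h1 := H.radius_ne _ hx.1
  have h2 := H.N_ne _ hx.1
  have h3 := H.f_ne _ hx.1
  have h4 := sin_ne_of_mem_region hx
  have hp : ∀ μ α β, pd μ (fun y => T y ![α, β]) x
      = ![0, (metricR' N f (x 1) α * G α (x 1) + metricR N f (x 1) α * G' α (x 1)) * metricT (x 2) α,
          metricR N f (x 1) α * G α (x 1) * metricT' (x 2) α, 0] μ * kr α β := by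
    intro μ α β
    rw [pd_separated H.isOpen (fun y hy => ?_) hx
      ((H.hasDerivAt_metricR hx.1 α).fun_mul (hG _ hx.1 α))
      ((hasDerivAt_metricT (x 2) α).mul_const (kr α β)) μ]
    · fin_cases μ <;> simp <;> ring
    · rw [hT y hy, metricD]; ring
  simp only [H.inv_sssMetric_apply hx, ite_mul, zero_mul,
    Finset.sum_ite_eq, Finset.mem_univ, if_true, covD_two, H.christoffel_eq hx, hT x hx, hp, chr]
  fin_cases ν <;>
    simp [Fin.sum_univ_four, metricD, metricR, metricT, metricR', metricT', kr, chrR, chrT, accel,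
      hG3] <;>
    field_simp <;> first | ring1 | norm_num

end

/-! ### The Noether identity and invariance under the Killing vectors. -/

section
variable {N f : ℝ → ℝ} {I : Set ℝ} {L : Lagrangian} {A : Pt → Fin 4 → ℝ} {q : Fin 4 → ℝ → ℝ}
  {pe pm e b l : ℝ → ℝ}

theorem Background.hasDerivAt_accel (H : Background N f I) {r : ℝ} (hr : r ∈ I) :
    HasDerivAt (accel N f) ((deriv (deriv N) r * N r - deriv N r * deriv N r) / N r ^ 2
        + (deriv (deriv f) r * f r - deriv f r * deriv f r) / (2 * f r ^ 2)) r :=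
  H.hasDerivAt_chrR hr 0 0 1

theorem Background.contDiffOn_curv (H : Background N f I) (i : Fin 4) :
    ContDiffOn ℝ ∞ (fun r => curv N f r i) I := by
  have sN := H.smooth_N
  have sf := H.smooth_f
  have sN1 := contDiffOn_deriv H.isOpen sN
  have sf1 := contDiffOn_deriv H.isOpen sf
  have sN2 := contDiffOn_deriv H.isOpen sN1
  have sf2 := contDiffOn_deriv H.isOpen sf1
  have si : ContDiffOn ℝ ∞ (fun r : ℝ => r) I := contDiffOn_id
  have sc : ∀ c : ℝ, ContDiffOn ℝ ∞ (fun _ : ℝ => c) I := fun c => contDiffOn_const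
  fin_cases i
  · exact ((((sf.mul sN2).div sN H.N_ne).add ((((sc 3).mul sf1).mul sN1).div ((sc 2).mul sN)
      fun r hr => mul_ne_zero two_ne_zero (H.N_ne r hr))).add (sf2.div_const 2)).neg
  · exact ((((sf.mul sN1).div sN H.N_ne).add (sf1.div_const 2)).neg).div si H.radius_ne
  · exact (sf1.div ((sc 2).mul si) fun r hr => mul_ne_zero two_ne_zero (H.radius_ne r hr)).neg
  · exact ((sc 1).sub sf).div (si.pow 2) fun r hr => pow_ne_zero 2 (H.radius_ne r hr)

/-- This is the radial Noether identity. The rr-component contains the divergence of P without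
derivatives, so differentiating it once produces just the derivative terms of the tt- and
θθ-components. The term -l/2 contributes, by `deriv_lag`, the contraction of P with the derivative
of the curvature; the explicit `curv'` lets what remains cancel. The last summand is the failure of
the electric Maxwell equation; on the magnetic side b' = -2b/r leaves no such term. -/
theorem Resolved.hasDerivAt_gravR_one (R : Resolved L N f A I q pe pm e b l)
    (H : Background N f I) {r : ℝ} (hr : r ∈ I) :
    HasDerivAt (fun r => gravR N f q pe pm e b l r 1)
      (-(accel N f r * (gravR N f q pe pm e b l r 1 - gravR N f q pe pm e b l r 0)
        + 2 * (gravR N f q pe pm e b l r 1 - gravR N f q pe pm e b l r 2) / r)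
        + e r * (deriv pe r + 2 * pe r / r) / 2) r := by
  have h1 := H.radius_ne _ hr
  have h2 := H.N_ne _ hr
  have h3 := H.f_ne _ hr
  have hf := hasDerivAt_of_smooth H.isOpen H.smooth_f hr
  have hq := fun i => hasDerivAt_of_smooth H.isOpen (R.smooth_q i) hr
  have hv := fun i => hasDerivAt_of_smooth H.isOpen (H.contDiffOn_divR R.smooth_q i) hr
  have hpe := hasDerivAt_of_smooth H.isOpen R.smooth_pe hr
  have he := hasDerivAt_of_smooth H.isOpen R.smooth_e hr
  have hk := H.hasDerivAt_curv hr
  have hα := H.hasDerivAt_accel hr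
  have key := ((((((hq 0).fun_mul (hk 0)).fun_add (((hq 2).fun_mul (hk 2)).const_mul 2)).const_mul 2).fun_sub
    ((R.deriv_lag r hr).div_const 2)).fun_add ((hf.fun_mul ((hα.fun_mul (hv 0)).fun_add
      (((hv 2).const_mul 2).fun_div (hasDerivAt_id' r) h1))).const_mul 2)).fun_add
      ((hpe.fun_mul he).div_const 2)
  refine key.congr_deriv ?_
  simp only [gravR, div₂R, Matrix.cons_val]
  -- These derivatives enter both sides linearly with equal coefficients and can stay opaque, which
  -- avoids second derivatives of q.
  generalize deriv (fun r => divR N f q r 0) r = v₀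
  generalize deriv (fun r => divR N f q r 2) r = v₂
  simp [divR, curv, curv', accel]
  field_simp
  ring

theorem Resolved.differentiableAt_gravR (R : Resolved L N f A I q pe pm e b l)
    (H : Background N f I) {r : ℝ} (hr : r ∈ I) (i : Fin 4) :
    DifferentiableAt ℝ (fun r => gravR N f q pe pm e b l r i) r := by
  have h1 := H.radius_ne _ hr
  have hf := (hasDerivAt_of_smooth H.isOpen H.smooth_f hr).differentiableAt
  have hf' := (hasDerivAt_of_smooth H.isOpen
    (contDiffOn_deriv H.isOpen H.smooth_f) hr).differentiableAt
  have hq := fun i => (hasDerivAt_of_smooth H.isOpen (R.smooth_q i) hr).differentiableAt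
  have hv := fun i => (hasDerivAt_of_smooth H.isOpen
    (H.contDiffOn_divR R.smooth_q i) hr).differentiableAt
  have hv' := fun i => (hasDerivAt_of_smooth H.isOpen (contDiffOn_deriv H.isOpen
    (H.contDiffOn_divR R.smooth_q i)) hr).differentiableAt
  have hpe := (hasDerivAt_of_smooth H.isOpen R.smooth_pe hr).differentiableAt
  have hpm := (hasDerivAt_of_smooth H.isOpen R.smooth_pm hr).differentiableAt
  have he := (hasDerivAt_of_smooth H.isOpen R.smooth_e hr).differentiableAt
  have hb := (R.deriv_b r hr).differentiableAt
  have hl := (R.deriv_lag r hr).differentiableAt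
  have hk := fun i => (H.hasDerivAt_curv hr i).differentiableAt
  have hα := (H.hasDerivAt_accel hr).differentiableAt
  have hi : DifferentiableAt ℝ (fun r : ℝ => r) r := differentiableAt_id
  have g0 : DifferentiableAt ℝ (fun r => gravR N f q pe pm e b l r 0) r :=
    (((((hq 0).mul (hk 0)).add (((hq 1).mul (hk 1)).const_mul 2)).const_mul 2).sub
      (hl.div_const 2)).add ((((hf.mul (hv' 0)).add ((hf'.div_const 2).mul (hv 0))).add
      (((hf.const_mul 2).mul (hv 0)).div hi h1)).const_mul 2) |>.add ((hpe.mul he).div_const 2)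
  have g2 : DifferentiableAt ℝ (fun r => gravR N f q pe pm e b l r 2) r :=
    ((((((hq 1).mul (hk 1)).add ((hq 2).mul (hk 2))).add ((hq 3).mul (hk 3))).const_mul 2).sub
      (hl.div_const 2)).add ((((hf.mul (hv' 2)).add (((hf'.div_const 2).add (hα.mul hf)).mul
      (hv 2))).add ((hf.mul (hv 2)).div hi h1)).const_mul 2) |>.add ((hpm.mul hb).div_const 2)
  have g1 := (R.hasDerivAt_gravR_one H hr).differentiableAt
  fin_cases i <;> assumption

/-- Only ν = r is nontrivial: the divergence of a diagonal radial tensor has no other component, and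
F_{νt} vanishes for the other ν. For ν = r the two sides agree by `hasDerivAt_gravR_one`. -/
theorem Resolved.divGravEq_eq (R : Resolved L N f A I q pe pm e b l) (H : Background N f I)
    {x : Pt} (hx : x ∈ region I) (ν : Fin 4) : divGravEq L (sssMetric N f) A x ν
      = -2 * ∑ l, fieldStrength A x ν l * maxwellEq L (sssMetric N f) A x l := by
  have h2 := H.N_ne _ hx.1
  have key := H.divergence_diagonal (G := fun i r => gravR N f q pe pm e b l r i)
    (G' := fun i => deriv (fun r => gravR N f q pe pm e b l r i))
    (fun r hr i => (R.differentiableAt_gravR H hr i).hasDerivAt) (fun _ => rfl)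
    (T := fun y (i : Fin 2 → Fin 4) => gravEq L (sssMetric N f) A y (i 0) (i 1))
    (fun y hy α β => R.gravEq_eq H hy α β) hx ν
  rw [divGravEq, key, (R.hasDerivAt_gravR_one H hx.1).deriv]
  simp only [R.maxwellEq_eq H hx, R.field_eq x hx]
  fin_cases ν <;> simp [kr, plane₂]
  field_simp
  ring

theorem pd_killing {x : Pt} (hx : Real.sin (x 2) ≠ 0) (i μ ν : Fin 4) :
    pd μ (fun y => killing i y ν) x
      = ![0, 0,
          ![0, 0, ![0, 0, 0, Real.cos (x 3) / Real.sin (x 2) ^ 2],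
            ![0, 0, -Real.cos (x 3), Real.sin (x 3) * (Real.cos (x 2) / Real.sin (x 2))]],
          ![0, 0, ![0, 0, 0, Real.sin (x 3) / Real.sin (x 2) ^ 2],
            ![0, 0, -Real.sin (x 3), -(Real.cos (x 3) * (Real.cos (x 2) / Real.sin (x 2)))]]]
        i μ ν := by
  have d1 : deriv (fun θ => Real.cos θ / Real.sin θ) (x 2) = -1 / Real.sin (x 2) ^ 2 :=
    (hasDerivAt_chrT hx 3 2 3).deriv
  fin_cases i <;> fin_cases μ <;> fin_cases ν <;>
    simp [pd, killing, Function.update, d1, Real.cot_eq_cos_div_sin] <;> ring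

/-- Spherical symmetry and staticity of the field equations. -/
theorem Resolved.lieD_gravEq (R : Resolved L N f A I q pe pm e b l) (H : Background N f I)
    {x : Pt} (hx : x ∈ region I) (i μ ν : Fin 4) :
    lieD (killing i) (gravEq L (sssMetric N f) A) x μ ν = 0 := by
  have h4 := sin_ne_of_mem_region hx
  have hG := fun i => (R.differentiableAt_gravR H hx.1 i).hasDerivAt
  have hp : ∀ μ α β, pd μ (fun y => gravEq L (sssMetric N f) A y α β) x
      = ![0, (metricR' N f (x 1) α * gravR N f q pe pm e b l (x 1) α
          + metricR N f (x 1) α * deriv (fun r => gravR N f q pe pm e b l r α) (x 1))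
            * metricT (x 2) α,
          metricR N f (x 1) α * gravR N f q pe pm e b l (x 1) α * metricT' (x 2) α, 0] μ
        * kr α β := by
    intro μ α β
    rw [pd_separated H.isOpen (fun y hy => ?_) hx
      ((H.hasDerivAt_metricR hx.1 α).fun_mul (hG α))
      ((hasDerivAt_metricT (x 2) α).mul_const (kr α β)) μ]
    · fin_cases μ <;> simp <;> ring
    · rw [R.gravEq_eq H hy, metricD]; ring
  -- The two rotations that move the polar axis preserve the tensor because its two angular mixed
  -- components agree.
  have h32 : gravR N f q pe pm e b l (x 1) 3 = gravR N f q pe pm e b l (x 1) 2 := rfl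
  simp only [lieD, hp, pd_killing h4, R.gravEq_eq H hx, Fin.sum_univ_four]
  fin_cases i <;> fin_cases μ <;> fin_cases ν <;>
    simp [killing, metricD, metricR, metricT, metricT', kr, h32, Real.cot_eq_cos_div_sin] <;>
    field_simp <;> ring1

end

/-! ### Algebra of curvature tensors -/

theorem eq_vec_four (i : Fin 4 → Fin 4) : i = ![i 0, i 1, i 2, i 3] := by
  ext j; fin_cases j <;> rfl

theorem tensor_ext {S T : Tensor 4} (h : ∀ a b c d, S ![a, b, c, d] = T ![a, b, c, d]) : S = T := by
  funext i
  rw [eq_vec_four i]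
  exact h _ _ _ _

theorem isCurvatureTensor_curvProj (T : Tensor 4) : IsCurvatureTensor (curvProj T) := by
  intro a b c d
  simp only [curvProj, Matrix.cons_val]
  refine ⟨?_, ?_, ?_, ?_⟩ <;> ring

theorem curvProj_of_isCurvatureTensor {R : Tensor 4} (hR : IsCurvatureTensor R) :
    curvProj R = R := by
  refine tensor_ext fun a b c d => ?_
  have key : ∀ a b c d, (1 / 8) * (R ![a, b, c, d] - R ![b, a, c, d] - R ![a, b, d, c]
      + R ![b, a, d, c] + R ![c, d, a, b] - R ![d, c, a, b] - R ![c, d, b, a] + R ![d, c, b, a])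
      = R ![a, b, c, d] := by
    intro a b c d
    have h1 := (hR a b c d).1
    have h2 := (hR a b c d).2.1
    have h3 := (hR a b c d).2.2.1
    have h4 := (hR b a c d).2.1
    have h5 := (hR b a c d).2.2.1
    have h6 := (hR a b d c).2.2.1
    have h7 := (hR b a d c).2.2.1
    linarith
  simp only [curvProj, Matrix.cons_val, key]
  linarith [(hR a b c d).2.2.2]

/-- `curvProj` as a linear map. -/
def curvProjₗ : Tensor 4 →ₗ[ℝ] Tensor 4 where
  toFun := curvProj
  map_add' S T := by
    funext i
    simp only [curvProj, Pi.add_apply]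
    ring
  map_smul' c T := by
    funext i
    simp only [curvProj, Pi.smul_apply, smul_eq_mul, RingHom.id_apply]
    ring

theorem IsCurvatureTensor.add {R S : Tensor 4} (hR : IsCurvatureTensor R)
    (hS : IsCurvatureTensor S) : IsCurvatureTensor (R + S) := by
  intro a b c d
  obtain ⟨h1, h2, h3, h4⟩ := hR a b c d
  obtain ⟨k1, k2, k3, k4⟩ := hS a b c d
  simp only [Pi.add_apply]
  refine ⟨?_, ?_, ?_, ?_⟩ <;> linarith

/-- A monomial matrix. -/
def monomialMat (π : Equiv.Perm (Fin 4)) (ε : Fin 4 → ℝ) : Mat :=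
  Matrix.of fun j i => if j = π i then ε i else 0

/-- For a monomial matrix the sum over index tuples has a single term. Such matrices occur in two
roles: signed permutations are symmetries of the frame data, and diagonal ones (π = 1) pass from
coordinates to an orthonormal frame. -/
theorem pullback_monomialMat (π : Equiv.Perm (Fin 4)) (ε : Fin 4 → ℝ) {k : ℕ} (T : Tensor k)
    (i : Fin k → Fin 4) :
    pullback (monomialMat π ε) T i = (∏ l, ε (i l)) * T (π ∘ i) := by
  rw [pullback, Finset.sum_eq_single (π ∘ i)]
  · simp [monomialMat]
  · intro j _ hj
    obtain ⟨l, hl⟩ := Function.ne_iff.1 hj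
    rw [Finset.prod_eq_zero (Finset.mem_univ l), zero_mul]
    exact if_neg hl
  · simp

theorem monomialMat_congr (π : Equiv.Perm (Fin 4)) (ε : Fin 4 → ℝ) (g : Mat) (a b : Fin 4) :
    ((monomialMat π ε).transpose * g * monomialMat π ε) a b = ε a * ε b * g (π a) (π b) := by
  simp only [Matrix.mul_apply, Matrix.transpose_apply, monomialMat, Matrix.of_apply, ite_mul,
    zero_mul, mul_ite, mul_zero, Finset.sum_ite_eq', Finset.mem_univ, if_true]
  ring

theorem isUnit_det_monomialMat (π : Equiv.Perm (Fin 4)) {ε : Fin 4 → ℝ} (hε : ∀ a, ε a ≠ 0) :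
    IsUnit (monomialMat π ε).det := by
  have h : monomialMat π ε = (Matrix.diagonal ε).submatrix π.symm id := by
    ext j i
    simp only [monomialMat, Matrix.of_apply, Matrix.submatrix_apply, Matrix.diagonal_apply, id,
      Equiv.symm_apply_eq]
    split_ifs with h1
    · rw [h1]; simp
    · rfl
  rw [h, Matrix.det_permute, Matrix.det_diagonal]
  refine IsUnit.mul ?_ (isUnit_iff_ne_zero.2 (Finset.prod_ne_zero_iff.2 fun a _ => hε a))
  rcases Int.units_eq_one_or (Equiv.Perm.sign π.symm) with h | h <;> simp [h]

theorem pullback_add {k : ℕ} (A : Mat) (S T : Tensor k) :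
    pullback A (S + T) = pullback A S + pullback A T := by
  funext i
  simp [pullback, mul_add, Finset.sum_add_distrib]

theorem pullback_smul {k : ℕ} (A : Mat) (s : ℝ) (T : Tensor k) :
    pullback A (s • T) = s • pullback A T := by
  funext i
  simp only [pullback, Pi.smul_apply, smul_eq_mul, Finset.mul_sum]
  exact Finset.sum_congr rfl fun _ _ => by ring

theorem single_comp_perm (π : Equiv.Perm (Fin 4)) (i m : Fin 4 → Fin 4) :
    (Pi.single (π ∘ i) 1 : Tensor 4) (π ∘ m) = (Pi.single i 1 : Tensor 4) m := by
  simp only [Pi.single_apply]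
  congr 1
  exact propext ⟨fun h => π.injective.comp_left h, fun h => by rw [h]⟩

theorem pullback_curvProj_single (π : Equiv.Perm (Fin 4)) (ε : Fin 4 → ℝ) (i : Fin 4 → Fin 4) :
    pullback (monomialMat π ε) (curvProj (Pi.single (π ∘ i) 1))
      = (∏ l, ε (i l)) • curvProj (Pi.single i 1) := by
  refine tensor_ext fun a b c d => ?_
  have hT : ∀ a b c d, ε a * ε b * ε c * ε d * (Pi.single (π ∘ i) 1 : Tensor 4) ![π a, π b, π c, π d]
      = (∏ l, ε (i l)) * (Pi.single i 1 : Tensor 4) ![a, b, c, d] := by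
    intro a b c d
    have : ![π a, π b, π c, π d] = π ∘ ![a, b, c, d] := by ext j; fin_cases j <;> rfl
    rw [this, single_comp_perm, Pi.single_apply]
    split_ifs with h
    · rw [← h]; simp [Fin.prod_univ_four]
    · simp
  rw [pullback_monomialMat]
  simp only [Fin.prod_univ_four (f := fun l => ε (![a, b, c, d] l)), Matrix.cons_val,
    Pi.smul_apply, smul_eq_mul, curvProj, Function.comp_apply]
  -- The coefficients are those of `curvProj`: 1/8 for the pair symmetrisation, and 1/24 = 1/3 · 1/8
  -- for each of the three cyclic terms of the totally antisymmetric part.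
  linear_combination (1 / 8) * (hT a b c d - hT b a c d - hT a b d c + hT b a d c + hT c d a b
    - hT d c a b - hT c d b a + hT d c b a)
    - (1 / 24) * (hT a b c d - hT b a c d - hT a b d c + hT b a d c + hT c d a b
    - hT d c a b - hT c d b a + hT d c b a)
    - (1 / 24) * (hT a c d b - hT c a d b - hT a c b d + hT c a b d + hT d b a c
    - hT b d a c - hT d b c a + hT b d c a)
    - (1 / 24) * (hT a d b c - hT d a b c - hT a d c b + hT d a c b + hT b c a d
    - hT c b a d - hT b c d a + hT c b d a)

/-- The Kulkarni–Nomizu product of symmetric matrices. -/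
def kn (h k : Mat) : Tensor 4 := fun i =>
  h (i 0) (i 2) * k (i 1) (i 3) + h (i 1) (i 3) * k (i 0) (i 2)
    - h (i 0) (i 3) * k (i 1) (i 2) - h (i 1) (i 2) * k (i 0) (i 3)

theorem isCurvatureTensor_kn {h k : Mat} (hh : h.transpose = h) (hk : k.transpose = k) :
    IsCurvatureTensor (kn h k) := by
  have h1 : ∀ a b, h a b = h b a := fun a b => congrFun (congrFun hh b) a
  have k1 : ∀ a b, k a b = k b a := fun a b => congrFun (congrFun hk b) a
  intro a b c d
  simp only [kn, Matrix.cons_val]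
  refine ⟨by ring, by ring, ?_, ?_⟩
  · rw [h1 a c, h1 b d, h1 a d, h1 b c, k1 a c, k1 b d, k1 a d, k1 b c]; ring
  · rw [h1 c d, h1 b d, h1 b c, k1 c d, k1 b d, k1 b c]
    rw [h1 d c, k1 d c]; ring

/-- Boosts are not monomial; their action on curvature tensors is computed through this product,
which reduces it to congruences of symmetric matrices. -/
theorem pullback_kn (A h k : Mat) :
    pullback A (kn h k) = kn (A.transpose * h * A) (A.transpose * k * A) := by
  refine tensor_ext fun a b c d => ?_
  simp only [pullback, sum_pi_four, Fin.prod_univ_four, kn, Matrix.cons_val, Matrix.mul_apply,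
    Matrix.transpose_apply]
  simp only [Fin.sum_univ_four]
  ring

/-! ### First variations of an invariant Lagrangian -/

section
attribute [local instance] Matrix.normedAddCommGroup Matrix.normedSpace

variable {L : Lagrangian} {g F : Mat} {R : Tensor 4}

/-- The domain of ℒ is open only relative to the admissible values, which are not open in the space
of arrays. All differentiations are therefore carried out along smooth parametrisations with values
in `pointValues`, whose preimages of the domain are open. -/
theorem Lagrangian.isOpen_preimage_dom (L : Lagrangian) {E : Type*} [NormedAddCommGroup E]
    [NormedSpace ℝ E] {m : E → Mat × Tensor 4 × Mat} (hm : ContDiff ℝ ∞ m)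
    (hv : ∀ p, m p ∈ pointValues) : IsOpen (m ⁻¹' L.dom) := by
  obtain ⟨U, hU, hd⟩ := L.dom_open
  have : m ⁻¹' L.dom = m ⁻¹' U := by
    ext p; simp [hd, hv p]
  rw [this]
  exact hU.preimage hm.continuous

theorem Lagrangian.contDiffOn_comp (L : Lagrangian) {E : Type*} [NormedAddCommGroup E]
    [NormedSpace ℝ E] {m : E → Mat × Tensor 4 × Mat} (hm : ContDiff ℝ ∞ m) :
    ContDiffOn ℝ ∞ (fun p => L.toFun (m p).1 (m p).2.1 (m p).2.2) (m ⁻¹' L.dom) :=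
  L.smooth.comp hm.contDiffOn fun _ hp => hp

/-- Variations of curvature and field strength. -/
def variationMap (g : Mat) (R : Tensor 4) (F : Mat) (p : Tensor 4 × Mat) : Mat × Tensor 4 × Mat :=
  (g, R + curvProj p.1, F + (1 / 2 : ℝ) • (p.2 - p.2.transpose))

theorem contDiff_variationMap (g : Mat) (R : Tensor 4) (F : Mat) :
    ContDiff ℝ ∞ (variationMap g R F) := by
  refine contDiff_const.prodMk (ContDiff.prodMk ?_ ?_)
  · exact contDiff_const.add ((LinearMap.toContinuousLinearMap curvProjₗ).contDiff.comp
      contDiff_fst)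
  · have h : ContDiff ℝ ∞ fun M : Mat => M.transpose :=
      (LinearMap.toContinuousLinearMap
        (Matrix.transposeLinearEquiv (Fin 4) (Fin 4) ℝ ℝ).toLinearMap).contDiff
    exact contDiff_const.add ((contDiff_snd.sub (h.comp contDiff_snd)).const_smul _)

theorem variationMap_mem (h : (g, R, F) ∈ pointValues) (p : Tensor 4 × Mat) :
    variationMap g R F p ∈ pointValues := by
  refine ⟨h.1, h.2.1.add (isCurvatureTensor_curvProj _), ?_⟩
  have := h.2.2
  simp only [variationMap, Matrix.transpose_add, Matrix.transpose_smul, Matrix.transpose_sub,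
    Matrix.transpose_transpose] at this ⊢
  rw [this, neg_add, ← smul_neg, neg_sub]

theorem variationMap_zero (g : Mat) (R : Tensor 4) (F : Mat) :
    variationMap g R F 0 = (g, R, F) := by
  have : curvProj 0 = 0 := curvProjₗ.map_zero
  simp [variationMap, this]

/-- The Lagrangian as a function of variations of curvature and field strength. -/
def variation (L : Lagrangian) (g : Mat) (R : Tensor 4) (F : Mat) (p : Tensor 4 × Mat) : ℝ :=
  L.toFun g (R + curvProj p.1) (F + (1 / 2 : ℝ) • (p.2 - p.2.transpose))

theorem Lagrangian.mem_pointValues (h : (g, R, F) ∈ L.dom) : (g, R, F) ∈ pointValues := by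
  obtain ⟨U, -, hd⟩ := L.dom_open
  rw [hd] at h
  exact h.2

theorem Lagrangian.eventually_mem (h : (g, R, F) ∈ L.dom) :
    ∀ᶠ p in nhds 0, variationMap g R F p ∈ L.dom :=
  (L.isOpen_preimage_dom (contDiff_variationMap g R F)
    (variationMap_mem (L.mem_pointValues h))).mem_nhds (by
      rw [Set.mem_preimage, variationMap_zero]; exact h)

/-- The first variation. -/
def firstVar (L : Lagrangian) (g : Mat) (R : Tensor 4) (F : Mat) : Tensor 4 × Mat →L[ℝ] ℝ :=
  fderiv ℝ (variation L g R F) 0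

theorem hasFDerivAt_variation (h : (g, R, F) ∈ L.dom) :
    HasFDerivAt (variation L g R F) (firstVar L g R F) 0 := by
  have h1 := L.contDiffOn_comp (contDiff_variationMap g R F)
  have h2 : ContDiffAt ℝ ∞ (variation L g R F) 0 := h1.contDiffAt (L.eventually_mem h)
  exact (h2.differentiableAt (by simp)).hasFDerivAt

theorem hasDerivAt_variation (h : (g, R, F) ∈ L.dom) {c : ℝ → Tensor 4 × Mat}
    {c' : Tensor 4 × Mat} {s : ℝ} (hc : HasDerivAt c c' s) (h0 : c s = 0) :
    HasDerivAt (fun s => variation L g R F (c s)) (firstVar L g R F c') s := by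
  have hv : HasFDerivAt (variation L g R F) (firstVar L g R F) (c s) := by
    rw [h0]; exact hasFDerivAt_variation h
  exact hv.comp_hasDerivAt s hc

theorem hasDerivAt_variation_smul (h : (g, R, F) ∈ L.dom) (p : Tensor 4 × Mat) :
    HasDerivAt (fun s : ℝ => variation L g R F (s • p)) (firstVar L g R F p) 0 := by
  refine hasDerivAt_variation h ?_ (zero_smul _ _)
  have := (hasDerivAt_id' (0 : ℝ)).smul_const p
  rw [one_smul] at this
  exact this

theorem curvProj_smul (s : ℝ) (T : Tensor 4) : curvProj (s • T) = s • curvProj T :=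
  curvProjₗ.map_smul s T

theorem dRiem_eq_firstVar (h : (g, R, F) ∈ L.dom) (i : Fin 4 → Fin 4) :
    dRiem L g R F i = firstVar L g R F (Pi.single i 1, 0) := by
  rw [← (hasDerivAt_variation_smul h _).deriv, dRiem]
  simp [variation, curvProj_smul]

theorem dField_eq_firstVar (h : (g, R, F) ∈ L.dom) (a b : Fin 4) :
    dField L g R F a b = firstVar L g R F (0, Matrix.single a b 1) := by
  have h0 : curvProj 0 = 0 := curvProjₗ.map_zero
  rw [← (hasDerivAt_variation_smul h _).deriv, dField]
  simp only [variation, Matrix.of_apply, Prod.smul_mk, smul_zero, h0, add_zero,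
    Matrix.transpose_smul, Matrix.transpose_single, ← smul_sub]
  simp only [smul_comm (1 / 2 : ℝ)]

/-- Linearity on the basis arrays. Since the projections are built into `variation`, arbitrary
arrays T and G are allowed here. -/
theorem firstVar_eq_sum (h : (g, R, F) ∈ L.dom) (T : Tensor 4) (G : Mat) :
    firstVar L g R F (T, G) = ∑ a, ∑ b, ∑ c, ∑ d, T ![a, b, c, d] * dRiem L g R F ![a, b, c, d]
      + ∑ a, ∑ b, G a b * dField L g R F a b := by
  have h1 : firstVar L g R F (T, 0) = ∑ i, T i * dRiem L g R F i := by
    have : (T, (0 : Mat)) = ∑ i, T i • ((Pi.single i 1 : Tensor 4), (0 : Mat)) := by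
      ext1
      · simp [Prod.fst_sum, ← Pi.single_smul, Finset.univ_sum_single]
      · simp [Prod.snd_sum]
    rw [this, map_sum]
    simp only [map_smul, smul_eq_mul, dRiem_eq_firstVar h]
  have h2 : firstVar L g R F (0, G) = ∑ a, ∑ b, G a b * dField L g R F a b := by
    have : ((0 : Tensor 4), G) = ∑ a, ∑ b, G a b • ((0 : Tensor 4), Matrix.single a b (1 : ℝ)) := by
      ext1
      · simp [Prod.fst_sum]
      · simp only [Prod.snd_sum, Prod.smul_snd, Matrix.smul_single, smul_eq_mul, mul_one]
        exact Matrix.matrix_eq_sum_single G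
    rw [this, map_sum]
    simp only [map_sum, map_smul, smul_eq_mul, dField_eq_firstVar h]
  rw [← sum_pi_four fun i => T i * dRiem L g R F i, ← h1, ← h2, ← map_add]
  simp

/-- Invariance of the first variation under changes of basis. -/
theorem firstVar_congr (h : (g, R, F) ∈ L.dom) {A : Mat} (hA : IsUnit A.det) {T T' : Tensor 4}
    {G G' : Mat} (hT : curvProj T' = pullback A (curvProj T))
    (hG : G' - G'.transpose = A.transpose * (G - G.transpose) * A) :
    firstVar L g R F (T, G)
      = firstVar L (A.transpose * g * A) (pullback A R) (A.transpose * F * A) (T', G') := by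
  have h1 := hasDerivAt_variation_smul h (T, G)
  have h2 := hasDerivAt_variation_smul (L.dom_invariant A hA g R F h) (T', G')
  have hc : Filter.Tendsto (fun s : ℝ => s • (T, G)) (nhds 0) (nhds 0) := by
    have : Continuous fun s : ℝ => s • (T, G) := by fun_prop
    simpa using this.tendsto 0
  refine h1.unique (h2.congr_of_eventuallyEq ?_)
  filter_upwards [hc (L.eventually_mem h)] with s hs
  have key := L.invariant A hA _ _ _ hs
  rw [variation, ← key]
  simp only [variation, Prod.smul_mk, curvProj_smul, pullback_add, pullback_smul, hT,
    Matrix.transpose_smul, ← smul_sub, hG, Matrix.mul_add, Matrix.add_mul, Matrix.mul_smul,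
    Matrix.smul_mul]

/-- A monomial change of basis sends the projection of a basis array to a multiple of another such
projection, so the transformation law of ∂ℒ/∂R holds component by component. -/
theorem dRiem_monomialMat (h : (g, R, F) ∈ L.dom) (π : Equiv.Perm (Fin 4)) {ε : Fin 4 → ℝ}
    (hε : ∀ a, ε a ≠ 0) (i : Fin 4 → Fin 4) :
    dRiem L g R F (π ∘ i) = (∏ l, ε (i l)) * dRiem L
      ((monomialMat π ε).transpose * g * monomialMat π ε) (pullback (monomialMat π ε) R)
      ((monomialMat π ε).transpose * F * monomialMat π ε) i := by
  have hA := isUnit_det_monomialMat π hε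
  rw [dRiem_eq_firstVar h, dRiem_eq_firstVar (L.dom_invariant _ hA _ _ _ h), ← smul_eq_mul,
    ← map_smul]
  refine firstVar_congr h hA ?_ (by simp)
  rw [pullback_curvProj_single, ← curvProj_smul]

theorem dField_monomialMat (h : (g, R, F) ∈ L.dom) (π : Equiv.Perm (Fin 4)) {ε : Fin 4 → ℝ}
    (hε : ∀ a, ε a ≠ 0) (a b : Fin 4) :
    dField L g R F (π a) (π b) = ε a * ε b * dField L
      ((monomialMat π ε).transpose * g * monomialMat π ε) (pullback (monomialMat π ε) R)
      ((monomialMat π ε).transpose * F * monomialMat π ε) a b := by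
  have hA := isUnit_det_monomialMat π hε
  rw [dField_eq_firstVar h, dField_eq_firstVar (L.dom_invariant _ hA _ _ _ h), ← smul_eq_mul,
    ← map_smul]
  refine firstVar_congr h hA ?_ ?_
  · have h0 : curvProj 0 = 0 := curvProjₗ.map_zero
    funext i
    simp [h0, pullback]
  · ext c d
    rw [monomialMat_congr]
    simp only [Matrix.sub_apply, Matrix.transpose_apply, Matrix.smul_apply,
      smul_eq_mul, Matrix.single_apply, EmbeddingLike.apply_eq_iff_eq]
    by_cases h1 : a = c <;> by_cases h2 : b = d <;> by_cases h3 : a = d <;> by_cases h4 : b = c <;>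
      simp_all [mul_comm]

/-- The derivative in the direction of a basis array depends only on its projection, and the index
exchanges in question change this projection by at most a sign. -/
theorem dRiem_symm (h : (g, R, F) ∈ L.dom) (a b c d : Fin 4) :
    dRiem L g R F ![a, b, c, d] = -dRiem L g R F ![b, a, c, d] ∧
    dRiem L g R F ![a, b, c, d] = -dRiem L g R F ![a, b, d, c] ∧
    dRiem L g R F ![a, b, c, d] = dRiem L g R F ![c, d, a, b] := by
  have key : ∀ i i' : Fin 4 → Fin 4, ∀ s : ℝ,
      curvProj (Pi.single i 1) = s • curvProj (Pi.single i' 1) →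
      dRiem L g R F i = s * dRiem L g R F i' := by
    intro i i' s hs
    rw [dRiem_eq_firstVar h, dRiem_eq_firstVar h, ← smul_eq_mul, ← map_smul]
    -- With the identity as change of basis, this says that the first variation depends on its
    -- arguments only through their projections.
    have := firstVar_congr h (A := 1) (by simp) (T := Pi.single i 1)
      (T' := s • Pi.single i' 1) (G := 0) (G' := 0) ?_ (by simp)
    · have hR : pullback 1 R = R := by
        have e : (1 : Mat) = monomialMat 1 1 := by
          ext a b; exact Matrix.one_apply
        funext i; rw [e, pullback_monomialMat]; simp
      simpa [hR] using this
    · have e : (1 : Mat) = monomialMat 1 1 := by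
        ext a b; exact Matrix.one_apply
      rw [curvProj_smul, hs]
      funext i; rw [e, pullback_monomialMat]; simp
  have hs : ∀ a b c d m n p q : Fin 4, (Pi.single ![a, b, c, d] 1 : Tensor 4) ![m, n, p, q]
      = kr a m * kr b n * kr c p * kr d q := by
    intro a b c d m n p q
    have : (![m, n, p, q] = ![a, b, c, d]) ↔ (a = m ∧ b = n ∧ c = p ∧ d = q) := by
      constructor
      · intro h
        exact ⟨(congrFun h 0).symm, (congrFun h 1).symm, (congrFun h 2).symm, (congrFun h 3).symm⟩
      · rintro ⟨rfl, rfl, rfl, rfl⟩; rfl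
    simp only [Pi.single_apply, this, kr]
    split_ifs <;> simp_all
  refine ⟨?_, ?_, ?_⟩
  · rw [key ![a, b, c, d] ![b, a, c, d] (-1), neg_one_mul]
    funext m
    simp only [curvProj, hs, Pi.smul_apply, smul_eq_mul]
    ring
  · rw [key ![a, b, c, d] ![a, b, d, c] (-1), neg_one_mul]
    funext m
    simp only [curvProj, hs, Pi.smul_apply, smul_eq_mul]
    ring
  · rw [key ![a, b, c, d] ![c, d, a, b] 1, one_mul]
    funext m
    simp only [curvProj, hs, Pi.smul_apply, smul_eq_mul]
    ring

/-- Along a symmetric direction the projected field strength does not move, so the derivative there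
is zero. -/
theorem dField_antisymm (h : (g, R, F) ∈ L.dom) (a b : Fin 4) :
    dField L g R F a b = -dField L g R F b a := by
  have h1 := hasDerivAt_variation_smul h (0, Matrix.single a b 1 + Matrix.single b a 1)
  have h2 : (fun s : ℝ => variation L g R F
      (s • ((0 : Tensor 4), Matrix.single a b (1 : ℝ) + Matrix.single b a 1)))
      = fun _ => variation L g R F 0 := by
    funext s
    simp [variation, Matrix.transpose_add, add_comm]
  rw [h2] at h1
  have h3 := h1.unique (hasDerivAt_const _ _)
  rw [firstVar_eq_sum h] at h3
  rw [dField_eq_firstVar h, dField_eq_firstVar h, eq_neg_iff_add_eq_zero, ← map_add, Prod.mk_add_mk,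
    add_zero, firstVar_eq_sum h]
  exact h3

end

/-! ### The Lagrangian in an orthonormal frame -/

/-- The orthonormal frame metric; `σ = ±1` is the sign of `f`. -/
def frameMetric (σ : ℝ) : Fin 4 → ℝ := ![-σ, σ, 1, 1]

/-- The curvature tensor with sectional curvatures `k` in an orthonormal frame. -/
def frameCurv (σ : ℝ) (k : Fin 4 → ℝ) : Tensor 4 := fun i =>
  planes k (i 0) (i 1) * frameMetric σ (i 0) * frameMetric σ (i 1) * kr₂ (i 0) (i 1) (i 2) (i 3)

theorem frameMetric_mul_self {σ : ℝ} (hσ : σ * σ = 1) (a : Fin 4) :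
    frameMetric σ a * frameMetric σ a = 1 := by
  fin_cases a <;> simp [frameMetric, hσ]

theorem isLorentzian_frameMetric {σ : ℝ} (hσ : σ * σ = 1) :
    IsLorentzian (Matrix.diagonal (frameMetric σ)) := by
  rcases mul_self_eq_one_iff.1 hσ with rfl | rfl
  · refine ⟨1, by simp, ?_⟩
    simp [frameMetric]
  -- For σ = -1 the second basis vector is timelike; exchanging the first two restores the standard
  -- signature.
  · refine ⟨monomialMat (Equiv.swap 0 1) 1, isUnit_det_monomialMat _ (by simp), ?_⟩
    ext a b
    rw [monomialMat_congr]
    simp only [Matrix.diagonal_apply, EmbeddingLike.apply_eq_iff_eq]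
    fin_cases a <;> simp [frameMetric]
    all_goals split_ifs <;> rfl

/-- The metric of the `tr` plane. -/
def frameT (σ : ℝ) : Mat := Matrix.diagonal ![-σ, σ, 0, 0]

/-- The metric of the `θφ` plane. -/
def frameS : Mat := Matrix.diagonal ![0, 0, 1, 1]

/-- A symmetric matrix in the `tr` plane. -/
def symT (x y z : ℝ) : Mat := Matrix.of ![![x, y, 0, 0], ![y, z, 0, 0], ![0, 0, 0, 0], ![0, 0, 0, 0]]

theorem eq_of_antisymm₂ {u v : Fin 4 → Fin 4 → Fin 4 → Fin 4 → ℝ}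
    (hu : ∀ a b c d, u a b c d = -u b a c d) (hu' : ∀ a b c d, u a b c d = -u a b d c)
    (hv : ∀ a b c d, v a b c d = -v b a c d) (hv' : ∀ a b c d, v a b c d = -v a b d c)
    (h : ∀ a b c d, a < b → c < d → u a b c d = v a b c d) (a b c d : Fin 4) :
    u a b c d = v a b c d := by
  have h1 : ∀ a b c d, a < b → u a b c d = v a b c d := fun a b c d hab =>
    eq_of_antisymm (u := u a b) (v := v a b) (hu' a b) (hv' a b)
      (h _ _ _ _ hab (by decide)) (h _ _ _ _ hab (by decide)) (h _ _ _ _ hab (by decide))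
      (h _ _ _ _ hab (by decide)) (h _ _ _ _ hab (by decide)) (h _ _ _ _ hab (by decide)) c d
  exact eq_of_antisymm (u := fun a b => u a b c d) (v := fun a b => v a b c d)
    (fun a b => hu a b c d) (fun a b => hv a b c d) (h1 _ _ _ _ (by decide))
    (h1 _ _ _ _ (by decide)) (h1 _ _ _ _ (by decide)) (h1 _ _ _ _ (by decide))
    (h1 _ _ _ _ (by decide)) (h1 _ _ _ _ (by decide)) a b

/-- The three summands belong to the plane tr, to the four mixed planes and to the plane θφ. A boost
preserves `frameT` and `frameS`, hence acts only on the `symT` factor of the mixed part. The halves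
compensate for the factor two in the product of a matrix with itself. -/
theorem frameCurv_eq_kn (σ : ℝ) (k : Fin 4 → ℝ) : frameCurv σ k
    = (k 0 / 2) • kn (frameT σ) (frameT σ) + kn (symT (-(σ * k 1)) 0 (σ * k 2)) frameS
      + (k 3 / 2) • kn frameS frameS := by
  refine tensor_ext fun a b c d => ?_
  refine eq_of_antisymm₂ (u := fun a b c d => frameCurv σ k ![a, b, c, d])
    (v := fun a b c d => ((k 0 / 2) • kn (frameT σ) (frameT σ)
      + kn (symT (-(σ * k 1)) 0 (σ * k 2)) frameS + (k 3 / 2) • kn frameS frameS) ![a, b, c, d])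
    (fun a b c d => ?_) (fun a b c d => ?_) (fun a b c d => ?_) (fun a b c d => ?_)
    (fun a b c d hab hcd => ?_) a b c d
  · simp only [frameCurv, Matrix.cons_val, planes_symm k b a, kr₂]; ring
  · simp only [frameCurv, Matrix.cons_val, kr₂]; ring
  · simp only [kn, Pi.add_apply, Pi.smul_apply, smul_eq_mul, Matrix.cons_val]; ring
  · simp only [kn, Pi.add_apply, Pi.smul_apply, smul_eq_mul, Matrix.cons_val]; ring
  · simp only [kn, Pi.add_apply, Pi.smul_apply, smul_eq_mul, Matrix.cons_val, frameCurv]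
    fin_cases a <;> fin_cases b <;> (try exact absurd hab (by decide)) <;>
      fin_cases c <;> fin_cases d <;> (try exact absurd hcd (by decide)) <;>
      simp [planes, kr₂, kr, frameT, frameS, symT, frameMetric] <;> ring

theorem IsCurvatureTensor.smul {R : Tensor 4} (hR : IsCurvatureTensor R) (s : ℝ) :
    IsCurvatureTensor (s • R) := by
  intro a b c d
  obtain ⟨h1, h2, h3, h4⟩ := hR a b c d
  simp only [Pi.smul_apply, smul_eq_mul]
  refine ⟨by rw [h1]; ring, by rw [h2]; ring, by rw [h3], by rw [← mul_add, ← mul_add, h4, mul_zero]⟩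

theorem symT_transpose (x y z : ℝ) : (symT x y z).transpose = symT x y z := by
  ext a b; fin_cases a <;> fin_cases b <;> rfl

theorem frameS_transpose : frameS.transpose = frameS := Matrix.diagonal_transpose _

theorem isCurvatureTensor_frameCurv (σ : ℝ) (k : Fin 4 → ℝ) :
    IsCurvatureTensor (frameCurv σ k) := by
  rw [frameCurv_eq_kn]
  have hT : (frameT σ).transpose = frameT σ := Matrix.diagonal_transpose _
  exact (((isCurvatureTensor_kn hT hT).smul _).add (isCurvatureTensor_kn (symT_transpose _ _ _)
    frameS_transpose)).add ((isCurvatureTensor_kn frameS_transpose frameS_transpose).smul _)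

section
attribute [local instance] Matrix.normedAddCommGroup Matrix.normedSpace

variable {L : Lagrangian} {σ : ℝ} {J : Mat} {v : (Fin 4 → ℝ) × ℝ}

/-- Metric, curvature `v.1` and field strength `v.2` (in the direction `J`) in the frame. -/
def frameConfig (σ : ℝ) (J : Mat) (v : (Fin 4 → ℝ) × ℝ) : Mat × Tensor 4 × Mat :=
  (Matrix.diagonal (frameMetric σ), frameCurv σ v.1, v.2 • J)

/-- The Lagrangian as a function of the frame components of curvature and field strength. -/
def frameLag (L : Lagrangian) (σ : ℝ) (J : Mat) (v : (Fin 4 → ℝ) × ℝ) : ℝ :=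
  L.toFun (Matrix.diagonal (frameMetric σ)) (frameCurv σ v.1) (v.2 • J)

def frameCurvₗ (σ : ℝ) : (Fin 4 → ℝ) →ₗ[ℝ] Tensor 4 where
  toFun := frameCurv σ
  map_add' k k' := by
    funext i
    have : ∀ a b, planes (k + k') a b = planes k a b + planes k' a b := fun a b => by
      fin_cases a <;> fin_cases b <;> simp [planes]
    simp only [frameCurv, Pi.add_apply, this]
    ring
  map_smul' c k := by
    funext i
    have : ∀ a b, planes (c • k) a b = c * planes k a b := fun a b => by
      fin_cases a <;> fin_cases b <;> simp [planes]
    simp only [frameCurv, Pi.smul_apply, this, smul_eq_mul, RingHom.id_apply]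
    ring

theorem contDiff_frameConfig (σ : ℝ) (J : Mat) : ContDiff ℝ ∞ (frameConfig σ J) :=
  contDiff_const.prodMk (((LinearMap.toContinuousLinearMap (frameCurvₗ σ)).contDiff.comp
    contDiff_fst).prodMk (contDiff_snd.smul contDiff_const))

theorem frameConfig_mem (hσ : σ * σ = 1) (hJ : J.transpose = -J) (v : (Fin 4 → ℝ) × ℝ) :
    frameConfig σ J v ∈ pointValues :=
  ⟨isLorentzian_frameMetric hσ, isCurvatureTensor_frameCurv σ v.1, by
    simp [frameConfig, Matrix.transpose_smul, hJ]⟩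

theorem isOpen_frameDom (L : Lagrangian) (hσ : σ * σ = 1) (hJ : J.transpose = -J) :
    IsOpen (frameConfig σ J ⁻¹' L.dom) :=
  L.isOpen_preimage_dom (contDiff_frameConfig σ J) (frameConfig_mem hσ hJ)

theorem contDiffOn_frameLag (L : Lagrangian) (σ : ℝ) (J : Mat) :
    ContDiffOn ℝ ∞ (frameLag L σ J) (frameConfig σ J ⁻¹' L.dom) :=
  L.contDiffOn_comp (contDiff_frameConfig σ J)

theorem hasFDerivAt_frameLag (hσ : σ * σ = 1) (hJ : J.transpose = -J)
    (hv : frameConfig σ J v ∈ L.dom) :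
    HasFDerivAt (frameLag L σ J) (fderiv ℝ (frameLag L σ J) v) v :=
  (((contDiffOn_frameLag L σ J).contDiffAt
    ((isOpen_frameDom L hσ hJ).mem_nhds hv)).differentiableAt (by simp)).hasFDerivAt

theorem fderiv_frameLag (hσ : σ * σ = 1) (hJ : J.transpose = -J)
    (hv : frameConfig σ J v ∈ L.dom) (w : (Fin 4 → ℝ) × ℝ) :
    fderiv ℝ (frameLag L σ J) v w = firstVar L (Matrix.diagonal (frameMetric σ))
      (frameCurv σ v.1) (v.2 • J) (frameCurv σ w.1, w.2 • J) := by
  have h1 := hasDerivAt_variation_smul hv (frameCurv σ w.1, w.2 • J)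
  have hc : HasDerivAt (fun s : ℝ => v + s • w) w 0 := by
    have := ((hasDerivAt_id' (0 : ℝ)).smul_const w).const_add v
    rw [one_smul] at this
    exact this
  have h2 : HasFDerivAt (frameLag L σ J) (fderiv ℝ (frameLag L σ J) v) (v + (0 : ℝ) • w) := by
    rw [zero_smul, add_zero]; exact hasFDerivAt_frameLag hσ hJ hv
  refine (h2.comp_hasDerivAt 0 hc).unique (h1.congr_of_eventuallyEq (.of_forall fun s => ?_))
  have e1 : frameCurv σ (v.1 + s • w.1) = frameCurv σ v.1 + s • frameCurv σ w.1 := by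
    have := (frameCurvₗ σ).map_add v.1 (s • w.1)
    rw [(frameCurvₗ σ).map_smul] at this
    exact this
  have e2 : (1 / 2 : ℝ) • (s • w.2 • J - (s • w.2 • J).transpose) = s • w.2 • J := by
    rw [Matrix.transpose_smul, Matrix.transpose_smul, hJ]
    module
  simp only [Function.comp, frameLag, variation, Prod.fst_add, Prod.snd_add, Prod.smul_fst,
    Prod.smul_snd, e1, e2, curvProj_smul,
    curvProj_of_isCurvatureTensor (isCurvatureTensor_frameCurv _ _), add_smul, smul_assoc]

/-! ### Residual symmetries of the frame data. -/

/-- A monomial change of frame that preserves metric, curvature and field strength. -/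
structure FrameSymm (J : Mat) (π : Equiv.Perm (Fin 4)) (ε : Fin 4 → ℝ) : Prop where
  sq : ∀ a, ε a * ε a = 1
  metric : ∀ σ a, frameMetric σ (π a) = frameMetric σ a
  planes_perm : ∀ k a b, planes k (π a) (π b) = planes k a b
  field : ∀ a b, ε a * ε b * J (π a) (π b) = J a b

theorem kr_perm (π : Equiv.Perm (Fin 4)) (a b : Fin 4) : kr (π a) (π b) = kr a b := by
  simp [kr]

theorem FrameSymm.ne_zero {π : Equiv.Perm (Fin 4)} {ε : Fin 4 → ℝ} (h : FrameSymm J π ε)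
    (a : Fin 4) : ε a ≠ 0 := fun h0 => by simpa [h0] using h.sq a

theorem FrameSymm.metric_eq {π : Equiv.Perm (Fin 4)} {ε : Fin 4 → ℝ} (h : FrameSymm J π ε)
    (σ : ℝ) : (monomialMat π ε).transpose * Matrix.diagonal (frameMetric σ) * monomialMat π ε
      = Matrix.diagonal (frameMetric σ) := by
  ext a b
  rw [monomialMat_congr]
  simp only [Matrix.diagonal_apply, EmbeddingLike.apply_eq_iff_eq, h.metric]
  split_ifs with hab
  · rw [hab, h.sq, one_mul]
  · simp

theorem FrameSymm.curv_eq {π : Equiv.Perm (Fin 4)} {ε : Fin 4 → ℝ} (h : FrameSymm J π ε)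
    (σ : ℝ) (k : Fin 4 → ℝ) : pullback (monomialMat π ε) (frameCurv σ k) = frameCurv σ k := by
  have hk : ∀ a c, ε a * ε c * kr a c = kr a c := fun a c => by
    unfold kr
    split_ifs with hac
    · rw [hac, h.sq, one_mul]
    · simp
  refine tensor_ext fun a b c d => ?_
  rw [pullback_monomialMat]
  simp only [frameCurv, Function.comp_apply, Fin.prod_univ_four, Matrix.cons_val, h.metric,
    h.planes_perm, kr₂, kr_perm]
  linear_combination planes k a b * frameMetric σ a * frameMetric σ b
    * (ε b * ε d * kr b d * hk a c + kr a c * hk b d - ε b * ε c * kr b c * hk a d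
      - kr a d * hk b c)

theorem FrameSymm.field_eq {π : Equiv.Perm (Fin 4)} {ε : Fin 4 → ℝ} (h : FrameSymm J π ε)
    (e : ℝ) : (monomialMat π ε).transpose * (e • J) * monomialMat π ε = e • J := by
  ext a b
  rw [monomialMat_congr, Matrix.smul_apply, Matrix.smul_apply, smul_eq_mul, smul_eq_mul,
    ← h.field a b]
  ring

/-- Equivariance at a fixed point: the stabiliser of metric, curvature and field strength also fixes
∂ℒ/∂R. -/
theorem FrameSymm.dRiem_eq {π : Equiv.Perm (Fin 4)} {ε : Fin 4 → ℝ} (h : FrameSymm J π ε)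
    (hv : frameConfig σ J v ∈ L.dom) (a b c d : Fin 4) :
    dRiem L (Matrix.diagonal (frameMetric σ)) (frameCurv σ v.1) (v.2 • J) ![π a, π b, π c, π d]
      = ε a * ε b * ε c * ε d * dRiem L (Matrix.diagonal (frameMetric σ)) (frameCurv σ v.1)
        (v.2 • J) ![a, b, c, d] := by
  have key := dRiem_monomialMat hv π h.ne_zero ![a, b, c, d]
  rw [h.metric_eq, h.curv_eq, h.field_eq] at key
  have e : π ∘ ![a, b, c, d] = ![π a, π b, π c, π d] := by ext j; fin_cases j <;> rfl
  rw [← e, key]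
  simp [Fin.prod_univ_four]

theorem FrameSymm.dField_eq {π : Equiv.Perm (Fin 4)} {ε : Fin 4 → ℝ} (h : FrameSymm J π ε)
    (hv : frameConfig σ J v ∈ L.dom) (a b : Fin 4) :
    dField L (Matrix.diagonal (frameMetric σ)) (frameCurv σ v.1) (v.2 • J) (π a) (π b)
      = ε a * ε b * dField L (Matrix.diagonal (frameMetric σ)) (frameCurv σ v.1) (v.2 • J) a b := by
  have key := dField_monomialMat hv π h.ne_zero a b
  rwa [h.metric_eq, h.curv_eq, h.field_eq] at key

/-- The electric field direction. -/
def electricJ : Mat := plane₂ (-1) 0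

/-- The magnetic field direction. -/
def magneticJ : Mat := plane₂ 0 1

theorem electricJ_transpose : electricJ.transpose = -electricJ := by
  ext a b; fin_cases a <;> fin_cases b <;> simp [electricJ, plane₂]

theorem magneticJ_transpose : magneticJ.transpose = -magneticJ := by
  ext a b; fin_cases a <;> fin_cases b <;> simp [magneticJ, plane₂]

theorem frameSymm_reflection {ε : Fin 4 → ℝ} (hε : ∀ a, ε a * ε a = 1)
    (hJ : ∀ a b, ε a * ε b * J a b = J a b) : FrameSymm J 1 ε :=
  ⟨hε, fun _ _ => rfl, fun _ _ _ => rfl, hJ⟩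

/-- A quarter turn of the sphere. Without the minus sign the exchange of θ and φ would reverse the
magnetic field. -/
theorem frameSymm_rotation (hJ : J = electricJ ∨ J = magneticJ) :
    FrameSymm J (Equiv.swap 2 3) ![1, 1, 1, -1] := by
  have s0 : (Equiv.swap 2 3 : Equiv.Perm (Fin 4)) 0 = 0 := rfl
  have s1 : (Equiv.swap 2 3 : Equiv.Perm (Fin 4)) 1 = 1 := rfl
  refine ⟨fun a => ?_, fun σ a => ?_, fun k a b => ?_, fun a b => ?_⟩
  · fin_cases a <;> simp
  · fin_cases a <;> simp [frameMetric, s0, s1]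
  · fin_cases a <;> fin_cases b <;> simp [planes, s0, s1]
  · rcases hJ with rfl | rfl <;> fin_cases a <;> fin_cases b <;>
      simp [electricJ, magneticJ, plane₂, s0, s1]

end

section
attribute [local instance] Matrix.normedAddCommGroup Matrix.normedSpace

variable {L : Lagrangian} {σ : ℝ} {J : Mat} {v : (Fin 4 → ℝ) × ℝ}

/-- `∂ℒ/∂R` in the frame. -/
def frameRiem (L : Lagrangian) (σ : ℝ) (J : Mat) (v : (Fin 4 → ℝ) × ℝ) (a b c d : Fin 4) : ℝ :=
  dRiem L (Matrix.diagonal (frameMetric σ)) (frameCurv σ v.1) (v.2 • J) ![a, b, c, d]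

/-- `∂ℒ/∂F` in the frame. -/
def frameField (L : Lagrangian) (σ : ℝ) (J : Mat) (v : (Fin 4 → ℝ) × ℝ) : Mat :=
  dField L (Matrix.diagonal (frameMetric σ)) (frameCurv σ v.1) (v.2 • J)

/-- The four terms of the product contribute equally to a contraction with an array antisymmetric in
both pairs. -/
theorem sum_kn_mul {d : Fin 4 → Fin 4 → Fin 4 → Fin 4 → ℝ} (h1 : ∀ a b c e, d a b c e = -d b a c e)
    (h2 : ∀ a b c e, d a b c e = -d a b e c) (h k : Mat) :
    ∑ a, ∑ b, ∑ c, ∑ e, kn h k ![a, b, c, e] * d a b c e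
      = 4 * ∑ a, ∑ b, ∑ c, ∑ e, h a c * k b e * d a b c e := by
  have s1 : ∑ a, ∑ b, ∑ c, ∑ e, h b e * k a c * d a b c e
      = ∑ a, ∑ b, ∑ c, ∑ e, h a c * k b e * d a b c e := by
    rw [Finset.sum_comm]
    refine Finset.sum_congr rfl fun b _ => Finset.sum_congr rfl fun a _ => ?_
    rw [Finset.sum_comm]
    refine Finset.sum_congr rfl fun c _ => Finset.sum_congr rfl fun e _ => ?_
    rw [h1 b a c e, h2 a b c e]; ring
  have s2 : ∑ a, ∑ b, ∑ c, ∑ e, h a e * k b c * d a b c e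
      = -∑ a, ∑ b, ∑ c, ∑ e, h a c * k b e * d a b c e := by
    simp only [← Finset.sum_neg_distrib]
    refine Finset.sum_congr rfl fun a _ => Finset.sum_congr rfl fun b _ => ?_
    rw [Finset.sum_comm]
    refine Finset.sum_congr rfl fun c _ => Finset.sum_congr rfl fun e _ => ?_
    rw [h2 a b c e]; ring
  have s3 : ∑ a, ∑ b, ∑ c, ∑ e, h b c * k a e * d a b c e
      = -∑ a, ∑ b, ∑ c, ∑ e, h a c * k b e * d a b c e := by
    simp only [← Finset.sum_neg_distrib]
    rw [Finset.sum_comm]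
    refine Finset.sum_congr rfl fun b _ => Finset.sum_congr rfl fun a _ => ?_
    refine Finset.sum_congr rfl fun c _ => Finset.sum_congr rfl fun e _ => ?_
    rw [h1 a b c e]; ring
  simp only [kn, Matrix.cons_val, sub_mul, add_mul, Finset.sum_sub_distrib,
    Finset.sum_add_distrib, s1, s2, s3]
  ring

theorem frameRiem_symm (hv : frameConfig σ J v ∈ L.dom) (a b c d : Fin 4) :
    frameRiem L σ J v a b c d = -frameRiem L σ J v b a c d ∧
    frameRiem L σ J v a b c d = -frameRiem L σ J v a b d c ∧
    frameRiem L σ J v a b c d = frameRiem L σ J v c d a b :=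
  dRiem_symm hv a b c d

theorem FrameSymm.frameRiem_eq_zero {ε : Fin 4 → ℝ} (h : FrameSymm J 1 ε)
    (hv : frameConfig σ J v ∈ L.dom) {a b c d : Fin 4} (hε : ε a * ε b * ε c * ε d = -1) :
    frameRiem L σ J v a b c d = 0 := by
  have := h.dRiem_eq hv a b c d
  rw [hε] at this
  simp only [Equiv.Perm.one_apply] at this
  have h2 : frameRiem L σ J v a b c d = -1 * frameRiem L σ J v a b c d := this
  linarith

/-- The quarter turn identifies components with θ and φ exchanged. It takes P^{tθtφ} to its negative
up to the exchange of index pairs, under which P is symmetric; hence this component vanishes, and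
likewise for r. -/
theorem frameRiem_rotate (hJ : J = electricJ ∨ J = magneticJ) (hv : frameConfig σ J v ∈ L.dom) :
    frameRiem L σ J v 0 3 0 3 = frameRiem L σ J v 0 2 0 2 ∧
    frameRiem L σ J v 1 3 1 3 = frameRiem L σ J v 1 2 1 2 ∧
    frameRiem L σ J v 0 3 1 3 = frameRiem L σ J v 0 2 1 2 ∧
    frameRiem L σ J v 0 2 0 3 = 0 ∧ frameRiem L σ J v 1 2 1 3 = 0 := by
  have h := (frameSymm_rotation hJ).dRiem_eq hv
  have s0 : (Equiv.swap 2 3 : Equiv.Perm (Fin 4)) 0 = 0 := rfl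
  have s1 : (Equiv.swap 2 3 : Equiv.Perm (Fin 4)) 1 = 1 := rfl
  have h1 := h 0 2 0 2
  have h2 := h 1 2 1 2
  have h3 := h 0 2 1 2
  have h4 := h 0 2 0 3
  have h5 := h 1 2 1 3
  simp [s0, s1] at h1 h2 h3 h4 h5
  have h6 := (dRiem_symm hv 0 3 0 2).2.2
  have h7 := (dRiem_symm hv 1 3 1 2).2.2
  exact ⟨h1, h2, h3, by unfold frameRiem; linarith, by unfold frameRiem; linarith⟩

/-- A boost in the `tr` plane. -/
def boost (c s : ℝ) : Mat :=
  Matrix.of ![![c, s, 0, 0], ![s, c, 0, 0], ![0, 0, 1, 0], ![0, 0, 0, 1]]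

theorem boost_congr_symT (c s x y z : ℝ) :
    (boost c s).transpose * symT x y z * boost c s
      = symT (c ^ 2 * x + 2 * c * s * y + s ^ 2 * z) (c * s * (x + z) + (c ^ 2 + s ^ 2) * y)
        (s ^ 2 * x + 2 * c * s * y + c ^ 2 * z) := by
  ext a b
  simp only [Matrix.mul_apply, Matrix.transpose_apply, Fin.sum_univ_four]
  fin_cases a <;> fin_cases b <;> simp [boost, symT] <;> ring

theorem boost_congr_frameS (c s : ℝ) : (boost c s).transpose * frameS * boost c s = frameS := by
  ext a b
  simp only [Matrix.mul_apply, Matrix.transpose_apply, Fin.sum_univ_four]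
  fin_cases a <;> fin_cases b <;> simp [boost, frameS]

theorem frameT_eq_symT (σ : ℝ) : frameT σ = symT (-σ) 0 σ := by
  ext a b
  fin_cases a <;> fin_cases b <;> simp [frameT, symT]

theorem boost_congr_frameT {c s : ℝ} (h : c ^ 2 - s ^ 2 = 1) (σ : ℝ) :
    (boost c s).transpose * frameT σ * boost c s = frameT σ := by
  rw [frameT_eq_symT, boost_congr_symT]
  congr 1
  · linear_combination -σ * h
  · ring
  · linear_combination σ * h

theorem boost_congr_frameMetric {c s : ℝ} (h : c ^ 2 - s ^ 2 = 1) (σ : ℝ) :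
    (boost c s).transpose * Matrix.diagonal (frameMetric σ) * boost c s
      = Matrix.diagonal (frameMetric σ) := by
  have e : Matrix.diagonal (frameMetric σ) = frameT σ + frameS := by
    rw [frameT, frameS, Matrix.diagonal_add]
    congr 1
    ext a; fin_cases a <;> simp [frameMetric]
  rw [e, Matrix.mul_add, Matrix.add_mul, boost_congr_frameT h, boost_congr_frameS]

theorem boost_congr_electricJ {c s : ℝ} (h : c ^ 2 - s ^ 2 = 1) :
    (boost c s).transpose * electricJ * boost c s = electricJ := by
  ext a b
  simp only [Matrix.mul_apply, Matrix.transpose_apply, Fin.sum_univ_four]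
  fin_cases a <;> fin_cases b <;> simp [boost, electricJ, plane₂] <;> linarith

theorem isUnit_det_boost {c s : ℝ} (h : c ^ 2 - s ^ 2 = 1) : IsUnit (boost c s).det := by
  have h1 : (boost c s).det * (boost c (-s)).det = 1 := by
    rw [← Matrix.det_mul]
    have : boost c s * boost c (-s) = 1 := by
      ext a b
      simp only [Matrix.mul_apply, Fin.sum_univ_four]
      fin_cases a <;> fin_cases b <;> simp [boost] <;> linarith
    rw [this, Matrix.det_one]
  exact IsUnit.of_mul_eq_one _ h1

/-- The factor 8 is 4 from `sum_kn_mul` times the two angular directions; the off-diagonal entry y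
occurs twice in the symmetric matrix, hence 16. The derivative along y thus isolates the component
that reflections do not remove. -/
theorem firstVar_kn_symT (hJ : J = electricJ ∨ J = magneticJ) (hv : frameConfig σ J v ∈ L.dom)
    (x y z : ℝ) :
    firstVar L (Matrix.diagonal (frameMetric σ)) (frameCurv σ v.1) (v.2 • J)
      (kn (symT x y z) frameS, 0) = 8 * x * frameRiem L σ J v 0 2 0 2
        + 16 * y * frameRiem L σ J v 0 2 1 2 + 8 * z * frameRiem L σ J v 1 2 1 2 := by
  rw [firstVar_eq_sum hv]
  have h := sum_kn_mul (fun a b c d => (frameRiem_symm hv a b c d).1)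
    (fun a b c d => (frameRiem_symm hv a b c d).2.1) (symT x y z) frameS
  obtain ⟨r1, r2, r3, -, -⟩ := frameRiem_rotate hJ hv
  have p1 := (frameRiem_symm hv 0 2 1 2).2.2
  have p2 := (frameRiem_symm hv 0 3 1 3).2.2
  have e : ∑ a, ∑ b, ∑ c, ∑ d, kn (symT x y z) frameS ![a, b, c, d]
      * dRiem L (Matrix.diagonal (frameMetric σ)) (frameCurv σ v.1) (v.2 • J) ![a, b, c, d]
      = ∑ a, ∑ b, ∑ c, ∑ d, kn (symT x y z) frameS ![a, b, c, d]
        * frameRiem L σ J v a b c d := rfl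
  rw [e, h]
  simp only [Fin.sum_univ_four, symT, frameS, Matrix.diagonal_apply, Matrix.of_apply,
    Matrix.cons_val]
  simp
  rw [r1, r2, r3, ← p1, ← p2, r3]
  ring

/-- Boost invariance forbids the mixed component of `∂ℒ/∂R` in the electric case. -/
theorem frameRiem_boost (hσ : σ * σ = 1) (hv : frameConfig σ electricJ v ∈ L.dom) :
    frameRiem L σ electricJ v 0 2 1 2 = 0 := by
  obtain ⟨k, e⟩ := v
  have hcurv : ∀ c s, c ^ 2 - s ^ 2 = 1 → pullback (boost c s) (frameCurv σ k)
      = frameCurv σ k + kn (symT (s ^ 2 * (σ * (k 2 - k 1))) (c * s * (σ * (k 2 - k 1)))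
        (s ^ 2 * (σ * (k 2 - k 1)))) frameS := by
    intro c s h
    simp only [frameCurv_eq_kn, pullback_add, pullback_smul, pullback_kn, boost_congr_frameT h,
      boost_congr_frameS, boost_congr_symT]
    have hadd : ∀ x y z x' y' z', kn (symT (x + x') (y + y') (z + z')) frameS
        = kn (symT x y z) frameS + kn (symT x' y' z') frameS := by
      intro x y z x' y' z'
      have : symT (x + x') (y + y') (z + z') = symT x y z + symT x' y' z' := by
        ext a b; fin_cases a <;> fin_cases b <;> simp [symT]
      rw [this]
      funext i
      simp only [kn, Pi.add_apply, Matrix.add_apply]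
      ring
    have e1 : c ^ 2 * -(σ * k 1) + 2 * c * s * 0 + s ^ 2 * (σ * k 2)
        = -(σ * k 1) + s ^ 2 * (σ * (k 2 - k 1)) := by linear_combination -(σ * k 1) * h
    have e2 : c * s * (-(σ * k 1) + σ * k 2) + (c ^ 2 + s ^ 2) * 0
        = 0 + c * s * (σ * (k 2 - k 1)) := by ring
    have e3 : s ^ 2 * -(σ * k 1) + 2 * c * s * 0 + c ^ 2 * (σ * k 2)
        = σ * k 2 + s ^ 2 * (σ * (k 2 - k 1)) := by linear_combination (σ * k 2) * h
    rw [e1, e2, e3, hadd]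
    abel
  have hfield : ∀ c s, c ^ 2 - s ^ 2 = 1 →
      (boost c s).transpose * (e • electricJ) * boost c s = e • electricJ := by
    intro c s h
    rw [Matrix.mul_smul, Matrix.smul_mul, boost_congr_electricJ h]
  have hkn : ∀ x y z, curvProj (kn (symT x y z) frameS) = kn (symT x y z) frameS := fun x y z =>
    curvProj_of_isCurvatureTensor (isCurvatureTensor_kn (symT_transpose _ _ _) frameS_transpose)
  -- If the two mixed curvatures agree, the curvature is boost invariant and so is ∂ℒ/∂R. Otherwise
  -- boosts move the curvature, and invariance of ℒ along the orbit gives a vanishing derivative in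
  -- precisely the direction needed.
  by_cases hS : k 2 = k 1
  · have key : ∀ c s, c ^ 2 - s ^ 2 = 1 →
        firstVar L (Matrix.diagonal (frameMetric σ)) (frameCurv σ k) (e • electricJ)
          (kn (symT 1 0 0) frameS, 0)
        = firstVar L (Matrix.diagonal (frameMetric σ)) (frameCurv σ k) (e • electricJ)
          (kn (symT (c ^ 2) (c * s) (s ^ 2)) frameS, 0) := by
      intro c s h
      have h1 := firstVar_congr hv (isUnit_det_boost h) (T := kn (symT 1 0 0) frameS)
        (T' := kn (symT (c ^ 2) (c * s) (s ^ 2)) frameS) (G := 0) (G' := 0) ?_ (by simp)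
      · have hz : kn (symT 0 0 0) frameS = 0 := by
          have : symT 0 0 0 = 0 := by ext a b; fin_cases a <;> fin_cases b <;> simp [symT]
          funext i; simp [kn, this]
        rw [boost_congr_frameMetric h, hcurv c s h, hfield c s h, hS] at h1
        simpa [hz] using h1
      · rw [hkn, hkn, pullback_kn, boost_congr_symT, boost_congr_frameS]
        congr 2 <;> ring
    -- A rational point of c² - s² = 1. Opposite values of s give equations that differ only in the
    -- sign of the mixed term, so their difference forces it to vanish.
    have k1 := key (5 / 4) (3 / 4) (by norm_num)
    have k2 := key (5 / 4) (-(3 / 4)) (by norm_num)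
    rw [firstVar_kn_symT (.inl rfl) hv, firstVar_kn_symT (.inl rfl) hv] at k1 k2
    linarith
  · have hS' : σ * (k 2 - k 1) ≠ 0 :=
      mul_ne_zero (fun h => by simp [h] at hσ) (sub_ne_zero.2 hS)
    set S := σ * (k 2 - k 1) with hSdef
    -- The displacement of the curvature along the orbit of boosts of rapidity t. Its sinh² part is
    -- of second order, so the velocity at t = 0 is S times the mixed direction alone.
    let c : ℝ → Tensor 4 × Mat := fun t =>
      (Real.sinh t ^ 2 * S) • (kn (symT 1 0 1) frameS, (0 : Mat))
        + (Real.cosh t * Real.sinh t * S) • (kn (symT 0 1 0) frameS, (0 : Mat))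
    have hc : HasDerivAt c (S • (kn (symT 0 1 0) frameS, (0 : Mat))) 0 := by
      have d1 := ((((Real.hasDerivAt_sinh 0).pow 2).mul_const S).smul_const
        (kn (symT 1 0 1) frameS, (0 : Mat)))
      have d2 := ((((Real.hasDerivAt_cosh 0).fun_mul (Real.hasDerivAt_sinh 0)).mul_const S).smul_const
        (kn (symT 0 1 0) frameS, (0 : Mat)))
      refine (d1.fun_add d2).congr_deriv ?_
      simp
    have h1 := hasDerivAt_variation hv hc (by simp [c])
    have h2 : (fun t => variation L (Matrix.diagonal (frameMetric σ)) (frameCurv σ k)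
        (e • electricJ) (c t)) = fun _ => L.toFun (Matrix.diagonal (frameMetric σ)) (frameCurv σ k)
        (e • electricJ) := by
      funext t
      have ht : Real.cosh t ^ 2 - Real.sinh t ^ 2 = 1 := Real.cosh_sq_sub_sinh_sq t
      have h3 := L.invariant _ (isUnit_det_boost ht) _ _ _ hv
      rw [boost_congr_frameMetric ht, hcurv _ _ ht, hfield _ _ ht] at h3
      have h4 : curvProj (c t).1 = kn (symT (Real.sinh t ^ 2 * S)
          (Real.cosh t * Real.sinh t * S) (Real.sinh t ^ 2 * S)) frameS := by
        rw [← hkn]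
        congr 1
        funext i
        have : ∀ a b, symT (Real.sinh t ^ 2 * S)
          (Real.cosh t * Real.sinh t * S) (Real.sinh t ^ 2 * S) a b
          = (Real.sinh t ^ 2 * S) * symT 1 0 1 a b
            + (Real.cosh t * Real.sinh t * S) * symT 0 1 0 a b := by
          intro a b; fin_cases a <;> fin_cases b <;> simp [symT]
        simp only [c, kn, this, Prod.smul_mk, Prod.mk_add_mk, Pi.add_apply, Pi.smul_apply,
          smul_eq_mul]
        ring
      have h5 : (c t).2 = 0 := by simp [c]
      rw [variation, h4, h5, ← h3]
      simp
    rw [h2] at h1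
    have h3 := h1.unique (hasDerivAt_const _ _)
    rw [map_smul, firstVar_kn_symT (.inl rfl) hv, smul_eq_mul] at h3
    have := (mul_eq_zero.1 h3).resolve_left hS'
    linarith

end

/-! ### The derivatives of the Lagrangian in the frame. -/

section
attribute [local instance] Matrix.normedAddCommGroup Matrix.normedSpace

variable {L : Lagrangian} {σ : ℝ} {J : Mat} {v : (Fin 4 → ℝ) × ℝ}

-- In the electric case reflections of θ and of φ preserve F, so an index θ or φ must occur an even
-- number of times; what is left is P^{tθrθ} and P^{tφrφ}, treated by the boost and the quarter
-- turn. In the magnetic case reflections of t and of r are available instead, and the remaining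
-- P^{tθtφ} and P^{rθrφ} vanish by the quarter turn.
set_option maxHeartbeats 1000000 in
theorem frameRiem_offDiagonal (hσ : σ * σ = 1) (hJ : J = electricJ ∨ J = magneticJ)
    (hv : frameConfig σ J v ∈ L.dom) {a b c d : Fin 4} (hab : a < b) (hcd : c < d)
    (h : a ≠ c ∨ b ≠ d) : frameRiem L σ J v a b c d = 0 := by
  obtain ⟨r1, r2, r3, r4, r5⟩ := frameRiem_rotate hJ hv
  have sy := fun a b c d => (frameRiem_symm hv a b c d).2.2
  rcases hJ with rfl | rfl
  · have hb := frameRiem_boost hσ hv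
    rw [hb] at r3
    have hb' := (sy 1 2 0 2).trans hb
    have r3' := (sy 1 3 0 3).trans r3
    have f1 : FrameSymm electricJ 1 ![1, 1, -1, 1] := frameSymm_reflection
      (fun a => by fin_cases a <;> simp)
      (fun a b => by fin_cases a <;> fin_cases b <;> simp [electricJ, plane₂])
    have f2 : FrameSymm electricJ 1 ![1, 1, 1, -1] := frameSymm_reflection
      (fun a => by fin_cases a <;> simp)
      (fun a b => by fin_cases a <;> fin_cases b <;> simp [electricJ, plane₂])
    fin_cases a <;> fin_cases b <;> (try exact absurd hab (by decide)) <;>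
      fin_cases c <;> fin_cases d <;> (try exact absurd hcd (by decide)) <;>
      first
      | exact absurd h (by decide)
      | (refine f1.frameRiem_eq_zero hv ?_; simp; done)
      | (refine f2.frameRiem_eq_zero hv ?_; simp; done)
      | assumption
  · have r4' := (sy 0 3 0 2).trans r4
    have r5' := (sy 1 3 1 2).trans r5
    have f1 : FrameSymm magneticJ 1 ![-1, 1, 1, 1] := frameSymm_reflection
      (fun a => by fin_cases a <;> simp)
      (fun a b => by fin_cases a <;> fin_cases b <;> simp [magneticJ, plane₂])
    have f2 : FrameSymm magneticJ 1 ![1, -1, 1, 1] := frameSymm_reflection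
      (fun a => by fin_cases a <;> simp)
      (fun a b => by fin_cases a <;> fin_cases b <;> simp [magneticJ, plane₂])
    fin_cases a <;> fin_cases b <;> (try exact absurd hab (by decide)) <;>
      fin_cases c <;> fin_cases d <;> (try exact absurd hcd (by decide)) <;>
      first
      | exact absurd h (by decide)
      | (refine f1.frameRiem_eq_zero hv ?_; simp; done)
      | (refine f2.frameRiem_eq_zero hv ?_; simp; done)
      | assumption

/-- The signs in the vector are the products of frame metric entries in the planes tr, tθ, rθ and
θφ, namely -σ² = -1, -σ, σ and 1. -/
theorem frameRiem_eq_planes (hσ : σ * σ = 1) (hJ : J = electricJ ∨ J = magneticJ)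
    (hv : frameConfig σ J v ∈ L.dom) (a b c d : Fin 4) : frameRiem L σ J v a b c d
      = planes ![-frameRiem L σ J v 0 1 0 1, -(σ * frameRiem L σ J v 0 2 0 2),
          σ * frameRiem L σ J v 1 2 1 2, frameRiem L σ J v 2 3 2 3] a b
        * frameMetric σ a * frameMetric σ b * kr₂ a b c d := by
  obtain ⟨r1, r2, -, -, -⟩ := frameRiem_rotate hJ hv
  generalize hq : (![-frameRiem L σ J v 0 1 0 1, -(σ * frameRiem L σ J v 0 2 0 2),
          σ * frameRiem L σ J v 1 2 1 2, frameRiem L σ J v 2 3 2 3] : Fin 4 → ℝ) = q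
  refine eq_of_antisymm₂ (v := fun a b c d => planes q a b
        * frameMetric σ a * frameMetric σ b * kr₂ a b c d)
    (fun a b c d => (frameRiem_symm hv a b c d).1) (fun a b c d => (frameRiem_symm hv a b c d).2.1)
    (fun a b c d => ?_) (fun a b c d => ?_) (fun a b c d hab hcd => ?_) a b c d
  · simp only [planes_symm q b a, kr₂]; ring
  · simp only [kr₂]; ring
  · by_cases h : a = c ∧ b = d
    · obtain ⟨rfl, rfl⟩ := h
      subst hq
      fin_cases a <;> fin_cases b <;> (try exact absurd hab (by decide)) <;>
        simp [planes, frameMetric, kr₂, kr, r1, r2] <;>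
        first
        | linear_combination (-frameRiem L σ J v 0 1 0 1) * hσ
        | linear_combination (-frameRiem L σ J v 0 2 0 2) * hσ
        | linear_combination (-frameRiem L σ J v 1 2 1 2) * hσ
    · rw [frameRiem_offDiagonal hσ hJ hv hab hcd (not_and_or.1 h)]
      have : kr₂ a b c d = 0 := by
        have h2 : ¬(a = d ∧ b = c) := by
          rintro ⟨rfl, rfl⟩
          exact lt_asymm hab hcd
        simp only [kr₂, kr]
        split_ifs <;> simp_all
      rw [this, mul_zero]

theorem sum_kr₂_sq (a b : Fin 4) : ∑ c, ∑ d, kr₂ a b c d * kr₂ a b c d = 2 - 2 * kr a b := by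
  simp only [Fin.sum_univ_four]
  fin_cases a <;> fin_cases b <;> simp [kr₂, kr] <;> norm_num

/-- Each coordinate plane occurs with four index orderings, and the second and third curvatures
belong to two planes each. This explains the weights 4, 8, 8, 4 and the divisors in `planeDeriv`. -/
theorem fderiv_frameLag_curv (hσ : σ * σ = 1) (hJ : J = electricJ ∨ J = magneticJ)
    (hv : frameConfig σ J v ∈ L.dom) (k : Fin 4 → ℝ) : fderiv ℝ (frameLag L σ J) v (k, 0)
      = -4 * k 0 * frameRiem L σ J v 0 1 0 1 - 8 * k 1 * (σ * frameRiem L σ J v 0 2 0 2)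
        + 8 * k 2 * (σ * frameRiem L σ J v 1 2 1 2) + 4 * k 3 * frameRiem L σ J v 2 3 2 3 := by
  have hJt : J.transpose = -J := by
    rcases hJ with rfl | rfl
    exacts [electricJ_transpose, magneticJ_transpose]
  rw [fderiv_frameLag hσ hJt hv, firstVar_eq_sum hv]
  simp only [zero_smul, Matrix.zero_apply, zero_mul, Finset.sum_const_zero, add_zero]
  have key := frameRiem_eq_planes hσ hJ hv
  generalize hq : (![-frameRiem L σ J v 0 1 0 1, -(σ * frameRiem L σ J v 0 2 0 2),
          σ * frameRiem L σ J v 1 2 1 2, frameRiem L σ J v 2 3 2 3] : Fin 4 → ℝ) = q at key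
  have e : ∀ a b, ∑ c, ∑ d, frameCurv σ k ![a, b, c, d]
      * dRiem L (Matrix.diagonal (frameMetric σ)) (frameCurv σ v.1) (v.2 • J) ![a, b, c, d]
      = planes k a b * planes q a b * (2 - 2 * kr a b) := by
    intro a b
    rw [← sum_kr₂_sq, Finset.mul_sum]
    refine Finset.sum_congr rfl fun c _ => ?_
    rw [Finset.mul_sum]
    refine Finset.sum_congr rfl fun d _ => ?_
    have h := key a b c d
    simp only [frameRiem] at h
    rw [h]
    simp only [frameCurv, Matrix.cons_val]
    linear_combination planes k a b * planes q a b * kr₂ a b c d * kr₂ a b c d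
      * (frameMetric σ b * frameMetric σ b * frameMetric_mul_self hσ a
        + frameMetric_mul_self hσ b)
  simp only [e]
  subst hq
  simp [Fin.sum_univ_four, planes, kr]
  ring

/-- The planes of `∂ℒ/∂R` in terms of the derivatives of the Lagrangian. -/
def planeDeriv (L : Lagrangian) (σ : ℝ) (J : Mat) (v : (Fin 4 → ℝ) × ℝ) : Fin 4 → ℝ :=
  ![fderiv ℝ (frameLag L σ J) v (Pi.single 0 1, 0) / 4,
    fderiv ℝ (frameLag L σ J) v (Pi.single 1 1, 0) / 8,
    fderiv ℝ (frameLag L σ J) v (Pi.single 2 1, 0) / 8,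
    fderiv ℝ (frameLag L σ J) v (Pi.single 3 1, 0) / 4]

/-- The derivative of the Lagrangian with respect to the field strength. -/
def fieldDeriv (L : Lagrangian) (σ : ℝ) (J : Mat) (v : (Fin 4 → ℝ) × ℝ) : ℝ :=
  fderiv ℝ (frameLag L σ J) v (0, 1)

/-- Through this formula the smoothness of P in r becomes that of derivatives of `frameLag` composed
with smooth curvature and field strength functions. -/
theorem frameRiem_eq (hσ : σ * σ = 1) (hJ : J = electricJ ∨ J = magneticJ)
    (hv : frameConfig σ J v ∈ L.dom) (a b c d : Fin 4) : frameRiem L σ J v a b c d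
      = planes (planeDeriv L σ J v) a b * frameMetric σ a * frameMetric σ b * kr₂ a b c d := by
  rw [frameRiem_eq_planes hσ hJ hv]
  congr 4
  simp only [planeDeriv, fderiv_frameLag_curv hσ hJ hv]
  ext i
  fin_cases i <;> simp <;> ring

theorem fderiv_frameLag_eq (v w : (Fin 4 → ℝ) × ℝ) : fderiv ℝ (frameLag L σ J) v w
      = 4 * planeDeriv L σ J v 0 * w.1 0 + 8 * planeDeriv L σ J v 1 * w.1 1
        + 8 * planeDeriv L σ J v 2 * w.1 2 + 4 * planeDeriv L σ J v 3 * w.1 3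
        + fieldDeriv L σ J v * w.2 := by
  have : w = w.1 0 • (Pi.single 0 1, (0 : ℝ)) + w.1 1 • (Pi.single 1 1, (0 : ℝ))
      + w.1 2 • (Pi.single 2 1, (0 : ℝ)) + w.1 3 • (Pi.single 3 1, (0 : ℝ))
      + w.2 • ((0 : Fin 4 → ℝ), (1 : ℝ)) := by
    ext i
    · fin_cases i <;> simp
    · simp
  conv_lhs => rw [this]
  simp only [map_add, map_smul, smul_eq_mul, planeDeriv, fieldDeriv, Matrix.cons_val]
  ring

/-- The two angular reflections remove every component except tr. The direction J has tr-entry -1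
and antisymmetry doubles it, hence the factor -1/2. -/
theorem frameField_electric (hσ : σ * σ = 1) (hv : frameConfig σ electricJ v ∈ L.dom) :
    frameField L σ electricJ v = plane₂ (-(fieldDeriv L σ electricJ v / 2)) 0 := by
  have an := dField_antisymm hv
  have hp : fieldDeriv L σ electricJ v = -2 * frameField L σ electricJ v 0 1 := by
    rw [fieldDeriv, fderiv_frameLag hσ electricJ_transpose hv, firstVar_eq_sum hv]
    have h0 : frameCurv σ 0 = 0 := (frameCurvₗ σ).map_zero
    have h1 := an 1 0
    have hJ : ∀ a b, electricJ a b = plane₂ (-1) 0 a b := fun _ _ => rfl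
    simp only [one_smul, hJ]
    simp [h0, Fin.sum_univ_four, plane₂, h1, frameField]
    ring
  have f1 : FrameSymm electricJ 1 ![1, 1, -1, 1] := frameSymm_reflection
    (fun a => by fin_cases a <;> simp)
    (fun a b => by fin_cases a <;> fin_cases b <;> simp [electricJ, plane₂])
  have f2 : FrameSymm electricJ 1 ![1, 1, 1, -1] := frameSymm_reflection
    (fun a => by fin_cases a <;> simp)
    (fun a b => by fin_cases a <;> fin_cases b <;> simp [electricJ, plane₂])
  have g1 := f1.dField_eq hv
  have g2 := f2.dField_eq hv
  simp only [Equiv.Perm.one_apply] at g1 g2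
  rw [hp]
  refine Matrix.ext fun a b => eq_of_antisymm an (v := plane₂ _ _)
    (fun c d => by fin_cases c <;> fin_cases d <;> simp [plane₂]) ?_ ?_ ?_ ?_ ?_ ?_ a b
  · simp [plane₂, frameField]
    ring
  · have := g1 0 2; simp at this; simp [plane₂]; linarith
  · have := g2 0 3; simp at this; simp [plane₂]; linarith
  · have := g1 1 2; simp at this; simp [plane₂]; linarith
  · have := g2 1 3; simp at this; simp [plane₂]; linarith
  · have := g1 2 3; simp at this; simp [plane₂]; linarith

theorem frameField_magnetic (hσ : σ * σ = 1) (hv : frameConfig σ magneticJ v ∈ L.dom) :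
    frameField L σ magneticJ v = plane₂ 0 (fieldDeriv L σ magneticJ v / 2) := by
  have an := dField_antisymm hv
  have hp : fieldDeriv L σ magneticJ v = 2 * frameField L σ magneticJ v 2 3 := by
    rw [fieldDeriv, fderiv_frameLag hσ magneticJ_transpose hv, firstVar_eq_sum hv]
    have h0 : frameCurv σ 0 = 0 := (frameCurvₗ σ).map_zero
    have h1 := an 3 2
    have hJ : ∀ a b, magneticJ a b = plane₂ 0 1 a b := fun _ _ => rfl
    simp only [one_smul, hJ]
    simp [h0, Fin.sum_univ_four, plane₂, h1, frameField]
    ring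
  have f1 : FrameSymm magneticJ 1 ![-1, 1, 1, 1] := frameSymm_reflection
    (fun a => by fin_cases a <;> simp)
    (fun a b => by fin_cases a <;> fin_cases b <;> simp [magneticJ, plane₂])
  have f2 : FrameSymm magneticJ 1 ![1, -1, 1, 1] := frameSymm_reflection
    (fun a => by fin_cases a <;> simp)
    (fun a b => by fin_cases a <;> fin_cases b <;> simp [magneticJ, plane₂])
  have g1 := f1.dField_eq hv
  have g2 := f2.dField_eq hv
  simp only [Equiv.Perm.one_apply] at g1 g2
  rw [hp]
  refine Matrix.ext fun a b => eq_of_antisymm an (v := plane₂ _ _)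
    (fun c d => by fin_cases c <;> fin_cases d <;> simp [plane₂]) ?_ ?_ ?_ ?_ ?_ ?_ a b
  · have := g1 0 1; simp at this; simp [plane₂]; linarith
  · have := g1 0 2; simp at this; simp [plane₂]; linarith
  · have := g1 0 3; simp at this; simp [plane₂]; linarith
  · have := g2 1 2; simp at this; simp [plane₂]; linarith
  · have := g2 1 3; simp at this; simp [plane₂]; linarith
  · simp [plane₂, frameField]

theorem contDiffOn_planeDeriv (hσ : σ * σ = 1) (hJ : J.transpose = -J) (i : Fin 4) :
    ContDiffOn ℝ ∞ (fun v => planeDeriv L σ J v i) (frameConfig σ J ⁻¹' L.dom) := by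
  have h : ∀ w, ContDiffOn ℝ ∞ (fun v => fderiv ℝ (frameLag L σ J) v w)
      (frameConfig σ J ⁻¹' L.dom) := fun w =>
    ((contDiffOn_frameLag L σ J).fderiv_of_isOpen (isOpen_frameDom L hσ hJ) (by simp)).clm_apply
      contDiffOn_const
  fin_cases i
  exacts [(h _).div_const 4, (h _).div_const 8, (h _).div_const 8, (h _).div_const 4]

theorem contDiffOn_fieldDeriv (hσ : σ * σ = 1) (hJ : J.transpose = -J) :
    ContDiffOn ℝ ∞ (fieldDeriv L σ J) (frameConfig σ J ⁻¹' L.dom) :=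
  ((contDiffOn_frameLag L σ J).fderiv_of_isOpen (isOpen_frameDom L hσ hJ) (by simp)).clm_apply
    contDiffOn_const

end

/-! ### From the frame to coordinates -/

/-- The components of an orthonormal frame. -/
def frameScale (N f : ℝ → ℝ) (σ : ℝ) (x : Pt) : Fin 4 → ℝ :=
  ![1 / (N (x 1) * Real.sqrt (σ * f (x 1))), Real.sqrt (σ * f (x 1)), 1 / x 1,
    1 / (x 1 * Real.sin (x 2))]

section
variable {N f : ℝ → ℝ} {I : Set ℝ} {L : Lagrangian} {σ : ℝ} {J : Mat} {x : Pt} {F : Mat} {e : ℝ}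

theorem Background.frameScale_ne (H : Background N f I) (hx : x ∈ region I)
    (hf : 0 < σ * f (x 1)) (a : Fin 4) : frameScale N f σ x a ≠ 0 := by
  have h1 := H.radius_ne _ hx.1
  have h2 := H.N_ne _ hx.1
  have h4 := sin_ne_of_mem_region hx
  have h5 := (Real.sqrt_pos.2 hf).ne'
  fin_cases a <;> simp [frameScale, h1, h2, h4, h5]

theorem Background.frameScale_sq (H : Background N f I) (hσ : σ * σ = 1) (hx : x ∈ region I)
    (hf : 0 < σ * f (x 1)) (a : Fin 4) :
    frameScale N f σ x a * frameScale N f σ x a * metricD N f x a = frameMetric σ a := by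
  have h1 := H.radius_ne _ hx.1
  have h2 := H.N_ne _ hx.1
  have h3 := H.f_ne _ hx.1
  have h4 := sin_ne_of_mem_region hx
  have h5 := (Real.sqrt_pos.2 hf).ne'
  have h6 : Real.sqrt (σ * f (x 1)) ^ 2 = σ * f (x 1) := Real.sq_sqrt hf.le
  fin_cases a <;> simp [frameScale, metricD, metricR, metricT, frameMetric] <;> field_simp
  · rw [h6]; linear_combination (-f (x 1)) * hσ
  · rw [h6]

/-- The hypothesis `hF` is the only place where the ansatz for the potential enters: the rescaled
field strength must be a multiple of the fixed direction J. -/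
theorem Background.frame_config (H : Background N f I) (hσ : σ * σ = 1) (hx : x ∈ region I)
    (hf : 0 < σ * f (x 1))
    (hF : ∀ a b, frameScale N f σ x a * frameScale N f σ x b * F a b = e * J a b) :
    (monomialMat 1 (frameScale N f σ x)).transpose * sssMetric N f x
        * monomialMat 1 (frameScale N f σ x) = Matrix.diagonal (frameMetric σ) ∧
      pullback (monomialMat 1 (frameScale N f σ x)) (riemann (sssMetric N f) x)
        = frameCurv σ (curv N f (x 1)) ∧
      (monomialMat 1 (frameScale N f σ x)).transpose * F
        * monomialMat 1 (frameScale N f σ x) = e • J := by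
  have hs := H.frameScale_sq hσ hx hf
  refine ⟨?_, ?_, ?_⟩
  · ext a b
    rw [monomialMat_congr, Equiv.Perm.one_apply, Equiv.Perm.one_apply, sssMetric_apply,
      Matrix.diagonal_apply]
    split_ifs with h
    · rw [← h, hs]
    · simp
  · refine tensor_ext fun a b c d => ?_
    rw [pullback_monomialMat]
    have : ((1 : Equiv.Perm (Fin 4)) : Fin 4 → Fin 4) ∘ ![a, b, c, d] = ![a, b, c, d] := rfl
    simp only [this, H.riemann_eq hx, Fin.prod_univ_four, Matrix.cons_val, frameCurv, ← hs]
    by_cases hk : kr₂ a b c d = 0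
    · simp [hk]
    · have : frameScale N f σ x c * frameScale N f σ x d
          = frameScale N f σ x a * frameScale N f σ x b := by
        simp only [kr₂, kr] at hk
        split_ifs at hk <;> simp_all [mul_comm]
      linear_combination frameScale N f σ x a * frameScale N f σ x b
        * planes (curv N f (x 1)) a b * metricD N f x a * metricD N f x b * kr₂ a b c d * this
  · ext a b
    rw [monomialMat_congr]
    exact hF a b

theorem monomialMat_inv_congr {ε : Fin 4 → ℝ} (hε : ∀ a, ε a ≠ 0) (g : Mat) :
    (monomialMat 1 ε⁻¹).transpose * ((monomialMat 1 ε).transpose * g * monomialMat 1 ε)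
      * monomialMat 1 ε⁻¹ = g := by
  ext a b
  have ha := hε a
  have hb := hε b
  simp only [monomialMat_congr, Equiv.Perm.one_apply, Pi.inv_apply]
  field_simp

theorem pullback_inv_pullback {ε : Fin 4 → ℝ} (hε : ∀ a, ε a ≠ 0) {k : ℕ} (T : Tensor k) :
    pullback (monomialMat 1 ε⁻¹) (pullback (monomialMat 1 ε) T) = T := by
  funext i
  have h1 : ((1 : Equiv.Perm (Fin 4)) : Fin 4 → Fin 4) ∘ i = i := rfl
  simp only [pullback_monomialMat, h1, Pi.inv_apply]
  rw [← mul_assoc, ← Finset.prod_mul_distrib, Finset.prod_eq_one, one_mul]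
  exact fun l _ => inv_mul_cancel₀ (hε _)

theorem Background.frameConfig_mem (H : Background N f I) (hσ : σ * σ = 1) (hx : x ∈ region I)
    (hf : 0 < σ * f (x 1))
    (hF : ∀ a b, frameScale N f σ x a * frameScale N f σ x b * F a b = e * J a b)
    (hd : (sssMetric N f x, riemann (sssMetric N f) x, F) ∈ L.dom) :
    frameConfig σ J (curv N f (x 1), e) ∈ L.dom := by
  obtain ⟨h1, h2, h3⟩ := H.frame_config hσ hx hf hF
  have := L.dom_invariant _ (isUnit_det_monomialMat 1 (H.frameScale_ne hx hf)) _ _ _ hd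
  rwa [h1, h2, h3] at this

/-- Membership in the domain is assumed at the frame values, since under variations of N, f or the
potential it is obtained from openness in the frame variables. Invariance is accordingly applied to
the inverse rescaling. -/
theorem Background.toFun_eq_frameLag (H : Background N f I) (hσ : σ * σ = 1) (hx : x ∈ region I)
    (hf : 0 < σ * f (x 1))
    (hF : ∀ a b, frameScale N f σ x a * frameScale N f σ x b * F a b = e * J a b)
    (hd : frameConfig σ J (curv N f (x 1), e) ∈ L.dom) :
    L.toFun (sssMetric N f x) (riemann (sssMetric N f) x) F
      = frameLag L σ J (curv N f (x 1), e) := by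
  obtain ⟨h1, h2, h3⟩ := H.frame_config hσ hx hf hF
  have hs := H.frameScale_ne hx hf
  have hu := isUnit_det_monomialMat 1 (ε := (frameScale N f σ x)⁻¹) fun a => inv_ne_zero (hs a)
  have := L.invariant _ hu _ _ _ hd
  simp only at this
  rwa [← h1, ← h2, ← h3, monomialMat_inv_congr hs, pullback_inv_pullback hs,
    monomialMat_inv_congr hs, h1, h2, h3] at this

theorem Background.dRiem_eq_planes (H : Background N f I) (hσ : σ * σ = 1)
    (hJ : J = electricJ ∨ J = magneticJ) (hx : x ∈ region I) (hf : 0 < σ * f (x 1))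
    (hF : ∀ a b, frameScale N f σ x a * frameScale N f σ x b * F a b = e * J a b)
    (hd : (sssMetric N f x, riemann (sssMetric N f) x, F) ∈ L.dom) (a b c d : Fin 4) :
    dRiem L (sssMetric N f x) (riemann (sssMetric N f) x) F ![a, b, c, d]
      = planes (planeDeriv L σ J (curv N f (x 1), e)) a b * (metricD N f x a)⁻¹
        * (metricD N f x b)⁻¹ * kr₂ a b c d := by
  obtain ⟨h1, h2, h3⟩ := H.frame_config hσ hx hf hF
  have hs := H.frameScale_sq hσ hx hf
  have hg := H.metricD_ne hx
  have hv := H.frameConfig_mem hσ hx hf hF hd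
  have key := dRiem_monomialMat hd 1 (H.frameScale_ne hx hf) ![a, b, c, d]
  rw [h1, h2, h3] at key
  have h4 : ((1 : Equiv.Perm (Fin 4)) : Fin 4 → Fin 4) ∘ ![a, b, c, d] = ![a, b, c, d] := rfl
  have h5 := frameRiem_eq hσ hJ hv a b c d
  rw [h4] at key
  rw [frameRiem] at h5
  rw [key, h5]
  simp only [Fin.prod_univ_four, Matrix.cons_val]
  have hinv : ∀ a, (metricD N f x a)⁻¹
      = frameScale N f σ x a * frameScale N f σ x a * frameMetric σ a := by
    intro a
    rw [inv_eq_iff_eq_inv, ← one_div, eq_div_iff (by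
      rw [← hs]; have := H.frameScale_ne hx hf a; have := hg a; positivity)]
    linear_combination frameMetric_mul_self hσ a + frameMetric σ a * hs a
  rw [hinv, hinv]
  by_cases hk : kr₂ a b c d = 0
  · simp [hk]
  · have : frameScale N f σ x c * frameScale N f σ x d
        = frameScale N f σ x a * frameScale N f σ x b := by
      simp only [kr₂, kr] at hk
      split_ifs at hk <;> simp_all [mul_comm]
    linear_combination frameScale N f σ x a * frameScale N f σ x b
      * planes (planeDeriv L σ J (curv N f (x 1), e)) a b * frameMetric σ a * frameMetric σ b
      * kr₂ a b c d * this

theorem Background.dField_eq_frameField (H : Background N f I) (hσ : σ * σ = 1)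
    (hx : x ∈ region I) (hf : 0 < σ * f (x 1))
    (hF : ∀ a b, frameScale N f σ x a * frameScale N f σ x b * F a b = e * J a b)
    (hd : (sssMetric N f x, riemann (sssMetric N f) x, F) ∈ L.dom) (a b : Fin 4) :
    dField L (sssMetric N f x) (riemann (sssMetric N f) x) F a b
      = frameScale N f σ x a * frameScale N f σ x b
        * frameField L σ J (curv N f (x 1), e) a b := by
  obtain ⟨h1, h2, h3⟩ := H.frame_config hσ hx hf hF
  have key := dField_monomialMat hd 1 (H.frameScale_ne hx hf) a b
  rwa [h1, h2, h3] at key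

theorem fieldStrength_electric (Φ : ℝ → ℝ) (x : Pt) :
    fieldStrength (electricPotential Φ) x = plane₂ (-deriv Φ (x 1)) 0 := by
  ext a b
  fin_cases a <;> fin_cases b <;>
    simp [fieldStrength, pd, electricPotential, plane₂, Function.update]

theorem fieldStrength_magnetic (χ : ℝ → ℝ) (x : Pt) :
    fieldStrength (magneticPotential χ) x = plane₂ 0 (deriv χ (x 2)) := by
  ext a b
  fin_cases a <;> fin_cases b <;>
    simp [fieldStrength, pd, magneticPotential, plane₂, Function.update]

theorem Background.frame_electric (H : Background N f I) (hx : x ∈ region I)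
    (hf : 0 < σ * f (x 1)) {u : ℝ} (a b : Fin 4) :
    frameScale N f σ x a * frameScale N f σ x b * plane₂ (-u) 0 a b
      = u / N (x 1) * electricJ a b := by
  have h2 := H.N_ne _ hx.1
  have h5 := (Real.sqrt_pos.2 hf).ne'
  fin_cases a <;> fin_cases b <;> simp [frameScale, electricJ, plane₂] <;> field_simp

theorem Background.frame_magnetic (H : Background N f I) (hx : x ∈ region I) {u : ℝ}
    (a b : Fin 4) :
    frameScale N f σ x a * frameScale N f σ x b * plane₂ 0 u a b
      = u / (x 1 ^ 2 * Real.sin (x 2)) * magneticJ a b := by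
  have h1 := H.radius_ne _ hx.1
  have h4 := sin_ne_of_mem_region hx
  fin_cases a <;> fin_cases b <;> simp [frameScale, magneticJ, plane₂] <;> field_simp

theorem Background.hasDerivAt_frameLag (H : Background N f I) (hσ : σ * σ = 1)
    (hJ : J.transpose = -J) {e : ℝ → ℝ} {e' r : ℝ} (hr : r ∈ I)
    (hd : frameConfig σ J (curv N f r, e r) ∈ L.dom) (he : HasDerivAt e e' r) :
    HasDerivAt (fun r => frameLag L σ J (curv N f r, e r))
      (4 * planeDeriv L σ J (curv N f r, e r) 0 * curv' N f r 0
        + 8 * planeDeriv L σ J (curv N f r, e r) 1 * curv' N f r 1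
        + 8 * planeDeriv L σ J (curv N f r, e r) 2 * curv' N f r 2
        + 4 * planeDeriv L σ J (curv N f r, e r) 3 * curv' N f r 3
        + fieldDeriv L σ J (curv N f r, e r) * e') r := by
  have hc : HasDerivAt (fun r => (curv N f r, e r)) (curv' N f r, e') r :=
    (hasDerivAt_pi.2 fun i => H.hasDerivAt_curv hr i).prodMk he
  refine ((hasFDerivAt_frameLag hσ hJ hd).comp_hasDerivAt r hc).congr_deriv ?_
  rw [fderiv_frameLag_eq]

/-- A point on the equator over each radius, through which statements on the region descend to
functions of r. -/
theorem exists_mem_region {r : ℝ} (hr : r ∈ I) : ∃ x ∈ region I, x 1 = r :=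
  ⟨![0, r, Real.pi / 2, 0], ⟨hr, by
    simp only [Matrix.cons_val]
    constructor <;> linarith [Real.pi_pos]⟩, rfl⟩

theorem Background.contDiffOn_jet (H : Background N f I) {e : ℝ → ℝ} (he : ContDiffOn ℝ ∞ e I) :
    ContDiffOn ℝ ∞ (fun r => (curv N f r, e r)) I :=
  (contDiffOn_pi.2 H.contDiffOn_curv).prodMk he

theorem Background.resolved_electric (H : Background N f I) (hσ : σ * σ = 1)
    (hf : ∀ r ∈ I, 0 < σ * f r) {Φ : ℝ → ℝ} (hΦ : ContDiffOn ℝ ∞ Φ I)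
    (hd : ∀ x ∈ region I, config (sssMetric N f) (electricPotential Φ) x ∈ L.dom) :
    Resolved L N f (electricPotential Φ) I
      (fun i r => planeDeriv L σ electricJ (curv N f r, deriv Φ r / N r) i)
      (fun r => fieldDeriv L σ electricJ (curv N f r, deriv Φ r / N r)) (fun _ => 0)
      (fun r => deriv Φ r / N r) (fun _ => 0)
      (fun r => frameLag L σ electricJ (curv N f r, deriv Φ r / N r)) := by
  have he : ContDiffOn ℝ ∞ (fun r => deriv Φ r / N r) I :=
    (contDiffOn_deriv H.isOpen hΦ).div H.smooth_N H.N_ne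
  have hF : ∀ x ∈ region I, ∀ a b, frameScale N f σ x a * frameScale N f σ x b
      * fieldStrength (electricPotential Φ) x a b
        = deriv Φ (x 1) / N (x 1) * electricJ a b := fun x hx a b => by
    rw [fieldStrength_electric, H.frame_electric hx (hf _ hx.1)]
  have hv : ∀ r ∈ I, frameConfig σ electricJ (curv N f r, deriv Φ r / N r) ∈ L.dom := by
    intro r hr
    obtain ⟨x, hx, rfl⟩ := exists_mem_region hr
    exact H.frameConfig_mem hσ hx (hf _ hr) (hF x hx) (hd x hx)
  refine ⟨fun i => ?_, ?_, contDiffOn_const, he, fun r _ => ?_, fun x hx a b c d => ?_,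
    fun x hx => ?_, fun x hx => ?_, fun x hx => ?_, fun r hr => ?_⟩
  · exact (contDiffOn_planeDeriv hσ electricJ_transpose i).comp (H.contDiffOn_jet he) hv
  · exact (contDiffOn_fieldDeriv hσ electricJ_transpose).comp (H.contDiffOn_jet he) hv
  · simpa using hasDerivAt_const r (0 : ℝ)
  · exact H.dRiem_eq_planes hσ (.inl rfl) hx (hf _ hx.1) (hF x hx) (hd x hx) a b c d
  · have h2 := H.N_ne _ hx.1
    have h5 := (Real.sqrt_pos.2 (hf _ hx.1)).ne'
    ext a b
    rw [Mup, Matrix.smul_apply, H.dField_eq_frameField hσ hx (hf _ hx.1) (hF x hx) (hd x hx),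
      frameField_electric hσ (hv _ hx.1)]
    fin_cases a <;> fin_cases b <;> simp [plane₂, frameScale] <;> field_simp <;> ring
  · have h2 := H.N_ne _ hx.1
    rw [fieldStrength_electric]
    congr 1
    · field_simp
    · simp
  · exact H.toFun_eq_frameLag hσ hx (hf _ hx.1) (hF x hx) (hv _ hx.1)
  · refine (H.hasDerivAt_frameLag hσ electricJ_transpose hr (hv r hr)
      (hasDerivAt_of_smooth H.isOpen he hr)).congr_deriv ?_
    ring

/-- Since χ' = P sin θ, the factor sin θ of the area element drops out and the frame field strength
is P/r². This gives `deriv_b`, the radial form of dF = 0. -/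
theorem Background.resolved_magnetic (H : Background N f I) (hσ : σ * σ = 1)
    (hf : ∀ r ∈ I, 0 < σ * f r) {χ : ℝ → ℝ} {P : ℝ}
    (hχ : ∀ θ ∈ Set.Ioo 0 Real.pi, deriv χ θ = P * Real.sin θ)
    (hd : ∀ x ∈ region I, config (sssMetric N f) (magneticPotential χ) x ∈ L.dom) :
    Resolved L N f (magneticPotential χ) I
      (fun i r => planeDeriv L σ magneticJ (curv N f r, P / r ^ 2) i) (fun _ => 0)
      (fun r => fieldDeriv L σ magneticJ (curv N f r, P / r ^ 2)) (fun _ => 0)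
      (fun r => P / r ^ 2) (fun r => frameLag L σ magneticJ (curv N f r, P / r ^ 2)) := by
  have he : ContDiffOn ℝ ∞ (fun r => P / r ^ 2) I :=
    contDiffOn_const.div (contDiffOn_id.pow 2) fun r hr => pow_ne_zero 2 (H.radius_ne r hr)
  have hF : ∀ x ∈ region I, ∀ a b, frameScale N f σ x a * frameScale N f σ x b
      * fieldStrength (magneticPotential χ) x a b = P / x 1 ^ 2 * magneticJ a b := by
    intro x hx a b
    have h1 := H.radius_ne _ hx.1
    have h4 := sin_ne_of_mem_region hx
    rw [fieldStrength_magnetic, H.frame_magnetic hx, hχ _ hx.2]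
    congr 1
    field_simp
  have hv : ∀ r ∈ I, frameConfig σ magneticJ (curv N f r, P / r ^ 2) ∈ L.dom := by
    intro r hr
    obtain ⟨x, hx, rfl⟩ := exists_mem_region hr
    exact H.frameConfig_mem hσ hx (hf _ hr) (hF x hx) (hd x hx)
  have hb : ∀ r ∈ I, HasDerivAt (fun r => P / r ^ 2) (-2 * (P / r ^ 2) / r) r := fun r hr => by
    have h1 := H.radius_ne _ hr
    refine ((hasDerivAt_const r P).fun_div (hasDerivAt_pow 2 r) (pow_ne_zero 2 h1)).congr_deriv ?_
    field_simp
    norm_num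
    ring
  refine ⟨fun i => ?_, contDiffOn_const, ?_, contDiffOn_const, hb, fun x hx a b c d => ?_,
    fun x hx => ?_, fun x hx => ?_, fun x hx => ?_, fun r hr => ?_⟩
  · exact (contDiffOn_planeDeriv hσ magneticJ_transpose i).comp (H.contDiffOn_jet he) hv
  · exact (contDiffOn_fieldDeriv hσ magneticJ_transpose).comp (H.contDiffOn_jet he) hv
  · exact H.dRiem_eq_planes hσ (.inr rfl) hx (hf _ hx.1) (hF x hx) (hd x hx) a b c d
  · have h1 := H.radius_ne _ hx.1
    have h4 := sin_ne_of_mem_region hx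
    ext a b
    rw [Mup, Matrix.smul_apply, H.dField_eq_frameField hσ hx (hf _ hx.1) (hF x hx) (hd x hx),
      frameField_magnetic hσ (hv _ hx.1)]
    fin_cases a <;> fin_cases b <;> simp [plane₂, frameScale] <;> field_simp <;> ring
  · have h1 := H.radius_ne _ hx.1
    rw [fieldStrength_magnetic, hχ _ hx.2]
    congr 1
    · simp
    · field_simp
  · exact H.toFun_eq_frameLag hσ hx (hf _ hx.1) (hF x hx) (hv _ hx.1)
  · refine (H.hasDerivAt_frameLag hσ magneticJ_transpose hr (hv r hr) (hb r hr)).congr_deriv ?_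
    simp

end

/-! ### Euler–Lagrange expressions -/

/-- The quadratic polynomial with prescribed value and derivatives at `s`. -/
def quadPoly (s a b c : ℝ) : ℝ → ℝ := fun y => a + b * (y - s) + c / 2 * (y - s) ^ 2

theorem quadPoly_self (s a b c : ℝ) : quadPoly s a b c s = a := by simp [quadPoly]

theorem deriv_quadPoly (s a b c : ℝ) : deriv (quadPoly s a b c) = fun y => b + c * (y - s) := by
  funext y
  have h1 := (hasDerivAt_id' y).sub_const s
  refine (((h1.const_mul b).const_add a).fun_add ((h1.pow 2).const_mul (c / 2))).deriv.trans ?_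
  simp
  ring

theorem deriv_quadPoly_self (s a b c : ℝ) : deriv (quadPoly s a b c) s = b := by
  simp [deriv_quadPoly]

theorem deriv_deriv_quadPoly (s a b c : ℝ) : deriv (deriv (quadPoly s a b c)) s = c := by
  rw [deriv_quadPoly]
  simp

theorem contDiff_quadPoly (s a b c : ℝ) : ContDiff ℝ ∞ (quadPoly s a b c) := by
  unfold quadPoly
  fun_prop

/-- The partial derivatives in u' and u'' are needed along an open set, because they are
differentiated again, once and twice respectively, in s. -/
theorem eulerLagrange_eq {𝓁 : (ℝ → ℝ) → ℝ → ℝ} {u : ℝ → ℝ} {s : ℝ} {I : Set ℝ} (hI : IsOpen I)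
    (hs : s ∈ I) {α β γ : ℝ} {B C C' : ℝ → ℝ}
    (hα : HasDerivAt (fun a => 𝓁 (quadPoly s a (deriv u s) (deriv (deriv u) s)) s) α (u s))
    (hB : ∀ y ∈ I, HasDerivAt (fun b => 𝓁 (quadPoly y (u y) b (deriv (deriv u) y)) y) (B y)
      (deriv u y))
    (hC : ∀ y ∈ I, HasDerivAt (fun c => 𝓁 (quadPoly y (u y) (deriv u y) c) y) (C y)
      (deriv (deriv u) y))
    (hβ : HasDerivAt B β s) (hC' : ∀ y ∈ I, HasDerivAt C (C' y) y) (hγ : HasDerivAt C' γ s) :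
    eulerLagrange 𝓁 u s = α - β + γ := by
  have hm := hI.mem_nhds hs
  have h1 : deriv (fun y => deriv (fun b => 𝓁 (quadPoly y (u y) b (deriv (deriv u) y)) y)
      (deriv u y)) s = β := by
    refine (hβ.congr_of_eventuallyEq ?_).deriv
    filter_upwards [hm] with y hy using (hB y hy).deriv
  have h2 : deriv (deriv (fun y => deriv (fun c => 𝓁 (quadPoly y (u y) (deriv u y) c) y)
      (deriv (deriv u) y))) s = γ := by
    refine (hγ.congr_of_eventuallyEq ?_).deriv
    filter_upwards [hm] with y hy
    refine ((hC' y hy).congr_of_eventuallyEq ?_).deriv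
    filter_upwards [hI.mem_nhds hy] with z hz using (hC z hz).deriv
  -- `quadPoly` unfolds to the polynomial in `eulerLagrange`, so the two sides now agree by
  -- definition.
  rw [← hα.deriv, ← h1, ← h2]
  rfl

section
variable {N f : ℝ → ℝ} {I : Set ℝ} {L : Lagrangian} {σ : ℝ} {J : Mat} {x : Pt}
  {A : Pt → Fin 4 → ℝ} {e : ℝ}

/-- The sectional curvatures in terms of the values and derivatives of `N` and `f`. -/
def curvJet (r n n₁ n₂ p p₁ p₂ : ℝ) : Fin 4 → ℝ :=
  ![-(p * n₂ / n + 3 * p₁ * n₁ / (2 * n) + p₂ / 2), -(p * n₁ / n + p₁ / 2) / r, -(p₁ / (2 * r)),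
    (1 - p) / r ^ 2]

theorem curv_quadPoly_left (f : ℝ → ℝ) (r a b c : ℝ) : curv (quadPoly r a b c) f r
    = curvJet r a b c (f r) (deriv f r) (deriv (deriv f) r) := by
  simp only [curv, curvJet, quadPoly_self, deriv_quadPoly_self, deriv_deriv_quadPoly]

theorem curv_quadPoly_right (N : ℝ → ℝ) (r a b c : ℝ) : curv N (quadPoly r a b c) r
    = curvJet r (N r) (deriv N r) (deriv (deriv N) r) a b c := by
  simp only [curv, curvJet, quadPoly_self, deriv_quadPoly_self, deriv_deriv_quadPoly]

/-- A quadratic replacement for N may have zeros away from its base point; removing them yields a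
legitimate background, to which the curvature formulas apply. -/
theorem Background.inter_left (H : Background N f I) {M : ℝ → ℝ} (hM : ContDiff ℝ ∞ M) :
    Background M f (I ∩ {y | M y ≠ 0}) where
  isOpen := H.isOpen.inter (isOpen_ne_fun hM.continuous continuous_const)
  radius_ne r hr := H.radius_ne r hr.1
  smooth_N := hM.contDiffOn
  smooth_f := H.smooth_f.mono Set.inter_subset_left
  N_ne _ hr := hr.2
  f_ne r hr := H.f_ne r hr.1

theorem Background.inter_right (H : Background N f I) {M : ℝ → ℝ} (hM : ContDiff ℝ ∞ M) :
    Background N M (I ∩ {y | M y ≠ 0}) where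
  isOpen := H.isOpen.inter (isOpen_ne_fun hM.continuous continuous_const)
  radius_ne r hr := H.radius_ne r hr.1
  smooth_N := H.smooth_N.mono Set.inter_subset_left
  smooth_f := hM.contDiffOn
  N_ne r hr := H.N_ne r hr.1
  f_ne _ hr := hr.2

theorem Background.sqrtDet_eq (H : Background N f I) (hx : x ∈ region I) :
    sqrtDet (sssMetric N f) x = |N (x 1)| * x 1 ^ 2 * Real.sin (x 2) := by
  have h3 := H.f_ne _ hx.1
  have h4 := Real.sin_pos_of_mem_Ioo hx.2
  have e : (sssMetric N f x).det = -(N (x 1) * x 1 ^ 2 * Real.sin (x 2)) ^ 2 := by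
    rw [sssMetric, Matrix.det_diagonal, Fin.prod_univ_four]
    simp only [Matrix.cons_val]
    field_simp
  rw [sqrtDet, e, abs_neg, abs_of_nonneg (sq_nonneg _), Real.sqrt_sq_eq_abs, abs_mul, abs_mul,
    abs_of_pos h4, abs_of_nonneg (sq_nonneg (x 1))]

theorem Background.reducedLag_eq (H : Background N f I) (hσ : σ * σ = 1) (hx : x ∈ region I)
    (hf : 0 < σ * f (x 1)) (hF : ∀ a b, frameScale N f σ x a * frameScale N f σ x b
      * fieldStrength A x a b = e * J a b)
    (hd : frameConfig σ J (curv N f (x 1), e) ∈ L.dom) : reducedLag L N f A x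
      = |N (x 1)| * x 1 ^ 2 * Real.sin (x 2) * frameLag L σ J (curv N f (x 1), e) := by
  rw [reducedLag, H.sqrtDet_eq hx, lag, H.toFun_eq_frameLag hσ hx hf hF hd]

/-- The reduced Lagrangian is a weight times `frameLag` only where the frame data lie in the domain
of ℒ. Openness makes this true near t, and the product and chain rules apply. -/
theorem hasDerivAt_mul_frameLag (hσ : σ * σ = 1) (hJ : J.transpose = -J) {F w : ℝ → ℝ}
    {k : ℝ → Fin 4 → ℝ} {e : ℝ → ℝ} {k' : Fin 4 → ℝ} {e' w' t : ℝ}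
    (hd : frameConfig σ J (k t, e t) ∈ L.dom) (hk : ∀ i, HasDerivAt (fun t => k t i) (k' i) t)
    (he : HasDerivAt e e' t) (hw : HasDerivAt w w' t)
    (hF : ∀ᶠ τ in nhds t, frameConfig σ J (k τ, e τ) ∈ L.dom →
      F τ = w τ * frameLag L σ J (k τ, e τ)) :
    HasDerivAt F (w' * frameLag L σ J (k t, e t)
      + w t * (4 * planeDeriv L σ J (k t, e t) 0 * k' 0 + 8 * planeDeriv L σ J (k t, e t) 1 * k' 1
        + 8 * planeDeriv L σ J (k t, e t) 2 * k' 2 + 4 * planeDeriv L σ J (k t, e t) 3 * k' 3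
        + fieldDeriv L σ J (k t, e t) * e')) t := by
  have hc : HasDerivAt (fun t => (k t, e t)) (k', e') t := (hasDerivAt_pi.2 hk).prodMk he
  have h1 := hw.fun_mul ((hasFDerivAt_frameLag hσ hJ hd).comp_hasDerivAt t hc)
  rw [fderiv_frameLag_eq] at h1
  refine h1.congr_of_eventuallyEq ?_
  filter_upwards [hF, hc.continuousAt ((isOpen_frameDom L hσ hJ).mem_nhds hd)] with τ h2 h3
  exact h2 h3

theorem mem_region_update_r (hx : x ∈ region I) {s : ℝ} {I' : Set ℝ} (hs : s ∈ I') :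
    Function.update x 1 s ∈ region I' := by
  refine ⟨by simpa using hs, ?_⟩
  have := hx.2
  simpa [Function.update] using this

theorem mem_region_update_θ (hx : x ∈ region I) {s : ℝ} (hs : s ∈ Set.Ioo 0 Real.pi) :
    Function.update x 2 s ∈ region I := by
  refine ⟨?_, by simpa using hs⟩
  have := hx.1
  simpa [Function.update] using this

end

/-! ### Variation of the metric functions -/

/-- The field strength `ε N r` of the ansatz in an orthonormal frame, together with its derivative
`ε'` in `N`. -/
structure Framed (L : Lagrangian) (σ ν : ℝ) (J : Mat) (N f : ℝ → ℝ) (A : Pt → Fin 4 → ℝ)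
    (I : Set ℝ) (ε : ℝ → ℝ → ℝ) (ε' : ℝ → ℝ) : Prop where
  mul_self_σ : σ * σ = 1
  mul_self_ν : ν * ν = 1
  pos_f : ∀ r ∈ I, 0 < σ * f r
  pos_N : ∀ r ∈ I, 0 < ν * N r
  transpose_J : J.transpose = -J
  frame_eq : ∀ {M g : ℝ → ℝ} {I' : Set ℝ}, Background M g I' → ∀ x ∈ region I', 0 < σ * g (x 1) →
    ∀ a b, frameScale M g σ x a * frameScale M g σ x b * fieldStrength A x a b
      = ε (M (x 1)) (x 1) * J a b
  mem_dom : ∀ r ∈ I, frameConfig σ J (curv N f r, ε (N r) r) ∈ L.dom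
  deriv_ε : ∀ r ∈ I, HasDerivAt (fun a => ε a r) (ε' r) (N r)

theorem abs_eq_sign_mul {ν a : ℝ} (hν : ν * ν = 1) (h : 0 < ν * a) : |a| = ν * a := by
  have h1 : |ν| = 1 := by
    have : |ν| * |ν| = 1 := by rw [abs_mul_abs_self, hν]
    nlinarith [abs_nonneg ν]
  rw [← abs_of_pos h, abs_mul, h1, one_mul]

section
variable {N f : ℝ → ℝ} {I : Set ℝ} {L : Lagrangian} {σ ν : ℝ} {J : Mat} {x : Pt}
  {A : Pt → Fin 4 → ℝ} {ε : ℝ → ℝ → ℝ} {ε' : ℝ → ℝ}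

theorem hasDerivAt_curvJet_n (r n n₁ n₂ p p₁ p₂ : ℝ) (hn : n ≠ 0) (i : Fin 4) :
    HasDerivAt (fun n => curvJet r n n₁ n₂ p p₁ p₂ i)
      ((![p * n₂ / n ^ 2 + 3 * p₁ * n₁ / (2 * n ^ 2), p * n₁ / n ^ 2 / r, 0, 0] : Fin 4 → ℝ) i)
      n := by
  have h := hasDerivAt_inv hn
  fin_cases i
  · refine HasDerivAt.congr_deriv (f := fun n => -(p * n₂ / n + 3 * p₁ * n₁ / (2 * n) + p₂ / 2))
      (f' := -(p * n₂ * (-(n ^ 2)⁻¹) + 3 * p₁ * n₁ / 2 * (-(n ^ 2)⁻¹))) ?_ ?_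
    · refine (((h.const_mul (p * n₂)).fun_add (h.const_mul (3 * p₁ * n₁ / 2))).add_const
        (p₂ / 2)).fun_neg.congr_of_eventuallyEq (.of_forall fun y => ?_)
      simp only [div_eq_mul_inv, mul_inv]
      ring
    · simp
      field_simp
      ring
  · refine HasDerivAt.congr_deriv (f := fun n => -(p * n₁ / n + p₁ / 2) / r)
      (f' := -(p * n₁ * (-(n ^ 2)⁻¹)) / r) ?_ ?_
    · exact (((h.const_mul (p * n₁)).add_const (p₁ / 2)).fun_neg.div_const r)
    · simp
      field_simp
  · exact hasDerivAt_const _ _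
  · exact hasDerivAt_const _ _

/-- The curvatures are affine in every jet variable except the value of N, so their derivatives in
those variables are slopes. -/
theorem hasDerivAt_affine {u : ℝ → ℝ} {m t : ℝ} (h : ∀ τ, u τ = u t + m * (τ - t)) :
    HasDerivAt u m t := by
  rw [funext h]
  simpa using (((hasDerivAt_id' t).sub_const t).const_mul m).const_add (u t)

theorem hasDerivAt_curvJet_n₁ (r n n₁ n₂ p p₁ p₂ : ℝ) (i : Fin 4) :
    HasDerivAt (fun n₁ => curvJet r n n₁ n₂ p p₁ p₂ i)
      ((![-(3 * p₁ / (2 * n)), -(p / n) / r, 0, 0] : Fin 4 → ℝ) i) n₁ := by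
  refine hasDerivAt_affine fun τ => ?_
  fin_cases i <;> simp [curvJet] <;> ring

theorem hasDerivAt_curvJet_n₂ (r n n₁ n₂ p p₁ p₂ : ℝ) (i : Fin 4) :
    HasDerivAt (fun n₂ => curvJet r n n₁ n₂ p p₁ p₂ i)
      ((![-(p / n), 0, 0, 0] : Fin 4 → ℝ) i) n₂ := by
  refine hasDerivAt_affine fun τ => ?_
  fin_cases i <;> simp [curvJet]; ring

theorem hasDerivAt_curvJet_p (r n n₁ n₂ p p₁ p₂ : ℝ) (i : Fin 4) :
    HasDerivAt (fun p => curvJet r n n₁ n₂ p p₁ p₂ i)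
      ((![-(n₂ / n), -(n₁ / n) / r, 0, -1 / r ^ 2] : Fin 4 → ℝ) i) p := by
  refine hasDerivAt_affine fun τ => ?_
  fin_cases i <;> simp [curvJet] <;> ring

theorem hasDerivAt_curvJet_p₁ (r n n₁ n₂ p p₁ p₂ : ℝ) (i : Fin 4) :
    HasDerivAt (fun p₁ => curvJet r n n₁ n₂ p p₁ p₂ i)
      ((![-(3 * n₁ / (2 * n)), -(1 / 2) / r, -(1 / (2 * r)), 0] : Fin 4 → ℝ) i) p₁ := by
  refine hasDerivAt_affine fun τ => ?_
  fin_cases i <;> simp [curvJet] <;> ring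

theorem hasDerivAt_curvJet_p₂ (r n n₁ n₂ p p₁ p₂ : ℝ) (i : Fin 4) :
    HasDerivAt (fun p₂ => curvJet r n n₁ n₂ p p₁ p₂ i)
      ((![-(1 / 2), 0, 0, 0] : Fin 4 → ℝ) i) p₂ := by
  refine hasDerivAt_affine fun τ => ?_
  fin_cases i <;> simp [curvJet]; ring

theorem curv_eq_curvJet (N f : ℝ → ℝ) (r : ℝ) : curv N f r = curvJet r (N r) (deriv N r)
    (deriv (deriv N) r) (f r) (deriv f r) (deriv (deriv f) r) := rfl

theorem Framed.reducedLag_left (G : Framed L σ ν J N f A I ε ε') (H : Background N f I)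
    (hx : x ∈ region I) {r : ℝ} (hr : r ∈ I) {a : ℝ} (b c : ℝ) (ha : 0 < ν * a)
    (hd : frameConfig σ J (curvJet r a b c (f r) (deriv f r) (deriv (deriv f) r), ε a r) ∈ L.dom) :
    reducedLag L (quadPoly r a b c) f A (Function.update x 1 r)
      = ν * a * r ^ 2 * Real.sin (x 2) * frameLag L σ J
        (curvJet r a b c (f r) (deriv f r) (deriv (deriv f) r), ε a r) := by
  have ha0 : a ≠ 0 := fun h => by simp [h] at ha
  have H' := H.inter_left (contDiff_quadPoly r a b c)
  have hx' : Function.update x 1 r ∈ region (I ∩ {y | quadPoly r a b c y ≠ 0}) :=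
    mem_region_update_r hx ⟨hr, by simpa [quadPoly_self] using ha0⟩
  have hf : 0 < σ * f (Function.update x 1 r 1) := by simpa using G.pos_f r hr
  have hd' : frameConfig σ J (curv (quadPoly r a b c) f (Function.update x 1 r 1),
      ε (quadPoly r a b c (Function.update x 1 r 1)) (Function.update x 1 r 1)) ∈ L.dom := by
    simpa [curv_quadPoly_left, quadPoly_self] using hd
  rw [H'.reducedLag_eq G.mul_self_σ hx' hf (G.frame_eq H' _ hx' hf) hd']
  simp [curv_quadPoly_left, quadPoly_self, abs_eq_sign_mul G.mul_self_ν ha]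

theorem Framed.reducedLag_right (G : Framed L σ ν J N f A I ε ε') (H : Background N f I)
    (hx : x ∈ region I) {r : ℝ} (hr : r ∈ I) {a : ℝ} (b c : ℝ) (ha : 0 < σ * a)
    (hd : frameConfig σ J (curvJet r (N r) (deriv N r) (deriv (deriv N) r) a b c, ε (N r) r)
      ∈ L.dom) :
    reducedLag L N (quadPoly r a b c) A (Function.update x 1 r)
      = ν * N r * r ^ 2 * Real.sin (x 2) * frameLag L σ J
        (curvJet r (N r) (deriv N r) (deriv (deriv N) r) a b c, ε (N r) r) := by
  have ha0 : a ≠ 0 := fun h => by simp [h] at ha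
  have H' := H.inter_right (contDiff_quadPoly r a b c)
  have hx' : Function.update x 1 r ∈ region (I ∩ {y | quadPoly r a b c y ≠ 0}) :=
    mem_region_update_r hx ⟨hr, by simpa [quadPoly_self] using ha0⟩
  have hf : 0 < σ * quadPoly r a b c (Function.update x 1 r 1) := by simpa [quadPoly_self] using ha
  have hd' : frameConfig σ J (curv N (quadPoly r a b c) (Function.update x 1 r 1),
      ε (N (Function.update x 1 r 1)) (Function.update x 1 r 1)) ∈ L.dom := by
    simpa [curv_quadPoly_right] using hd
  rw [H'.reducedLag_eq G.mul_self_σ hx' hf (G.frame_eq H' _ hx' hf) hd']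
  simp [curv_quadPoly_right, abs_eq_sign_mul G.mul_self_ν (G.pos_N r hr)]

theorem Background.hasDerivAt_divR_zero (H : Background N f I) {q : Fin 4 → ℝ → ℝ}
    (hq : ∀ i, ContDiffOn ℝ ∞ (q i) I) {r : ℝ} (hr : r ∈ I) :
    HasDerivAt (fun r => divR N f q r 0) (deriv (deriv (q 0)) r
      + 2 * (deriv (q 0) r - deriv (q 1) r) / r - 2 * (q 0 r - q 1 r) / r ^ 2) r := by
  have h1 := H.radius_ne r hr
  have d := fun i => hasDerivAt_of_smooth H.isOpen (hq i) hr
  have d2 := hasDerivAt_of_smooth H.isOpen (contDiffOn_deriv H.isOpen (hq 0)) hr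
  refine (d2.fun_add ((((d 0).fun_sub (d 1)).const_mul 2).fun_div (hasDerivAt_id' r)
    h1)).congr_deriv ?_
  field_simp
  ring

variable {q : Fin 4 → ℝ → ℝ} {pe pm e b l : ℝ → ℝ}

-- Varying N changes only g_tt, so only the tt-component of ℰ can appear. The verification compares
-- the integrated-by-parts derivatives of the curvatures, weighted by q, with the double divergence
-- in `gravR`. The hypothesis `hp` accounts for the N-dependence of the frame field strength: it is
-- Φ'/N in the electric case and independent of N in the magnetic one.
set_option maxHeartbeats 1000000 in
theorem Framed.eqN_eq (G : Framed L σ ν J N f A I ε ε') (H : Background N f I)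
    (R : Resolved L N f A I q pe pm e b l)
    (hq : ∀ i, q i = fun r => planeDeriv L σ J (curv N f r, ε (N r) r) i)
    (hl : l = fun r => frameLag L σ J (curv N f r, ε (N r) r))
    (hp : ∀ r ∈ I, N r * fieldDeriv L σ J (curv N f r, ε (N r) r) * ε' r = -(pe r * e r))
    (hx : x ∈ region I) :
    eqN L N f A x = -2 * ν * Real.sin (x 2) * x 1 ^ 2 * gravR N f q pe pm e b l (x 1) 0 := by
  obtain ⟨hr, hθ⟩ := id hx
  set S := Real.sin (x 2)
  have dq := fun i r (hr : r ∈ I) => hasDerivAt_of_smooth H.isOpen (R.smooth_q i) hr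
  have dq' := fun r (hr : r ∈ I) =>
    hasDerivAt_of_smooth H.isOpen (contDiffOn_deriv H.isOpen (R.smooth_q 0)) hr
  have df := fun r (hr : r ∈ I) => hasDerivAt_of_smooth H.isOpen H.smooth_f hr
  have df' := fun r (hr : r ∈ I) =>
    hasDerivAt_of_smooth H.isOpen (contDiffOn_deriv H.isOpen H.smooth_f) hr
  have qe : ∀ i r, planeDeriv L σ J (curvJet r (N r) (deriv N r) (deriv (deriv N) r) (f r)
      (deriv f r) (deriv (deriv f) r), ε (N r) r) i = q i r := fun i r => by rw [hq i]; rfl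
  have le : ∀ r, frameLag L σ J (curvJet r (N r) (deriv N r) (deriv (deriv N) r) (f r)
      (deriv f r) (deriv (deriv f) r), ε (N r) r) = l r := fun r => by rw [hl]; rfl
  have h1 := H.radius_ne _ hr
  have h2 := H.N_ne _ hr
  have hα : HasDerivAt (fun a => reducedLag L (quadPoly (x 1) a (deriv N (x 1))
      (deriv (deriv N) (x 1))) f A (Function.update x 1 (x 1)))
      (ν * S * x 1 ^ 2 * l (x 1) + ν * S * (N (x 1) * x 1 ^ 2
        * (4 * q 0 (x 1) * (f (x 1) * deriv (deriv N) (x 1) / N (x 1) ^ 2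
          + 3 * deriv f (x 1) * deriv N (x 1) / (2 * N (x 1) ^ 2))
        + 8 * q 1 (x 1) * (f (x 1) * deriv N (x 1) / N (x 1) ^ 2 / x 1))
        - x 1 ^ 2 * (pe (x 1) * e (x 1)))) (N (x 1)) := by
    refine (hasDerivAt_mul_frameLag (w := fun a => ν * a * x 1 ^ 2 * S) (e := fun a => ε a (x 1))
      (k := fun a => curvJet (x 1) a (deriv N (x 1)) (deriv (deriv N) (x 1)) (f (x 1))
        (deriv f (x 1)) (deriv (deriv f) (x 1))) (w' := ν * x 1 ^ 2 * S)
      G.mul_self_σ G.transpose_J (G.mem_dom _ hr)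
      (fun i => hasDerivAt_curvJet_n _ _ _ _ _ _ _ h2 i) (G.deriv_ε _ hr)
      (hasDerivAt_affine fun τ => by ring) ?_).congr_deriv ?_
    -- Nearby values of N keep the sign ν, so that |a| = ν a and the weight is differentiable.
    · filter_upwards [(continuous_const_mul ν).continuousAt.eventually (lt_mem_nhds
          (G.pos_N _ hr))] with a ha hd using G.reducedLag_left H hx hr _ _ ha hd
    · have hp' := hp _ hr
      rw [curv_eq_curvJet] at hp'
      simp only [qe, le, Matrix.cons_val]
      linear_combination ν * S * x 1 ^ 2 * hp'
  have hB : ∀ y ∈ I, HasDerivAt (fun b => reducedLag L (quadPoly y (N y) b (deriv (deriv N) y)) f A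
      (Function.update x 1 y))
      (ν * S * (-6 * y ^ 2 * deriv f y * q 0 y - 8 * y * f y * q 1 y)) (deriv N y) := by
    intro y hy
    refine (hasDerivAt_mul_frameLag (w := fun _ => ν * N y * y ^ 2 * S) (e := fun _ => ε (N y) y)
      (k := fun b => curvJet y (N y) b (deriv (deriv N) y) (f y) (deriv f y) (deriv (deriv f) y))
      G.mul_self_σ G.transpose_J (G.mem_dom _ hy) (fun i => hasDerivAt_curvJet_n₁ _ _ _ _ _ _ _ i)
      (hasDerivAt_const _ _) (hasDerivAt_const _ _) (.of_forall fun b hd =>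
        G.reducedLag_left H hx hy _ _ (G.pos_N _ hy) hd)).congr_deriv ?_
    have h1 := H.radius_ne _ hy
    have h2 := H.N_ne _ hy
    simp only [qe, Matrix.cons_val]
    field_simp
    ring
  have hC : ∀ y ∈ I, HasDerivAt (fun c => reducedLag L (quadPoly y (N y) (deriv N y) c) f A
      (Function.update x 1 y)) (-4 * ν * S * (y ^ 2 * f y * q 0 y)) (deriv (deriv N) y) := by
    intro y hy
    refine (hasDerivAt_mul_frameLag (w := fun _ => ν * N y * y ^ 2 * S) (e := fun _ => ε (N y) y)
      (k := fun c => curvJet y (N y) (deriv N y) c (f y) (deriv f y) (deriv (deriv f) y))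
      G.mul_self_σ G.transpose_J (G.mem_dom _ hy) (fun i => hasDerivAt_curvJet_n₂ _ _ _ _ _ _ _ i)
      (hasDerivAt_const _ _) (hasDerivAt_const _ _) (.of_forall fun b hd =>
        G.reducedLag_left H hx hy _ _ (G.pos_N _ hy) hd)).congr_deriv ?_
    have h2 := H.N_ne _ hy
    simp only [qe, Matrix.cons_val]
    field_simp
    ring
  have hβ := (((((hasDerivAt_pow 2 (x 1)).const_mul (-6)).fun_mul (df' _ hr)).fun_mul
    (dq 0 _ hr)).fun_sub ((((hasDerivAt_id' (x 1)).const_mul 8).fun_mul (df _ hr)).fun_mul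
      (dq 1 _ hr))).const_mul (ν * S)
  have hC' : ∀ y ∈ I, HasDerivAt (fun y => -4 * ν * S * (y ^ 2 * f y * q 0 y)) (-4 * ν * S
      * ((2 * y * f y + y ^ 2 * deriv f y) * q 0 y + y ^ 2 * f y * deriv (q 0) y)) y := fun y hy =>
    ((((hasDerivAt_pow 2 y).fun_mul (df y hy)).fun_mul (dq 0 y hy)).const_mul
      (-4 * ν * S)).congr_deriv (by norm_num)
  have hγ := ((((((hasDerivAt_id' (x 1)).const_mul 2).fun_mul (df _ hr)).fun_add
      ((hasDerivAt_pow 2 (x 1)).fun_mul (df' _ hr))).fun_mul (dq 0 _ hr)).fun_add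
      (((hasDerivAt_pow 2 (x 1)).fun_mul (df _ hr)).fun_mul (dq' _ hr))).const_mul (-4 * ν * S)
  have key := eulerLagrange_eq (𝓁 := fun u s => reducedLag L u f A (Function.update x 1 s))
    H.isOpen hr hα hB hC hβ hC' hγ
  rw [eqN, key]
  simp only [gravR, div₂R, (H.hasDerivAt_divR_zero R.smooth_q hr).deriv, Matrix.cons_val]
  simp only [curv, divR, Matrix.cons_val]
  simp only [Nat.cast_ofNat, Nat.add_one_sub_one, pow_one]
  generalize deriv (deriv (q 0)) (x 1) = a₁, deriv (q 0) (x 1) = a₂, deriv (q 1) (x 1) = a₃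
  field_simp
  ring

-- A variation of f changes g_tt and g_rr by opposite relative amounts δf/f and -δf/f, whence the
-- difference of the two mixed components. The frame field strength does not involve f, so there is
-- no analogue of `hp`.
set_option maxHeartbeats 1000000 in
theorem Framed.eqf_eq (G : Framed L σ ν J N f A I ε ε') (H : Background N f I)
    (R : Resolved L N f A I q pe pm e b l)
    (hq : ∀ i, q i = fun r => planeDeriv L σ J (curv N f r, ε (N r) r) i) (hx : x ∈ region I) :
    eqf L N f A x = ν * Real.sin (x 2) * x 1 ^ 2 * N (x 1) / f (x 1)
      * (gravR N f q pe pm e b l (x 1) 1 - gravR N f q pe pm e b l (x 1) 0) := by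
  obtain ⟨hr, hθ⟩ := id hx
  set S := Real.sin (x 2)
  have dq := fun i r (hr : r ∈ I) => hasDerivAt_of_smooth H.isOpen (R.smooth_q i) hr
  have dq' := fun r (hr : r ∈ I) =>
    hasDerivAt_of_smooth H.isOpen (contDiffOn_deriv H.isOpen (R.smooth_q 0)) hr
  have dN := fun r (hr : r ∈ I) => hasDerivAt_of_smooth H.isOpen H.smooth_N hr
  have dN' := fun r (hr : r ∈ I) =>
    hasDerivAt_of_smooth H.isOpen (contDiffOn_deriv H.isOpen H.smooth_N) hr
  have qe : ∀ i r, planeDeriv L σ J (curvJet r (N r) (deriv N r) (deriv (deriv N) r) (f r)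
      (deriv f r) (deriv (deriv f) r), ε (N r) r) i = q i r := fun i r => by rw [hq i]; rfl
  have h1 := H.radius_ne _ hr
  have h2 := H.N_ne _ hr
  have h3 := H.f_ne _ hr
  have hα : HasDerivAt (fun a => reducedLag L N (quadPoly (x 1) a (deriv f (x 1))
      (deriv (deriv f) (x 1))) A (Function.update x 1 (x 1)))
      (ν * S * (-4 * x 1 ^ 2 * q 0 (x 1) * deriv (deriv N) (x 1)
        - 8 * x 1 * q 1 (x 1) * deriv N (x 1) - 4 * q 3 (x 1) * N (x 1))) (f (x 1)) := by
    refine (hasDerivAt_mul_frameLag (w := fun _ => ν * N (x 1) * x 1 ^ 2 * S)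
      (e := fun _ => ε (N (x 1)) (x 1))
      (k := fun a => curvJet (x 1) (N (x 1)) (deriv N (x 1)) (deriv (deriv N) (x 1)) a
        (deriv f (x 1)) (deriv (deriv f) (x 1)))
      G.mul_self_σ G.transpose_J (G.mem_dom _ hr)
      (fun i => hasDerivAt_curvJet_p _ _ _ _ _ _ _ i) (hasDerivAt_const _ _)
      (hasDerivAt_const _ _) ?_).congr_deriv ?_
    · filter_upwards [(continuous_const_mul σ).continuousAt.eventually (lt_mem_nhds
          (G.pos_f _ hr))] with a ha hd using G.reducedLag_right H hx hr _ _ ha hd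
    · simp only [qe, Matrix.cons_val]
      field_simp
      ring
  have hB : ∀ y ∈ I, HasDerivAt (fun b => reducedLag L N (quadPoly y (f y) b (deriv (deriv f) y)) A
      (Function.update x 1 y))
      (ν * S * (-6 * y ^ 2 * deriv N y * q 0 y - 4 * y * N y * (q 1 y + q 2 y))) (deriv f y) := by
    intro y hy
    refine (hasDerivAt_mul_frameLag (w := fun _ => ν * N y * y ^ 2 * S) (e := fun _ => ε (N y) y)
      (k := fun b => curvJet y (N y) (deriv N y) (deriv (deriv N) y) (f y) b (deriv (deriv f) y))
      G.mul_self_σ G.transpose_J (G.mem_dom _ hy) (fun i => hasDerivAt_curvJet_p₁ _ _ _ _ _ _ _ i)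
      (hasDerivAt_const _ _) (hasDerivAt_const _ _) (.of_forall fun b hd =>
        G.reducedLag_right H hx hy _ _ (G.pos_f _ hy) hd)).congr_deriv ?_
    have h1 := H.radius_ne _ hy
    have h2 := H.N_ne _ hy
    simp only [qe, Matrix.cons_val]
    field_simp
    ring
  have hC : ∀ y ∈ I, HasDerivAt (fun c => reducedLag L N (quadPoly y (f y) (deriv f y) c) A
      (Function.update x 1 y)) (-2 * ν * S * (y ^ 2 * N y * q 0 y)) (deriv (deriv f) y) := by
    intro y hy
    refine (hasDerivAt_mul_frameLag (w := fun _ => ν * N y * y ^ 2 * S) (e := fun _ => ε (N y) y)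
      (k := fun c => curvJet y (N y) (deriv N y) (deriv (deriv N) y) (f y) (deriv f y) c)
      G.mul_self_σ G.transpose_J (G.mem_dom _ hy) (fun i => hasDerivAt_curvJet_p₂ _ _ _ _ _ _ _ i)
      (hasDerivAt_const _ _) (hasDerivAt_const _ _) (.of_forall fun b hd =>
        G.reducedLag_right H hx hy _ _ (G.pos_f _ hy) hd)).congr_deriv ?_
    simp only [qe, Matrix.cons_val]
    ring
  have hβ := (((((hasDerivAt_pow 2 (x 1)).const_mul (-6)).fun_mul (dN' _ hr)).fun_mul
    (dq 0 _ hr)).fun_sub ((((hasDerivAt_id' (x 1)).const_mul 4).fun_mul (dN _ hr)).fun_mul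
      ((dq 1 _ hr).fun_add (dq 2 _ hr)))).const_mul (ν * S)
  have hC' : ∀ y ∈ I, HasDerivAt (fun y => -2 * ν * S * (y ^ 2 * N y * q 0 y)) (-2 * ν * S
      * ((2 * y * N y + y ^ 2 * deriv N y) * q 0 y + y ^ 2 * N y * deriv (q 0) y)) y := fun y hy =>
    ((((hasDerivAt_pow 2 y).fun_mul (dN y hy)).fun_mul (dq 0 y hy)).const_mul
      (-2 * ν * S)).congr_deriv (by norm_num)
  have hγ := ((((((hasDerivAt_id' (x 1)).const_mul 2).fun_mul (dN _ hr)).fun_add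
      ((hasDerivAt_pow 2 (x 1)).fun_mul (dN' _ hr))).fun_mul (dq 0 _ hr)).fun_add
      (((hasDerivAt_pow 2 (x 1)).fun_mul (dN _ hr)).fun_mul (dq' _ hr))).const_mul (-2 * ν * S)
  have key := eulerLagrange_eq (𝓁 := fun u s => reducedLag L N u A (Function.update x 1 s))
    H.isOpen hr hα hB hC hβ hC' hγ
  rw [eqf, key]
  simp only [gravR, div₂R, (H.hasDerivAt_divR_zero R.smooth_q hr).deriv, Matrix.cons_val]
  simp only [curv, divR, accel, Matrix.cons_val]
  simp only [Nat.cast_ofNat, Nat.add_one_sub_one, pow_one]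
  generalize deriv (deriv (q 0)) (x 1) = a₁, deriv (q 0) (x 1) = a₂, deriv (q 1) (x 1) = a₃
  field_simp
  ring

end

/-! ### The reduced equations and the field equations -/

section
variable {N f : ℝ → ℝ} {I : Set ℝ} {L : Lagrangian} {σ ν : ℝ} {J : Mat} {x : Pt}
  {A : Pt → Fin 4 → ℝ} {ε : ℝ → ℝ → ℝ} {ε' : ℝ → ℝ}
  {q : Fin 4 → ℝ → ℝ} {pe pm e b l : ℝ → ℝ}

theorem Framed.sqrtDet_eq (G : Framed L σ ν J N f A I ε ε') (H : Background N f I)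
    (hx : x ∈ region I) :
    sqrtDet (sssMetric N f) x = ν * N (x 1) * x 1 ^ 2 * Real.sin (x 2) := by
  rw [H.sqrtDet_eq hx, abs_eq_sign_mul G.mul_self_ν (G.pos_N _ hx.1)]

theorem Framed.reduced_eq (G : Framed L σ ν J N f A I ε ε') (H : Background N f I)
    (R : Resolved L N f A I q pe pm e b l)
    (hq : ∀ i, q i = fun r => planeDeriv L σ J (curv N f r, ε (N r) r) i)
    (hl : l = fun r => frameLag L σ J (curv N f r, ε (N r) r))
    (hp : ∀ r ∈ I, N r * fieldDeriv L σ J (curv N f r, ε (N r) r) * ε' r = -(pe r * e r))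
    (hx : x ∈ region I) :
    eqN L N f A x = sqrtDet (sssMetric N f) x
        * (2 / (N (x 1) ^ 3 * f (x 1)) * gravEq L (sssMetric N f) A x 0 0) ∧
      eqf L N f A x = sqrtDet (sssMetric N f) x
        * (1 / (N (x 1) ^ 2 * f (x 1) ^ 2) * gravEq L (sssMetric N f) A x 0 0
          + gravEq L (sssMetric N f) A x 1 1) := by
  have h2 := H.N_ne _ hx.1
  have h3 := H.f_ne _ hx.1
  rw [G.eqN_eq H R hq hl hp hx, G.eqf_eq H R hq hx, G.sqrtDet_eq H hx, R.gravEq_eq H hx,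
    R.gravEq_eq H hx]
  simp only [metricD, metricR, metricT, kr, if_true, Matrix.cons_val]
  constructor
  · field_simp
  · field_simp
    ring

theorem Background.framed_electric (H : Background N f I) (hσ : σ * σ = 1) (hν : ν * ν = 1)
    (hf : ∀ r ∈ I, 0 < σ * f r) (hN : ∀ r ∈ I, 0 < ν * N r) {Φ : ℝ → ℝ}
    (hd : ∀ x ∈ region I, config (sssMetric N f) (electricPotential Φ) x ∈ L.dom) :
    Framed L σ ν electricJ N f (electricPotential Φ) I (fun a r => deriv Φ r / a)
      (fun r => -(deriv Φ r / N r ^ 2)) := by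
  have hF : ∀ {M g : ℝ → ℝ} {I' : Set ℝ}, Background M g I' → ∀ x ∈ region I', 0 < σ * g (x 1) →
      ∀ a b, frameScale M g σ x a * frameScale M g σ x b
        * fieldStrength (electricPotential Φ) x a b = deriv Φ (x 1) / M (x 1) * electricJ a b :=
    fun H' x hx hg a b => by rw [fieldStrength_electric, H'.frame_electric hx hg]
  refine ⟨hσ, hν, hf, hN, electricJ_transpose, hF, fun r hr => ?_, fun r hr => ?_⟩
  · obtain ⟨x, hx, rfl⟩ := exists_mem_region hr
    exact H.frameConfig_mem hσ hx (hf _ hr) (hF H x hx (hf _ hr)) (hd x hx)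
  · refine ((hasDerivAt_inv (H.N_ne r hr)).const_mul (deriv Φ r)).congr_deriv ?_
    rw [div_eq_mul_inv, mul_neg]

theorem Background.framed_magnetic (H : Background N f I) (hσ : σ * σ = 1) (hν : ν * ν = 1)
    (hf : ∀ r ∈ I, 0 < σ * f r) (hN : ∀ r ∈ I, 0 < ν * N r) {χ : ℝ → ℝ} {P : ℝ}
    (hχ : ∀ θ ∈ Set.Ioo 0 Real.pi, deriv χ θ = P * Real.sin θ)
    (hd : ∀ x ∈ region I, config (sssMetric N f) (magneticPotential χ) x ∈ L.dom) :
    Framed L σ ν magneticJ N f (magneticPotential χ) I (fun _ r => P / r ^ 2) (fun _ => 0) := by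
  have hF : ∀ {M g : ℝ → ℝ} {I' : Set ℝ}, Background M g I' → ∀ x ∈ region I', 0 < σ * g (x 1) →
      ∀ a b, frameScale M g σ x a * frameScale M g σ x b
        * fieldStrength (magneticPotential χ) x a b = P / x 1 ^ 2 * magneticJ a b := by
    intro M g I' H' x hx hg a b
    have h1 := H'.radius_ne _ hx.1
    have h4 := sin_ne_of_mem_region hx
    rw [fieldStrength_magnetic, H'.frame_magnetic hx, hχ _ hx.2]
    congr 1
    field_simp
  refine ⟨hσ, hν, hf, hN, magneticJ_transpose, hF, fun r hr => ?_, fun r hr => ?_⟩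
  · obtain ⟨x, hx, rfl⟩ := exists_mem_region hr
    exact H.frameConfig_mem hσ hx (hf _ hr) (hF H x hx (hf _ hr)) (hd x hx)
  · exact hasDerivAt_const _ _

/-- A neighbourhood on which `f` and `N` have constant sign. -/
theorem Background.exists_sign (H : Background N f I) {r : ℝ} (hr : r ∈ I) :
    ∃ (σ ν : ℝ) (I' : Set ℝ), σ * σ = 1 ∧ ν * ν = 1 ∧ r ∈ I' ∧ I' ⊆ I ∧ Background N f I' ∧
      (∀ r ∈ I', 0 < σ * f r) ∧ ∀ r ∈ I', 0 < ν * N r := by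
  have sgn : ∀ a : ℝ, a ≠ 0 → ∃ s : ℝ, s * s = 1 ∧ 0 < s * a := fun a ha => by
    rcases ha.lt_or_gt with h | h
    · exact ⟨-1, by norm_num, by linarith⟩
    · exact ⟨1, by norm_num, by linarith⟩
  obtain ⟨σ, hσ, h1⟩ := sgn _ (H.f_ne r hr)
  obtain ⟨ν, hν, h2⟩ := sgn _ (H.N_ne r hr)
  have o1 : IsOpen (I ∩ {y | 0 < σ * f y}) :=
    (continuousOn_const.mul H.smooth_f.continuousOn).isOpen_inter_preimage H.isOpen isOpen_Ioi
  have o2 : IsOpen (I ∩ {y | 0 < ν * N y}) :=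
    (continuousOn_const.mul H.smooth_N.continuousOn).isOpen_inter_preimage H.isOpen isOpen_Ioi
  have hs : (I ∩ {y | 0 < σ * f y}) ∩ (I ∩ {y | 0 < ν * N y}) ⊆ I := fun y hy => hy.1.1
  exact ⟨σ, ν, (I ∩ {y | 0 < σ * f y}) ∩ (I ∩ {y | 0 < ν * N y}), hσ, hν, ⟨⟨hr, h1⟩, hr, h2⟩, hs,
    ⟨o1.inter o2, fun r hr => H.radius_ne r (hs hr), H.smooth_N.mono hs, H.smooth_f.mono hs,
      fun r hr => H.N_ne r (hs hr), fun r hr => H.f_ne r (hs hr)⟩,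
    fun r hr => hr.1.2, fun r hr => hr.2.2⟩

theorem region_mono {I I' : Set ℝ} (h : I' ⊆ I) : region I' ⊆ region I := fun _ hx => ⟨h hx.1, hx.2⟩

/-- The electric and the magnetic ansatz for the vector potential. -/
def IsAnsatz (I : Set ℝ) (A : Pt → Fin 4 → ℝ) : Prop :=
  (∃ Φ : ℝ → ℝ, ContDiffOn ℝ ∞ Φ I ∧ A = electricPotential Φ) ∨
    (∃ (χ : ℝ → ℝ) (P : ℝ), ContDiffOn ℝ ∞ χ (Set.Ioo 0 Real.pi) ∧
      (∀ θ ∈ Set.Ioo 0 Real.pi, deriv χ θ = P * Real.sin θ) ∧ A = magneticPotential χ)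

/-- Every assertion of the theorem is local in r; both ansätze are brought to the same form on a
neighbourhood where f and N have constant sign. -/
theorem Background.exists_resolved (H : Background N f I) (hA : IsAnsatz I A)
    (hd : ∀ x ∈ region I, config (sssMetric N f) A x ∈ L.dom) {r : ℝ} (hr : r ∈ I) :
    ∃ (I' : Set ℝ) (q : Fin 4 → ℝ → ℝ) (pe pm e b l : ℝ → ℝ), r ∈ I' ∧ I' ⊆ I ∧
      Background N f I' ∧ Resolved L N f A I' q pe pm e b l ∧ ∀ x ∈ region I',
        eqN L N f A x = sqrtDet (sssMetric N f) x
          * (2 / (N (x 1) ^ 3 * f (x 1)) * gravEq L (sssMetric N f) A x 0 0) ∧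
        eqf L N f A x = sqrtDet (sssMetric N f) x
          * (1 / (N (x 1) ^ 2 * f (x 1) ^ 2) * gravEq L (sssMetric N f) A x 0 0
            + gravEq L (sssMetric N f) A x 1 1) := by
  obtain ⟨σ, ν, I', hσ, hν, hr', hs, H', hf, hN⟩ := H.exists_sign hr
  have hd' := fun x hx => hd x (region_mono hs hx)
  rcases hA with ⟨Φ, hΦ, rfl⟩ | ⟨χ, P, -, hχ, rfl⟩
  · have R := H'.resolved_electric hσ hf (hΦ.mono hs) hd'
    refine ⟨I', _, _, _, _, _, _, hr', hs, H', R, fun x hx =>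
      (H'.framed_electric hσ hν hf hN hd').reduced_eq H' R (fun _ => rfl) rfl (fun r hr => ?_) hx⟩
    have h2 := H'.N_ne _ hr
    field_simp
  · have R := H'.resolved_magnetic hσ hf hχ hd'
    refine ⟨I', _, _, _, _, _, _, hr', hs, H', R, fun x hx =>
      (H'.framed_magnetic hσ hν hf hN hχ hd').reduced_eq H' R (fun _ => rfl) rfl
        (fun r hr => ?_) hx⟩
    simp

/-- The radial Noether identity involves the derivative of the rr-component, which vanishes because
that component is zero on an open set. Once the tt and Maxwell terms are gone as well, only the
angular component times 2/r is left. -/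
theorem Resolved.gravR_two_eq_zero (R : Resolved L N f A I q pe pm e b l) (H : Background N f I)
    (hm : ∀ x ∈ region I, maxwellEq L (sssMetric N f) A x 0 = 0)
    (h0 : ∀ x ∈ region I, gravEq L (sssMetric N f) A x 0 0 = 0)
    (h1 : ∀ x ∈ region I, gravEq L (sssMetric N f) A x 1 1 = 0) {r : ℝ} (hr : r ∈ I) :
    gravR N f q pe pm e b l r 2 = 0 := by
  have g0 : ∀ r ∈ I, gravR N f q pe pm e b l r 0 = 0 := fun r hr => by
    obtain ⟨x, hx, rfl⟩ := exists_mem_region hr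
    have := h0 x hx
    rw [R.gravEq_eq H hx] at this
    simpa [kr, H.metricD_ne hx] using this
  have g1 : ∀ r ∈ I, gravR N f q pe pm e b l r 1 = 0 := fun r hr => by
    obtain ⟨x, hx, rfl⟩ := exists_mem_region hr
    have := h1 x hx
    rw [R.gravEq_eq H hx] at this
    simpa [kr, H.metricD_ne hx] using this
  have hp : deriv pe r + 2 * pe r / r = 0 := by
    obtain ⟨x, hx, rfl⟩ := exists_mem_region hr
    have := hm x hx
    rw [R.maxwellEq_eq H hx] at this
    simpa [kr, H.N_ne _ hr] using this
  have d1 := R.hasDerivAt_gravR_one H hr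
  have d2 : HasDerivAt (fun r => gravR N f q pe pm e b l r 1) 0 r :=
    (hasDerivAt_const r (0 : ℝ)).congr_of_eventuallyEq (by
      filter_upwards [H.isOpen.mem_nhds hr] with y hy using g1 y hy)
  have key := d1.unique d2
  rw [g0 r hr, g1 r hr, hp] at key
  simpa [H.radius_ne r hr] using key

theorem Background.sqrtDet_ne (H : Background N f I) (hx : x ∈ region I) :
    sqrtDet (sssMetric N f) x ≠ 0 := by
  have h1 := H.radius_ne _ hx.1
  have h2 := H.N_ne _ hx.1
  have h4 := sin_ne_of_mem_region hx
  rw [H.sqrtDet_eq hx]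
  positivity

theorem Background.eqN_eqf_eq_zero_iff (H : Background N f I) (hA : IsAnsatz I A)
    (hd : ∀ x ∈ region I, config (sssMetric N f) A x ∈ L.dom) (hx : x ∈ region I) :
    (eqN L N f A x = 0 ∧ eqf L N f A x = 0) ↔
      (gravEq L (sssMetric N f) A x 0 0 = 0 ∧ gravEq L (sssMetric N f) A x 1 1 = 0) := by
  obtain ⟨I', q, pe, pm, e, b, l, hr, -, -, -, h⟩ := H.exists_resolved hA hd hx.1
  have h0 := H.sqrtDet_ne hx
  have h2 := H.N_ne _ hx.1
  have h3 := H.f_ne _ hx.1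
  rw [(h x ⟨hr, hx.2⟩).1, (h x ⟨hr, hx.2⟩).2]
  constructor
  · rintro ⟨k1, k2⟩
    have k3 : gravEq L (sssMetric N f) A x 0 0 = 0 := by simpa [h0, h2, h3] using k1
    exact ⟨k3, by simpa [h0, k3] using k2⟩
  · rintro ⟨k1, k2⟩
    simp [k1, k2]

theorem Background.gravEq_offDiagonal (H : Background N f I) (hA : IsAnsatz I A)
    (hd : ∀ x ∈ region I, config (sssMetric N f) A x ∈ L.dom) (hx : x ∈ region I) {μ ν : Fin 4}
    (h : μ ≠ ν) : gravEq L (sssMetric N f) A x μ ν = 0 := by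
  obtain ⟨I', q, pe, pm, e, b, l, hr, -, H', R, -⟩ := H.exists_resolved hA hd hx.1
  rw [R.gravEq_eq H' ⟨hr, hx.2⟩]
  simp [kr, h]

theorem Background.gravEq_angular (H : Background N f I) (hA : IsAnsatz I A)
    (hd : ∀ x ∈ region I, config (sssMetric N f) A x ∈ L.dom) (hx : x ∈ region I) :
    gravEq L (sssMetric N f) A x 3 3
      = Real.sin (x 2) ^ 2 * gravEq L (sssMetric N f) A x 2 2 := by
  obtain ⟨I', q, pe, pm, e, b, l, hr, -, H', R, -⟩ := H.exists_resolved hA hd hx.1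
  rw [R.gravEq_eq H' ⟨hr, hx.2⟩, R.gravEq_eq H' ⟨hr, hx.2⟩]
  have : gravR N f q pe pm e b l (x 1) 3 = gravR N f q pe pm e b l (x 1) 2 := rfl
  rw [this]
  simp only [metricD, metricR, metricT, kr, if_true, Matrix.cons_val]
  ring

theorem Background.reduced_iff (H : Background N f I) (hA : IsAnsatz I A)
    (hd : ∀ x ∈ region I, config (sssMetric N f) A x ∈ L.dom)
    (hm : ∀ x ∈ region I, ∀ ν, maxwellEq L (sssMetric N f) A x ν = 0) :
    (∀ x ∈ region I, eqN L N f A x = 0 ∧ eqf L N f A x = 0) ↔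
      (∀ x ∈ region I, ∀ μ ν, gravEq L (sssMetric N f) A x μ ν = 0) := by
  refine ⟨fun h x hx => ?_, fun h x hx => (H.eqN_eqf_eq_zero_iff hA hd hx).2 ⟨h x hx 0 0, h x hx 1 1⟩⟩
  have k := fun y hy => (H.eqN_eqf_eq_zero_iff hA hd hy).1 (h y hy)
  obtain ⟨I', q, pe, pm, e, b, l, hr, hs, H', R, -⟩ := H.exists_resolved hA hd hx.1
  have h2 : gravEq L (sssMetric N f) A x 2 2 = 0 := by
    rw [R.gravEq_eq H' ⟨hr, hx.2⟩, R.gravR_two_eq_zero H'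
      (fun y hy => hm y (region_mono hs hy) 0) (fun y hy => (k y (region_mono hs hy)).1)
      (fun y hy => (k y (region_mono hs hy)).2) hr]
    simp
  intro μ ν
  by_cases hμ : μ = ν
  · subst hμ
    fin_cases μ
    exacts [(k x hx).1, (k x hx).2, h2, by
      simpa [h2] using H.gravEq_angular hA hd hx]
  · exact H.gravEq_offDiagonal hA hd hx hμ

/-- The density depends on Φ only through Φ'/N. The weight N cancels this denominator, so ∂L/∂Φ' is
ν sin θ r² pe, and minus its derivative is the Euler–Lagrange expression. -/
theorem Framed.eqPhi_eq {Φ : ℝ → ℝ}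
    (G : Framed L σ ν electricJ N f (electricPotential Φ) I ε ε')
    (H : Background N f I) (hε : ∀ r ∈ I, ε (N r) r = deriv Φ r / N r)
    (hpe : ContDiffOn ℝ ∞ pe I)
    (hp : pe = fun r => fieldDeriv L σ electricJ (curv N f r, deriv Φ r / N r))
    (hx : x ∈ region I) :
    eqPhi L N f Φ x = -(ν * Real.sin (x 2) * (2 * x 1 * pe (x 1) + x 1 ^ 2 * deriv pe (x 1))) := by
  obtain ⟨hr, hθ⟩ := id hx
  set S := Real.sin (x 2)
  have hd : ∀ y ∈ I, frameConfig σ electricJ (curv N f y, deriv Φ y / N y) ∈ L.dom := fun y hy => by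
    rw [← hε y hy]; exact G.mem_dom y hy
  have val : ∀ y ∈ I, ∀ a b c, frameConfig σ electricJ (curv N f y, b / N y) ∈ L.dom →
      reducedLag L N f (electricPotential (quadPoly y a b c)) (Function.update x 1 y)
        = ν * N y * y ^ 2 * S * frameLag L σ electricJ (curv N f y, b / N y) := by
    intro y hy a b c hd
    have hx' : Function.update x 1 y ∈ region I := mem_region_update_r hx hy
    have hf : 0 < σ * f (Function.update x 1 y 1) := by simpa using G.pos_f y hy
    rw [H.reducedLag_eq G.mul_self_σ hx' hf (e := b / N y) (J := electricJ) (fun i j => by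
      rw [fieldStrength_electric, H.frame_electric hx' hf]
      simp [deriv_quadPoly_self]) (by simpa using hd)]
    simp [abs_eq_sign_mul G.mul_self_ν (G.pos_N y hy), S]
  have hα : HasDerivAt (fun a => reducedLag L N f (electricPotential (quadPoly (x 1) a
      (deriv Φ (x 1)) (deriv (deriv Φ) (x 1)))) (Function.update x 1 (x 1))) 0 (Φ (x 1)) := by
    rw [funext fun a => val _ hr a _ _ (hd _ hr)]
    exact hasDerivAt_const _ _
  have hC : ∀ y ∈ I, HasDerivAt (fun c => reducedLag L N f (electricPotential (quadPoly y (Φ y)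
      (deriv Φ y) c)) (Function.update x 1 y)) 0 (deriv (deriv Φ) y) := fun y hy => by
    rw [funext fun c => val y hy _ _ c (hd y hy)]
    exact hasDerivAt_const _ _
  have hB : ∀ y ∈ I, HasDerivAt (fun b => reducedLag L N f (electricPotential (quadPoly y (Φ y)
      b (deriv (deriv Φ) y))) (Function.update x 1 y)) (ν * S * (y ^ 2 * pe y)) (deriv Φ y) := by
    intro y hy
    refine (hasDerivAt_mul_frameLag (w := fun _ => ν * N y * y ^ 2 * S) (k := fun _ => curv N f y)
      (e := fun b => b / N y) (k' := 0)
      G.mul_self_σ G.transpose_J (hd y hy) (fun i => hasDerivAt_const _ _)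
      ((hasDerivAt_id' _).div_const _) (hasDerivAt_const _ _) (.of_forall fun b hd =>
        val y hy _ _ _ hd)).congr_deriv ?_
    have h2 := H.N_ne _ hy
    rw [hp]
    simp
    field_simp
  have key := eulerLagrange_eq
    (𝓁 := fun u s => reducedLag L N f (electricPotential u) (Function.update x 1 s))
    H.isOpen hr hα hB hC (((hasDerivAt_pow 2 (x 1)).fun_mul
      (hasDerivAt_of_smooth H.isOpen hpe hr)).const_mul (ν * S))
    (fun y _ => hasDerivAt_const y 0) (hasDerivAt_const _ 0)
  rw [eqPhi, key]
  simp

theorem Background.eqPhi_eq_zero_iff (H : Background N f I) {Φ : ℝ → ℝ} (hΦ : ContDiffOn ℝ ∞ Φ I)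
    (hd : ∀ x ∈ region I, config (sssMetric N f) (electricPotential Φ) x ∈ L.dom)
    (hx : x ∈ region I) :
    eqPhi L N f Φ x = 0 ↔ ∀ ν, maxwellEq L (sssMetric N f) (electricPotential Φ) x ν = 0 := by
  obtain ⟨σ, ν, I', hσ, hν, hr, hs, H', hf, hN⟩ := H.exists_sign hx.1
  have hd' := fun x hx => hd x (region_mono hs hx)
  have R := H'.resolved_electric hσ hf (hΦ.mono hs) hd'
  have hx' : x ∈ region I' := ⟨hr, hx.2⟩
  obtain ⟨pe, hpe⟩ : ∃ pe, pe = fun r => fieldDeriv L σ electricJ (curv N f r, deriv Φ r / N r) :=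
    ⟨_, rfl⟩
  rw [← hpe] at R
  rw [(H'.framed_electric hσ hν hf hN hd').eqPhi_eq H' (fun _ _ => rfl) R.smooth_pe hpe hx']
  simp only [R.maxwellEq_eq H' hx']
  have h1 := H.radius_ne _ hx.1
  have h2 := H.N_ne _ hx.1
  have h4 := sin_ne_of_mem_region hx
  have h5 : ν ≠ 0 := fun h => by simp [h] at hν
  have e1 : 2 * x 1 * pe (x 1) + x 1 ^ 2 * deriv pe (x 1)
      = x 1 ^ 2 * (deriv pe (x 1) + 2 * pe (x 1) / x 1) := by
    field_simp
    ring
  rw [e1]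
  constructor
  · intro h κ
    have : deriv pe (x 1) + 2 * pe (x 1) / x 1 = 0 := by simpa [h1, h4, h5] using h
    rw [this]
    simp
  · intro h
    have : deriv pe (x 1) + 2 * pe (x 1) / x 1 = 0 := by simpa [kr, h2] using h 0
    rw [this]
    simp

/-- In the frame, χ' appears divided by r² sin θ, which cancels the angular weight in ∂L/∂χ'. On the
ansatz the argument of `fieldDeriv` is P/r², so ∂L/∂χ' is constant in θ; the density depends neither
on χ nor on χ''. -/
theorem Background.eqChi_eq_zero (H : Background N f I) {χ : ℝ → ℝ} {P : ℝ}
    (hχ : ∀ θ ∈ Set.Ioo 0 Real.pi, deriv χ θ = P * Real.sin θ)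
    (hd : ∀ x ∈ region I, config (sssMetric N f) (magneticPotential χ) x ∈ L.dom)
    (hx : x ∈ region I) : eqChi L N f χ x = 0 := by
  obtain ⟨σ, ν, I', hσ, hν, hr, hs, H', hf, hN⟩ := H.exists_sign hx.1
  have G := H'.framed_magnetic hσ hν hf hN hχ fun x hx => hd x (region_mono hs hx)
  have h1 := H.radius_ne _ hx.1
  have hx' : x ∈ region I' := ⟨hr, hx.2⟩
  have hsin : ∀ y ∈ Set.Ioo 0 Real.pi, Real.sin y ≠ 0 := fun y hy =>
    (Real.sin_pos_of_mem_Ioo hy).ne'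
  have he : ∀ y ∈ Set.Ioo 0 Real.pi, deriv χ y / (x 1 ^ 2 * Real.sin y) = P / x 1 ^ 2 :=
    fun y hy => by
      have := hsin y hy
      rw [hχ y hy]
      field_simp
  have hd' : ∀ y ∈ Set.Ioo 0 Real.pi, frameConfig σ magneticJ
      (curv N f (x 1), deriv χ y / (x 1 ^ 2 * Real.sin y)) ∈ L.dom := fun y hy => by
    rw [he y hy]; exact G.mem_dom _ hr
  have val : ∀ y ∈ Set.Ioo 0 Real.pi, ∀ a b c,
      frameConfig σ magneticJ (curv N f (x 1), b / (x 1 ^ 2 * Real.sin y)) ∈ L.dom →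
      reducedLag L N f (magneticPotential (quadPoly y a b c)) (Function.update x 2 y)
        = |N (x 1)| * x 1 ^ 2 * Real.sin y
          * frameLag L σ magneticJ (curv N f (x 1), b / (x 1 ^ 2 * Real.sin y)) := by
    intro y hy a b c hd
    have hx2 : Function.update x 2 y ∈ region I' := mem_region_update_θ hx' hy
    have e1 : Function.update x 2 y 1 = x 1 := rfl
    have hf' : 0 < σ * f (Function.update x 2 y 1) := hf _ hr
    rw [H'.reducedLag_eq hσ hx2 hf' (e := b / (x 1 ^ 2 * Real.sin y)) (J := magneticJ)
      (fun i j => by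
        rw [fieldStrength_magnetic, H'.frame_magnetic hx2]
        simp [deriv_quadPoly_self]) hd, e1]
    simp
  have hα : HasDerivAt (fun a => reducedLag L N f (magneticPotential (quadPoly (x 2) a
      (deriv χ (x 2)) (deriv (deriv χ) (x 2)))) (Function.update x 2 (x 2))) 0 (χ (x 2)) := by
    rw [funext fun a => val _ hx.2 a _ _ (hd' _ hx.2)]
    exact hasDerivAt_const _ _
  have hC : ∀ y ∈ Set.Ioo 0 Real.pi, HasDerivAt (fun c => reducedLag L N f (magneticPotential
      (quadPoly y (χ y) (deriv χ y) c)) (Function.update x 2 y)) 0 (deriv (deriv χ) y) :=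
    fun y hy => by
      rw [funext fun c => val y hy _ _ c (hd' y hy)]
      exact hasDerivAt_const _ _
  have hB : ∀ y ∈ Set.Ioo 0 Real.pi, HasDerivAt (fun b => reducedLag L N f (magneticPotential
      (quadPoly y (χ y) b (deriv (deriv χ) y))) (Function.update x 2 y))
      (|N (x 1)| * fieldDeriv L σ magneticJ (curv N f (x 1), P / x 1 ^ 2)) (deriv χ y) := by
    intro y hy
    refine (hasDerivAt_mul_frameLag (w := fun _ => |N (x 1)| * x 1 ^ 2 * Real.sin y)
      (k := fun _ => curv N f (x 1)) (e := fun b => b / (x 1 ^ 2 * Real.sin y)) (k' := 0)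
      hσ G.transpose_J (hd' y hy) (fun i => hasDerivAt_const _ _)
      ((hasDerivAt_id' _).div_const _) (hasDerivAt_const _ _) (.of_forall fun b hd =>
        val y hy _ _ _ hd)).congr_deriv ?_
    have h2 := hsin y hy
    rw [he y hy]
    simp
    field_simp
  have key := eulerLagrange_eq
    (𝓁 := fun u s => reducedLag L N f (magneticPotential u) (Function.update x 2 s))
    isOpen_Ioo hx.2 hα hB hC (hasDerivAt_const _ _) (fun y _ => hasDerivAt_const y 0)
    (hasDerivAt_const _ 0)
  rw [eqChi, key]
  simp

theorem Background.maxwellEq_magnetic (H : Background N f I) {χ : ℝ → ℝ} {P : ℝ}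
    (hχ : ∀ θ ∈ Set.Ioo 0 Real.pi, deriv χ θ = P * Real.sin θ)
    (hd : ∀ x ∈ region I, config (sssMetric N f) (magneticPotential χ) x ∈ L.dom)
    (hx : x ∈ region I) (κ : Fin 4) :
    maxwellEq L (sssMetric N f) (magneticPotential χ) x κ = 0 := by
  obtain ⟨σ, ν, I', hσ, -, hr, hs, H', hf, -⟩ := H.exists_sign hx.1
  rw [(H'.resolved_magnetic hσ hf hχ fun x hx => hd x (region_mono hs hx)).maxwellEq_eq H'
    ⟨hr, hx.2⟩]
  simp

end

end ReducedAction

end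

/-! ### The equivalence of the reduced and the full field equations. -/

theorem mainTheorem2 (L : Lagrangian) (I : Set ℝ) (hI : IsOpen I) (hIpos : I ⊆ Set.Ioi 0)
    (N f : ℝ → ℝ) (hN : ContDiffOn ℝ ∞ N I) (hf : ContDiffOn ℝ ∞ f I)
    (hN0 : ∀ r ∈ I, N r ≠ 0) (hf0 : ∀ r ∈ I, f r ≠ 0) :
    -- both ansätze
    (∀ A : Pt → Fin 4 → ℝ,
      ((∃ Φ : ℝ → ℝ, ContDiffOn ℝ ∞ Φ I ∧ A = electricPotential Φ) ∨
        (∃ (χ : ℝ → ℝ) (P : ℝ), ContDiffOn ℝ ∞ χ (Set.Ioo 0 Real.pi) ∧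
          (∀ θ ∈ Set.Ioo 0 Real.pi, deriv χ θ = P * Real.sin θ) ∧ A = magneticPotential χ)) →
      (∀ x ∈ region I, config (sssMetric N f) A x ∈ L.dom) →
      -- the reduced equations in terms of the field equations
      (∀ x ∈ region I,
        eqN L N f A x = sqrtDet (sssMetric N f) x
          * (2 / (N (x 1) ^ 3 * f (x 1)) * gravEq L (sssMetric N f) A x 0 0) ∧
        eqf L N f A x = sqrtDet (sssMetric N f) x
          * (1 / (N (x 1) ^ 2 * f (x 1) ^ 2) * gravEq L (sssMetric N f) A x 0 0
            + gravEq L (sssMetric N f) A x 1 1)) ∧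
      (∀ x ∈ region I, (eqN L N f A x = 0 ∧ eqf L N f A x = 0) ↔
        (gravEq L (sssMetric N f) A x 0 0 = 0 ∧ gravEq L (sssMetric N f) A x 1 1 = 0)) ∧
      -- symmetries and off-diagonal components
      (∀ x ∈ region I, ∀ i μ ν, lieD (killing i) (gravEq L (sssMetric N f) A) x μ ν = 0) ∧
      (∀ x ∈ region I, ∀ μ ν, μ ≠ ν → gravEq L (sssMetric N f) A x μ ν = 0) ∧
      (∀ x ∈ region I, gravEq L (sssMetric N f) A x 3 3
        = Real.sin (x 2) ^ 2 * gravEq L (sssMetric N f) A x 2 2) ∧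
      -- Noether identity and angular components
      (∀ x ∈ region I, ∀ ν, divGravEq L (sssMetric N f) A x ν
        = -2 * ∑ l, fieldStrength A x ν l * maxwellEq L (sssMetric N f) A x l) ∧
      ((∀ x ∈ region I, ∀ ν, maxwellEq L (sssMetric N f) A x ν = 0) →
        ((∀ x ∈ region I, eqN L N f A x = 0 ∧ eqf L N f A x = 0) ↔
          (∀ x ∈ region I, ∀ μ ν, gravEq L (sssMetric N f) A x μ ν = 0)))) ∧
    -- electric ansatz: equivalence of the reduced and the full equations
    (∀ Φ : ℝ → ℝ, ContDiffOn ℝ ∞ Φ I →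
      (∀ x ∈ region I, config (sssMetric N f) (electricPotential Φ) x ∈ L.dom) →
      ((∀ x ∈ region I, eqPhi L N f Φ x = 0) ↔
        (∀ x ∈ region I, ∀ ν, maxwellEq L (sssMetric N f) (electricPotential Φ) x ν = 0)) ∧
      ((∀ x ∈ region I, eqN L N f (electricPotential Φ) x = 0 ∧
          eqf L N f (electricPotential Φ) x = 0 ∧ eqPhi L N f Φ x = 0) ↔
        (∀ x ∈ region I,
          (∀ μ ν, gravEq L (sssMetric N f) (electricPotential Φ) x μ ν = 0) ∧
          (∀ ν, maxwellEq L (sssMetric N f) (electricPotential Φ) x ν = 0)))) ∧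
    -- magnetic ansatz: equivalence of the reduced and the full equations
    (∀ (χ : ℝ → ℝ) (P : ℝ), ContDiffOn ℝ ∞ χ (Set.Ioo 0 Real.pi) →
      (∀ θ ∈ Set.Ioo 0 Real.pi, deriv χ θ = P * Real.sin θ) →
      (∀ x ∈ region I, config (sssMetric N f) (magneticPotential χ) x ∈ L.dom) →
      (∀ x ∈ region I, eqChi L N f χ x = 0 ∧
        ∀ ν, maxwellEq L (sssMetric N f) (magneticPotential χ) x ν = 0) ∧
      ((∀ x ∈ region I, eqN L N f (magneticPotential χ) x = 0 ∧
          eqf L N f (magneticPotential χ) x = 0) ↔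
        (∀ x ∈ region I,
          (∀ μ ν, gravEq L (sssMetric N f) (magneticPotential χ) x μ ν = 0) ∧
          (∀ ν, maxwellEq L (sssMetric N f) (magneticPotential χ) x ν = 0)))) := by
  have H : Background N f I := ⟨hI, fun r hr => (hIpos hr).ne', hN, hf, hN0, hf0⟩
  refine ⟨fun A hA hd => ⟨fun x hx => ?_, fun x hx => H.eqN_eqf_eq_zero_iff hA hd hx,
    fun x hx i μ ν => ?_, fun x hx μ ν h => H.gravEq_offDiagonal hA hd hx h,
    fun x hx => H.gravEq_angular hA hd hx, fun x hx ν => ?_, H.reduced_iff hA hd⟩,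
    fun Φ hΦ hd => ?_, fun χ P hχ hχ' hd => ?_⟩
  · obtain ⟨I', q, pe, pm, e, b, l, hr, -, -, -, h⟩ := H.exists_resolved hA hd hx.1
    exact h x ⟨hr, hx.2⟩
  · obtain ⟨I', q, pe, pm, e, b, l, hr, -, H', R, -⟩ := H.exists_resolved hA hd hx.1
    exact R.lieD_gravEq H' ⟨hr, hx.2⟩ i μ ν
  · obtain ⟨I', q, pe, pm, e, b, l, hr, -, H', R, -⟩ := H.exists_resolved hA hd hx.1
    exact R.divGravEq_eq H' ⟨hr, hx.2⟩ ν
  · have hA : IsAnsatz I (electricPotential Φ) := .inl ⟨Φ, hΦ, rfl⟩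
    have hm := fun x hx => H.eqPhi_eq_zero_iff hΦ hd (x := x) hx
    refine ⟨forall₂_congr hm, fun h => ?_, fun h x hx => ?_⟩
    · have hm' := fun x hx => (hm x hx).1 (h x hx).2.2
      have hg := (H.reduced_iff hA hd hm').1 fun x hx => ⟨(h x hx).1, (h x hx).2.1⟩
      exact fun x hx => ⟨hg x hx, hm' x hx⟩
    · have hr := (H.eqN_eqf_eq_zero_iff hA hd hx).2 ⟨(h x hx).1 0 0, (h x hx).1 1 1⟩
      exact ⟨hr.1, hr.2, (hm x hx).2 (h x hx).2⟩
  · have hA : IsAnsatz I (magneticPotential χ) := .inr ⟨χ, P, hχ, hχ', rfl⟩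
    have hm := fun x hx => H.maxwellEq_magnetic hχ' hd (x := x) hx
    refine ⟨fun x hx => ⟨H.eqChi_eq_zero hχ' hd hx, hm x hx⟩, ?_⟩
    rw [H.reduced_iff hA hd hm]
    exact forall₂_congr fun x hx => ⟨fun h => ⟨h, hm x hx⟩, fun h => h.1⟩
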